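/- **Problem.** Let $f(x)=\mathbb E[F(x;\xi)]$ with $\xi\sim\mathcal P$, $F(\cdot;\xi):\mathbb R^d\to\mathbb R$, and let $c:\mathbb R^d\to\mathbb R^m$. Consider $\min f(x)$ subject to $c(x)=0$. Write $G=\nabla^Tc\in\mathbb R^{m\times d}$, $\mathcal L(x,\lambda)=f(x)+\lambda^Tc(x)$, $\nabla_x\mathcal L=\nabla f+G^T\lambda$, $\nabla\mathcal L=(\nabla_x\mathcal L,c)$, $M=\nabla_x^2\mathcal L\,G^T+T$ where $T$ has columns $\nabla^2c_j\nabla_x\mathcal L$, and $$\mathcal L_{\mu,\nu}(x,\lambda)=\mathcal L(x,\lambda)+\tfrac\mu2\|c(x)\|^2+\tfrac\nu2\|G(x)\nabla_x\mathcal L(x,\lambda)\|^2 .$$ A subscript or superscript $k$ means evaluation at $(x^k,\lambda^k)$; stacked vectors carry the Euclidean norm and matrices the operator norm. **Algorithm.** Parameters: $\nu\ge\gamma_{RH}>0$, $\bar\alpha_0=\alpha_{max}>0$, $\mu_0,\bar\epsilon_0,\kappa_{grad}>0$, $\rho>1$, $p_{grad},p_f,\beta\in(0,1)$, $\kappa_f\in(0,\beta/(4\alpha_{max}))$.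 In iteration $k=0,1,2,\dots$ (with $\bar\mu_{-1}=\mu_0$): 1. Draw a sample set $\xi_g^k$ with $|\xi_g^k|\ge|\xi_g^{k-1}|+1$ ($|\xi_g^{-1}|=0$). Let $\bar g_k,\bar H_k$ be the averages of $\nabla F(x^k;\cdot),\nabla^2F(x^k;\cdot)$ over $\xi_g^k$, and let $\bar\nabla_x\mathcal L^k,\bar M_k$ be $\nabla_x\mathcal L^k,M_k$ with $\nabla f_k,\nabla^2f_k$ replaced by $\bar g_k,\bar H_k$. It is required that $P(\mathcal A_k^c\mid\mathcal F_{k-1})\le p_{grad}$, where, with $r_k=\begin{pmatrix}\bar\nabla_x\mathcal L^k+\nu\bar M_kG_k\bar\nabla_x\mathcal L^k+G_k^Tc_k\\ \nu G_kG_k^TG_k\bar\nabla_x\mathcal L^k\end{pmatrix}$, $$\mathcal A_k=\left\{\left\|\begin{pmatrix}\bar g_k-\nabla f_k+\nu(\bar M_kG_k\bar\nabla_x\mathcal L^k-M_kG_k\nabla_x\mathcal L^k)\\ \nu G_kG_k^TG_k(\bar g_k-\nabla f_k)\end{pmatrix}\right\|\le\kappa_{grad}\bar\alpha_k\|r_k\|\right\}.$$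 2. Generate $B_k$ ($\mathcal F_{k-0.5}$-measurable) with $v^TB_kv\ge\gamma_{RH}\|v\|^2$ whenever $G_kv=0$, and compute $(\bar\Delta x^k,\bar\Delta\lambda^k)$ from $$B_k\bar\Delta x^k+G_k^T\tilde\Delta\lambda^k=-\bar\nabla_x\mathcal L^k,\qquad G_k\bar\Delta x^k=-c_k,\qquad G_kG_k^T\bar\Delta\lambda^k=-(G_k\bar\nabla_x\mathcal L^k+\bar M_k^T\bar\Delta x^k).$$ 3. Let $\bar\nabla\mathcal L_{\mu,\nu}^k=\begin{pmatrix}(I+\nu\bar M_kG_k)\bar\nabla_x\mathcal L^k+\mu G_k^Tc_k\\ c_k+\nu G_kG_k^TG_k\bar\nabla_x\mathcal L^k\end{pmatrix}$, $\bar\Delta^k=(\bar\Delta x^k,\bar\Delta\lambda^k)$ and $s_k=\begin{pmatrix}\bar\Delta x^k\\ G_k\bar\nabla_x\mathcal L^k\end{pmatrix}$. Starting from $\mu=\bar\mu_{k-1}$, replace $\mu$ by $\rho\mu$ until $(\bar\nabla\mathcal L^k_{\mu,\nu})^T\bar\Delta^k\le-\frac{\gamma_{RH}}2\|s_k\|^2$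 and $\|c_k\|\le\|\bar\nabla\mathcal L^k_{\mu,\nu}\|$; call the result $\bar\mu_k$. Put $S_k=(\bar\nabla\mathcal L^k_{\bar\mu_k,\nu})^T\bar\Delta^k$. 4. Draw a nonempty sample set $\xi_f^k$, and let $\bar{\mathcal L}^k,\bar{\mathcal L}^{s_k}$ be the estimates of $\mathcal L_{\bar\mu_k,\nu}$ at $(x^k,\lambda^k)$ and at the test point $(x^{s_k},\lambda^{s_k})=(x^k,\lambda^k)+\bar\alpha_k\bar\Delta^k$, obtained by replacing $f,\nabla f$ by their sample averages over $\xi_f^k$. With $e_k=|\bar{\mathcal L}^k-\mathcal L_{\bar\mu_k,\nu}^k|$, $e_{s_k}=|\bar{\mathcal L}^{s_k}-\mathcal L_{\bar\mu_k,\nu}^{s_k}|$ and $\mathcal B_k=\{e_k\vee e_{s_k}\le-\kappa_f\bar\alpha_k^2S_k\}$ it is required that $P(\mathcal B_k^c\mid\mathcal F_{k-0.5})\le p_f$ and $\mathbb E[e_k^2\mid\mathcal F_{k-0.5}]\vee\mathbb E[e_{s_k}^2\mid\mathcal F_{k-0.5}]\le\bar\epsilon_k^2$. 5. If $\bar{\mathcal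 L}^{s_k}\le\bar{\mathcal L}^k+\bar\alpha_k\beta S_k$, let $(x^{k+1},\lambda^{k+1})=(x^{s_k},\lambda^{s_k})$, $\bar\alpha_{k+1}=\alpha_{max}\wedge\rho\bar\alpha_k$, and $\bar\epsilon_{k+1}=\rho\bar\epsilon_k$ if $-\bar\alpha_k\beta S_k\ge\bar\epsilon_k$, $\bar\epsilon_{k+1}=\bar\epsilon_k/\rho$ otherwise. If not, let $(x^{k+1},\lambda^{k+1})=(x^k,\lambda^k)$, $\bar\alpha_{k+1}=\bar\alpha_k/\rho$, $\bar\epsilon_{k+1}=\bar\epsilon_k/\rho$. Here $\mathcal F_{k-1}=\sigma(x^0,\lambda^0,\xi_g^j,\xi_f^j:j<k)$ and $\mathcal F_{k-0.5}=\mathcal F_{k-1}\vee\sigma(\xi_g^k)$. For each $n$ the batch of $n$ points available for $\xi_g^k$ (for $\xi_f^k$) consists of i.i.d. draws from $\mathcal P$ that are independent of $\mathcal F_{k-1}$ (of $\mathcal F_{k-0.5}$); the sample size that selects one of these batches may be any random variable, possibly depending on the draws. The iterates, $\bar\alpha_k$ and $\bar\epsilon_k$ are $\mathcal F_{k-1}$-measurable;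 $\bar\Delta x^k,\bar\Delta\lambda^k,\bar\mu_k$ are $\mathcal F_{k-0.5}$-measurable. **Assumptions.** $(x^k,\lambda^k)\in\mathcal X\times\Lambda$ almost surely for all $k$, with $\mathcal X,\Lambda$ convex and compact; $f,c$ are three times continuously differentiable, and $F(\cdot;\xi)$ is twice differentiable, on a neighbourhood of $\mathcal X$; $G(x)$ has full row rank for $x\in\mathcal X$; $\|B_k\|\le\kappa_B$; $\|\nabla\mathcal L^k\|\wedge\|\bar\Delta^k\|>0$; for $x\in\mathcal X$, $\mathbb E[\nabla F(x;\xi)]=\nabla f(x)$, $\mathbb E[\nabla^2F(x;\xi)]=\nabla^2f(x)$, and almost surely $|F(x;\xi)-f(x)|\le M_0$, $\|\nabla F(x;\xi)-\nabla f(x)\|\le M_1$, $\|\nabla^2F(x;\xi)-\nabla^2f(x)\|\le M_2$ for all $x\in\mathcal X$. **Theorem.** (i) There are constants $\tilde\mu,\kappa,\Upsilon_1,\Upsilon_3,\Upsilon_4$, depending only on the problem, $\mathcal X,\Lambda,M_0,M_1,M_2,\nu,\gamma_{RH},\kappa_B,\rho,\mu_0$, such that for every execution of the algorithm under the assumptions,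 almost surely for all $k$, $$\bar\mu_k\le\tilde\mu,\qquad \|r_k\|\le\Upsilon_1\|s_k\|,\qquad \|\bar\Delta^k\|\le\Upsilon_3\|s_k\|,\qquad \|\bar\nabla\mathcal L^k_{\bar\mu_k,\nu}\|\le\Upsilon_4\|s_k\|,$$ and $\|\nabla^2\mathcal L_{\mu,\nu}\|\le\kappa$ on $\mathcal X\times\Lambda$ for all $\mu\in[0,\tilde\mu]$. (ii) Consider an execution of the algorithm under the assumptions, and any deterministic constants $\tilde\mu,\kappa,\Upsilon_1,\Upsilon_3,\Upsilon_4$ with the properties listed in (i) for this execution. Suppose that $\omega\in(0,1)$ satisfies $$\frac{\omega}{1-\omega}\ge\frac{32\rho\big(\kappa\,\alpha_{max}\Upsilon_3\vee(\kappa_{grad}\alpha_{max}\Upsilon_1+\Upsilon_4)\big)^2}{\beta\gamma_{RH}}\vee4(\rho-1),$$ and that $$\frac{p_{grad}+\sqrt{p_f}}{(1-p_{grad})(1-p_f)}\le\frac{\rho-1}{8\rho}\Big(\frac1\rho\wedge\frac{1-\omega}{\omega}\Big).$$ Then $\liminf_{k\to\infty}\|\nabla\mathcal L(x^k,\lambda^k)\|=0$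 almost surely. -/

import Mathlib

open MeasureTheory ProbabilityTheory Filter Topology
open scoped RealInnerProductSpace

noncomputable section

/-- `ℝⁿ` with its Euclidean norm. -/
abbrev Vec (n : ℕ) : Type := EuclideanSpace ℝ (Fin n)

/-- Primal-dual vectors `(a, b) ∈ ℝᵈ × ℝᵐ = ℝᵈ⁺ᵐ`, with the Euclidean norm. -/
abbrev PD (d m : ℕ) : Type := WithLp 2 (Vec d × Vec m)

/-- The stacked vector `(a; b)`. -/
def stack {d m : ℕ} (a : Vec d) (b : Vec m) : PD d m := WithLp.toLp 2 (a, b)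

/-- The Hessian `∇²h(x)` of a real function, as a linear operator. -/
def hess {V : Type*} [NormedAddCommGroup V] [InnerProductSpace ℝ V] [CompleteSpace V]
    (h : V → ℝ) (x : V) : V →L[ℝ] V :=
  fderiv ℝ (gradient h) x

/-- The average of `h` over the batch `z` of `n` sample points. -/
def batchMean {Ξ V : Type*} [AddCommGroup V] [Module ℝ V] {n : ℕ}
    (h : Ξ → V) (z : Fin n → Ξ) : V :=
  (n : ℝ)⁻¹ • ∑ i, h (z i)

/-- The data of the problem `min f(x) = 𝔼[F(x; ξ)]` subject to `c(x) = 0`, with `ξ ∼ P`. -/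
structure Problem (d m : ℕ) (Ξ : Type*) [MeasurableSpace Ξ] where
  /-- the law of `ξ` -/
  P : Measure Ξ
  isProb : IsProbabilityMeasure P
  /-- the realizations `F(x; ξ)` of the objective -/
  F : Vec d → Ξ → ℝ
  /-- the constraint -/
  c : Vec d → Vec m

namespace Problem

attribute [instance] Problem.isProb

variable {d m : ℕ} {Ξ : Type*} [MeasurableSpace Ξ] (Q : Problem d m Ξ)

/-- The objective `f(x) = 𝔼[F(x; ξ)]`. -/
def f (x : Vec d) : ℝ := ∫ ζ, Q.F x ζ ∂Q.P

/-- `∇F(x; ζ)`, the gradient in `x`. -/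
def gradF (x : Vec d) (ζ : Ξ) : Vec d := gradient (fun y => Q.F y ζ) x

/-- `∇²F(x; ζ)`, the Hessian in `x`. -/
def hessF (x : Vec d) (ζ : Ξ) : Vec d →L[ℝ] Vec d := hess (fun y => Q.F y ζ) x

/-- The Jacobian `G(x)` of the constraint. -/
def G (x : Vec d) : Vec d →L[ℝ] Vec m := fderiv ℝ Q.c x

/-- `G(x)ᵀ`. -/
def GT (x : Vec d) : Vec m →L[ℝ] Vec d := ContinuousLinearMap.adjoint (Q.G x)

/-- `∇²cⱼ(x)`. -/
def hessC (j : Fin m) (x : Vec d) : Vec d →L[ℝ] Vec d := hess (fun y => Q.c y j) x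

/-- `g + G(x)ᵀλ`: this is `∇ₓ𝓛(x, λ)` if `g = ∇f(x)`, and its estimate if `g` is an estimate of
`∇f(x)`. -/
def gradLag (g : Vec d) (x : Vec d) (l : Vec m) : Vec d := g + Q.GT x l

/-- `H + ∑ⱼ λⱼ∇²cⱼ(x)`: this is `∇ₓ²𝓛(x, λ)` or its estimate. -/
def hessLag (H : Vec d →L[ℝ] Vec d) (x : Vec d) (l : Vec m) : Vec d →L[ℝ] Vec d :=
  H + ∑ j, l j • Q.hessC j x

/-- The `d × m` matrix `T` with columns `∇²cⱼ(x) (g + G(x)ᵀλ)`. -/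
def matT (g : Vec d) (x : Vec d) (l : Vec m) : Vec m →L[ℝ] Vec d :=
  ∑ j, (EuclideanSpace.proj j : Vec m →L[ℝ] ℝ).smulRight (Q.hessC j x (Q.gradLag g x l))

/-- The `d × m` matrix `M = ∇ₓ²𝓛 Gᵀ + T`, or its estimate when `g`, `H` are estimates. -/
def matM (g : Vec d) (H : Vec d →L[ℝ] Vec d) (x : Vec d) (l : Vec m) : Vec m →L[ℝ] Vec d :=
  (Q.hessLag H x l).comp (Q.GT x) + Q.matT g x l

/-- The gradient `∇𝓛_{μ,ν}(x, λ)` of the augmented Lagrangian, or its estimate: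
`((I + νMG)∇ₓ𝓛 + μGᵀc ; c + νGGᵀG∇ₓ𝓛)`. -/
def meritGrad (μ ν : ℝ) (g : Vec d) (H : Vec d →L[ℝ] Vec d) (x : Vec d) (l : Vec m) : PD d m :=
  stack
    (Q.gradLag g x l + ν • Q.matM g H x l (Q.G x (Q.gradLag g x l)) + μ • Q.GT x (Q.c x))
    (Q.c x + ν • Q.G x (Q.GT x (Q.G x (Q.gradLag g x l))))

/-- The value of the augmented Lagrangian computed from a function value `v` and a gradient `g`:
`v + λᵀc + (μ/2)‖c‖² + (ν/2)‖G(g + Gᵀλ)‖²`. -/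
def meritVal (μ ν : ℝ) (v : ℝ) (g : Vec d) (x : Vec d) (l : Vec m) : ℝ :=
  v + ⟪l, Q.c x⟫ + μ / 2 * ‖Q.c x‖ ^ 2 + ν / 2 * ‖Q.G x (Q.gradLag g x l)‖ ^ 2

/-- The exact augmented Lagrangian `𝓛_{μ,ν}(x, λ)`. -/
def merit (μ ν : ℝ) (x : Vec d) (l : Vec m) : ℝ :=
  Q.meritVal μ ν (Q.f x) (gradient Q.f x) x l

/-- The full Hessian `∇²𝓛_{μ,ν}(x, λ)` in the primal-dual variable. -/
def meritHess (μ ν : ℝ) (x : Vec d) (l : Vec m) : PD d m →L[ℝ] PD d m :=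
  hess (fun p : PD d m => Q.merit μ ν p.ofLp.1 p.ofLp.2) (stack x l)

/-- `‖∇𝓛(x, λ)‖ = ‖(∇f(x) + G(x)ᵀλ ; c(x))‖`. -/
def kktResidual (x : Vec d) (l : Vec m) : ℝ :=
  ‖stack (Q.gradLag (gradient Q.f x) x l) (Q.c x)‖

/-- The part of the assumptions that concerns the problem only. -/
structure Regular (X : Set (Vec d)) (Lam : Set (Vec m)) (M0 M1 M2 : ℝ) : Prop where
  measurable_F : Measurable fun p : Vec d × Ξ => Q.F p.1 p.2
  measurable_gradF : Measurable fun p : Vec d × Ξ => Q.gradF p.1 p.2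
  measurable_hessF : Measurable fun p : Vec d × Ξ => Q.hessF p.1 p.2
  measurable_c : Measurable Q.c
  integrable_F : ∀ x, Integrable (Q.F x) Q.P
  compact_X : IsCompact X
  convex_X : Convex ℝ X
  compact_Lam : IsCompact Lam
  convex_Lam : Convex ℝ Lam
  /-- `f` and `c` are three times continuously differentiable, and the realizations of the
  objective are twice differentiable, on a neighbourhood of `X`. -/
  smooth : ∃ U : Set (Vec d), IsOpen U ∧ X ⊆ U ∧ ContDiffOn ℝ 3 Q.f U ∧ ContDiffOn ℝ 3 Q.c U ∧
    ∀ᵐ ζ ∂Q.P, ∀ x ∈ U, DifferentiableAt ℝ (fun y => Q.F y ζ) x ∧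
      DifferentiableAt ℝ (gradient fun y => Q.F y ζ) x
  /-- `G(x)` has full row rank. -/
  full_rank : ∀ x ∈ X, Function.Surjective (Q.G x)
  unbiased_grad : ∀ x ∈ X, ∫ ζ, Q.gradF x ζ ∂Q.P = gradient Q.f x
  unbiased_hess : ∀ x ∈ X, ∫ ζ, Q.hessF x ζ ∂Q.P = hess Q.f x
  noise_F : ∀ᵐ ζ ∂Q.P, ∀ x ∈ X, |Q.F x ζ - Q.f x| ≤ M0
  noise_gradF : ∀ᵐ ζ ∂Q.P, ∀ x ∈ X, ‖Q.gradF x ζ - gradient Q.f x‖ ≤ M1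
  noise_hessF : ∀ᵐ ζ ∂Q.P, ∀ x ∈ X, ‖Q.hessF x ζ - hess Q.f x‖ ≤ M2

end Problem

/-- The parameters that enter the search direction and the penalty update. -/
structure PenaltyParams where
  (nu gammaRH kappaB rho mu0 : ℝ)
  gammaRH_pos : 0 < gammaRH
  gammaRH_le_nu : gammaRH ≤ nu
  one_lt_rho : 1 < rho
  mu0_pos : 0 < mu0

/-- The parameters that enter the sampling conditions and the line search. -/
structure LineSearchParams where
  (alphaMax eps0 kappaGrad kappaF beta pGrad pF : ℝ)
  alphaMax_pos : 0 < alphaMax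
  eps0_pos : 0 < eps0
  kappaGrad_pos : 0 < kappaGrad
  beta_mem : beta ∈ Set.Ioo (0 : ℝ) 1
  pGrad_mem : pGrad ∈ Set.Ioo (0 : ℝ) 1
  pF_mem : pF ∈ Set.Ioo (0 : ℝ) 1
  kappaF_mem : kappaF ∈ Set.Ioo (0 : ℝ) (beta / (4 * alphaMax))

/-- The random quantities occurring in an execution of the adaptive stochastic SQP. -/
structure Trajectory (d m : ℕ) (Ξ Ω : Type*) where
  /-- primal iterate `xᵏ` -/
  x : ℕ → Ω → Vec d
  /-- dual iterate `λᵏ` -/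
  lam : ℕ → Ω → Vec m
  /-- stepsize -/
  alpha : ℕ → Ω → ℝ
  /-- reliability parameter -/
  eps : ℕ → Ω → ℝ
  /-- penalty parameter of iteration `k`, after the while loop -/
  mu : ℕ → Ω → ℝ
  /-- the matrix `Bₖ` -/
  B : ℕ → Ω → (Vec d →L[ℝ] Vec d)
  /-- primal search direction -/
  dx : ℕ → Ω → Vec d
  /-- dual search direction -/
  dlam : ℕ → Ω → Vec m
  /-- the number of samples used in iteration `k` for the derivatives -/
  Ng : ℕ → Ω → ℕ
  /-- `Zg k n`: the batch of `n` samples that is used for the derivatives if `Ng k = n` -/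
  Zg : ℕ → (n : ℕ) → Ω → (Fin n → Ξ)
  /-- the number of samples used in iteration `k` for the merit function -/
  Nf : ℕ → Ω → ℕ
  /-- `Zf k n`: the batch of `n` samples that is used for the merit function if `Nf k = n` -/
  Zf : ℕ → (n : ℕ) → Ω → (Fin n → Ξ)

namespace Trajectory

variable {d m : ℕ} {Ξ Ω : Type*} [MeasurableSpace Ξ]
  (R : Trajectory d m Ξ Ω) (Q : Problem d m Ξ) (pen : PenaltyParams) (ls : LineSearchParams)
  (k : ℕ) (ω : Ω)

/-- The sample set used for the derivatives, together with its size. -/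
def xiG : Σ n : ℕ, (Fin n → Ξ) := ⟨R.Ng k ω, R.Zg k (R.Ng k ω) ω⟩

/-- The sample set used for the merit function, together with its size. -/
def xiF : Σ n : ℕ, (Fin n → Ξ) := ⟨R.Nf k ω, R.Zf k (R.Nf k ω) ω⟩

/-- `𝓕_{k-1}`: generated by the initial point and all samples drawn before iteration `k`. -/
@[reducible] def past : MeasurableSpace Ω :=
  MeasurableSpace.comap (R.x 0) inferInstance ⊔ MeasurableSpace.comap (R.lam 0) inferInstance ⊔
    ⨆ j : Fin k, (MeasurableSpace.comap (R.xiG j) inferInstance ⊔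
      MeasurableSpace.comap (R.xiF j) inferInstance)

/-- `𝓕_{k-0.5}`: generated in addition by the derivative samples of iteration `k`. -/
@[reducible] def mid : MeasurableSpace Ω :=
  R.past k ⊔ MeasurableSpace.comap (R.xiG k) inferInstance

/-- The estimate `ḡₖ` of `∇f(xᵏ)`. -/
def gBar : Vec d := batchMean (Q.gradF (R.x k ω)) (R.xiG k ω).2

/-- The estimate `H̄ₖ` of `∇²f(xᵏ)`. -/
def HBar : Vec d →L[ℝ] Vec d := batchMean (Q.hessF (R.x k ω)) (R.xiG k ω).2

/-- The estimate of `∇ₓ𝓛ᵏ`. -/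
def gradLagBar : Vec d := Q.gradLag (R.gBar Q k ω) (R.x k ω) (R.lam k ω)

/-- `∇ₓ𝓛ᵏ`. -/
def gradLagTrue : Vec d := Q.gradLag (gradient Q.f (R.x k ω)) (R.x k ω) (R.lam k ω)

/-- `M̄ₖ`. -/
def MBar : Vec m →L[ℝ] Vec d :=
  Q.matM (R.gBar Q k ω) (R.HBar Q k ω) (R.x k ω) (R.lam k ω)

/-- `Mₖ`. -/
def MTrue : Vec m →L[ℝ] Vec d :=
  Q.matM (gradient Q.f (R.x k ω)) (hess Q.f (R.x k ω)) (R.x k ω) (R.lam k ω)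

/-- `Gₖ`. -/
def Gk : Vec d →L[ℝ] Vec m := Q.G (R.x k ω)

/-- `Gₖᵀ`. -/
def GkT : Vec m →L[ℝ] Vec d := Q.GT (R.x k ω)

/-- `cₖ`. -/
def ck : Vec m := Q.c (R.x k ω)

/-- The vector `(∇̄ₓ𝓛ᵏ + νM̄ₖGₖ∇̄ₓ𝓛ᵏ + Gₖᵀcₖ ; νGₖGₖᵀGₖ∇̄ₓ𝓛ᵏ)`. -/
def refVec : PD d m :=
  stack
    (R.gradLagBar Q k ω + pen.nu • R.MBar Q k ω (R.Gk Q k ω (R.gradLagBar Q k ω)) +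
      R.GkT Q k ω (R.ck Q k ω))
    (pen.nu • R.Gk Q k ω (R.GkT Q k ω (R.Gk Q k ω (R.gradLagBar Q k ω))))

/-- The event `𝓐ₖ` that the gradient of the merit function is estimated accurately. -/
def eventA : Set Ω :=
  {ω | ‖stack
      (R.gBar Q k ω - gradient Q.f (R.x k ω) +
        pen.nu • (R.MBar Q k ω (R.Gk Q k ω (R.gradLagBar Q k ω)) -
          R.MTrue Q k ω (R.Gk Q k ω (R.gradLagTrue Q k ω))))
      (pen.nu • R.Gk Q k ω (R.GkT Q k ω (R.Gk Q k ω
        (R.gBar Q k ω - gradient Q.f (R.x k ω)))))‖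
    ≤ ls.kappaGrad * R.alpha k ω * ‖R.refVec Q pen k ω‖}

/-- The estimate of `∇𝓛_{μ,ν}ᵏ`. -/
def meritGradBar (μ : ℝ) : PD d m :=
  Q.meritGrad μ pen.nu (R.gBar Q k ω) (R.HBar Q k ω) (R.x k ω) (R.lam k ω)

/-- The search direction. -/
def dir : PD d m := stack (R.dx k ω) (R.dlam k ω)

/-- The vector `(Δ̄xᵏ ; Gₖ∇̄ₓ𝓛ᵏ)`. -/
def scaleVec : PD d m := stack (R.dx k ω) (R.Gk Q k ω (R.gradLagBar Q k ω))

/-- The search direction solves the two Newton systems. -/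
def NewtonSystem : Prop :=
  (∃ dlamTilde : Vec m,
    R.B k ω (R.dx k ω) + R.GkT Q k ω dlamTilde = -R.gradLagBar Q k ω ∧
    R.Gk Q k ω (R.dx k ω) = -R.ck Q k ω) ∧
  R.Gk Q k ω (R.GkT Q k ω (R.dlam k ω)) =
    -(R.Gk Q k ω (R.gradLagBar Q k ω) +
      ContinuousLinearMap.adjoint (R.MBar Q k ω) (R.dx k ω))

/-- The exit condition of the while loop for the penalty parameter. -/
def PenaltyOK (μ : ℝ) : Prop :=
  ⟪R.meritGradBar Q pen k ω μ, R.dir k ω⟫ ≤ -(pen.gammaRH / 2) * ‖R.scaleVec Q k ω‖ ^ 2 ∧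
  ‖R.ck Q k ω‖ ≤ ‖R.meritGradBar Q pen k ω μ‖

/-- The penalty parameter before the while loop of iteration `k`. -/
def muBefore : ℝ := match k with
  | 0 => pen.mu0
  | j + 1 => R.mu j ω

/-- `R.mu k` is the output of the while loop: if the loop stops after exactly `j`
multiplications by `ρ`, the result is `ρʲ` times the starting value. (That the loop stops is not
presumed.) -/
def PenaltyUpdate : Prop :=
  ∀ j : ℕ, R.PenaltyOK Q pen k ω (pen.rho ^ j * R.muBefore pen k ω) →
    (∀ i < j, ¬ R.PenaltyOK Q pen k ω (pen.rho ^ i * R.muBefore pen k ω)) →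
    R.mu k ω = pen.rho ^ j * R.muBefore pen k ω

/-- The directional derivative `(∇̄𝓛_{μ̄ₖ,ν}ᵏ)ᵀ(Δ̄xᵏ, Δ̄λᵏ)`. -/
def slope : ℝ := ⟪R.meritGradBar Q pen k ω (R.mu k ω), R.dir k ω⟫

/-- The primal test point. -/
def xTrial : Vec d := R.x k ω + R.alpha k ω • R.dx k ω

/-- The dual test point. -/
def lamTrial : Vec m := R.lam k ω + R.alpha k ω • R.dlam k ω

/-- The merit function at `(y, l)` with the objective and its gradient estimated from the samples
`ξ_fᵏ`. -/
def meritBarAt (y : Vec d) (l : Vec m) : ℝ :=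
  Q.meritVal (R.mu k ω) pen.nu (batchMean (Q.F y) (R.xiF k ω).2)
    (batchMean (Q.gradF y) (R.xiF k ω).2) y l

/-- The estimated merit function at the current iterate. -/
def meritBar : ℝ := R.meritBarAt Q pen k ω (R.x k ω) (R.lam k ω)

/-- The estimated merit function at the test point. -/
def meritBarTrial : ℝ := R.meritBarAt Q pen k ω (R.xTrial k ω) (R.lamTrial k ω)

/-- The estimation error of the merit function at the current iterate. -/
def meritErr : ℝ :=
  R.meritBar Q pen k ω - Q.merit (R.mu k ω) pen.nu (R.x k ω) (R.lam k ω)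

/-- The estimation error of the merit function at the test point. -/
def meritErrTrial : ℝ :=
  R.meritBarTrial Q pen k ω - Q.merit (R.mu k ω) pen.nu (R.xTrial k ω) (R.lamTrial k ω)

/-- The event `𝓑ₖ` that the merit function is estimated accurately. -/
def eventB : Set Ω :=
  {ω | max |R.meritErr Q pen k ω| |R.meritErrTrial Q pen k ω| ≤
    -(ls.kappaF * R.alpha k ω ^ 2 * R.slope Q pen k ω)}

/-- The stochastic Armijo condition (the step is successful). -/
def Armijo : Prop :=
  R.meritBarTrial Q pen k ω ≤
    R.meritBar Q pen k ω + R.alpha k ω * ls.beta * R.slope Q pen k ω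

/-- The sufficient decrease condition (a successful step is reliable). -/
def Reliable : Prop := R.eps k ω ≤ -(R.alpha k ω * ls.beta * R.slope Q pen k ω)

/-- The update of the iterate, the stepsize and the reliability parameter. -/
structure LineSearchUpdate : Prop where
  success : R.Armijo Q pen ls k ω →
    R.x (k + 1) ω = R.xTrial k ω ∧ R.lam (k + 1) ω = R.lamTrial k ω ∧
    R.alpha (k + 1) ω = min ls.alphaMax (pen.rho * R.alpha k ω)
  reliable : R.Armijo Q pen ls k ω → R.Reliable Q pen ls k ω →
    R.eps (k + 1) ω = pen.rho * R.eps k ω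
  unreliable : R.Armijo Q pen ls k ω → ¬ R.Reliable Q pen ls k ω →
    R.eps (k + 1) ω = R.eps k ω / pen.rho
  failure : ¬ R.Armijo Q pen ls k ω →
    R.x (k + 1) ω = R.x k ω ∧ R.lam (k + 1) ω = R.lam k ω ∧
    R.alpha (k + 1) ω = R.alpha k ω / pen.rho ∧ R.eps (k + 1) ω = R.eps k ω / pen.rho

/-- `R` is an execution of the adaptive stochastic SQP with stochastic line search on the
probability space `(Ω, Pr)`. -/
structure IsExecution [MeasurableSpace Ω] (Pr : Measure Ω) : Prop where
  /- sampling: every batch consists of independent draws from `P`, independent of the past; the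
  sample sizes are arbitrary random variables, which may depend on the draws -/
  measurable_x0 : Measurable (R.x 0)
  measurable_lam0 : Measurable (R.lam 0)
  measurable_Ng : ∀ k, Measurable (R.Ng k)
  measurable_Nf : ∀ k, Measurable (R.Nf k)
  measurable_Zg : ∀ k n, Measurable (R.Zg k n)
  measurable_Zf : ∀ k n, Measurable (R.Zf k n)
  law_Zg : ∀ k n, Pr.map (R.Zg k n) = Measure.pi fun _ => Q.P
  law_Zf : ∀ k n, Pr.map (R.Zf k n) = Measure.pi fun _ => Q.P
  indep_Zg : ∀ k n, Indep (MeasurableSpace.comap (R.Zg k n) inferInstance) (R.past k) Pr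
  indep_Zf : ∀ k n, Indep (MeasurableSpace.comap (R.Zf k n) inferInstance) (R.mid k) Pr
  /- what is known before iteration `k`, and after its first sample set has been drawn -/
  adapted_x : ∀ k, Measurable[R.past k] (R.x k)
  adapted_lam : ∀ k, Measurable[R.past k] (R.lam k)
  adapted_alpha : ∀ k, Measurable[R.past k] (R.alpha k)
  adapted_eps : ∀ k, Measurable[R.past k] (R.eps k)
  adapted_B : ∀ k, Measurable[R.mid k] (R.B k)
  adapted_dx : ∀ k, Measurable[R.mid k] (R.dx k)
  adapted_dlam : ∀ k, Measurable[R.mid k] (R.dlam k)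
  adapted_mu : ∀ k, Measurable[R.mid k] (R.mu k)
  /- initialization -/
  init : ∀ᵐ ω ∂Pr, R.alpha 0 ω = ls.alphaMax ∧ R.eps 0 ω = ls.eps0
  /- sample sizes -/
  size_g : ∀ᵐ ω ∂Pr, 1 ≤ R.Ng 0 ω ∧ ∀ k, R.Ng k ω + 1 ≤ R.Ng (k + 1) ω
  size_f : ∀ᵐ ω ∂Pr, ∀ k, 1 ≤ R.Nf k ω
  /- accuracy of the estimates -/
  accuracy_grad : ∀ k, Pr⟦(R.eventA Q pen ls k)ᶜ | R.past k⟧ ≤ᵐ[Pr] fun _ => ls.pGrad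
  accuracy_merit : ∀ k, Pr⟦(R.eventB Q pen ls k)ᶜ | R.mid k⟧ ≤ᵐ[Pr] fun _ => ls.pF
  variance_merit : ∀ k, Integrable (fun ω => R.meritErr Q pen k ω ^ 2) Pr ∧
    Pr[fun ω => R.meritErr Q pen k ω ^ 2 | R.mid k] ≤ᵐ[Pr] fun ω => R.eps k ω ^ 2
  variance_trial : ∀ k, Integrable (fun ω => R.meritErrTrial Q pen k ω ^ 2) Pr ∧
    Pr[fun ω => R.meritErrTrial Q pen k ω ^ 2 | R.mid k] ≤ᵐ[Pr] fun ω => R.eps k ω ^ 2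
  /- the iteration -/
  B_pos : ∀ᵐ ω ∂Pr, ∀ k, ∀ v, R.Gk Q k ω v = 0 → pen.gammaRH * ‖v‖ ^ 2 ≤ ⟪v, R.B k ω v⟫
  newton : ∀ᵐ ω ∂Pr, ∀ k, R.NewtonSystem Q k ω
  penalty : ∀ᵐ ω ∂Pr, ∀ k, R.PenaltyUpdate Q pen k ω
  lineSearch : ∀ᵐ ω ∂Pr, ∀ k, R.LineSearchUpdate Q pen ls k ω

/-- The part of the assumptions that concerns the execution. -/
structure IterateAssumptions [MeasurableSpace Ω] (X : Set (Vec d)) (Lam : Set (Vec m))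
    (Pr : Measure Ω) : Prop where
  mem_X : ∀ᵐ ω ∂Pr, ∀ k, R.x k ω ∈ X
  mem_Lam : ∀ᵐ ω ∂Pr, ∀ k, R.lam k ω ∈ Lam
  B_bound : ∀ᵐ ω ∂Pr, ∀ k, ‖R.B k ω‖ ≤ pen.kappaB
  residual_pos : ∀ᵐ ω ∂Pr, ∀ k, 0 < Q.kktResidual (R.x k ω) (R.lam k ω)
  dir_pos : ∀ᵐ ω ∂Pr, ∀ k, 0 < ‖R.dir k ω‖

end Trajectory

/-- The deterministic constants that enter the condition on `ω`. -/
structure Consts where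
  (muTilde kappaL ups1 ups3 ups4 : ℝ)

/-- The defining properties of the constants: `muTilde` bounds the penalty parameters, `kappaL`
bounds the Hessian of the augmented Lagrangian on `X × Λ` for all penalty parameters up to
`muTilde`, and `ups1`, `ups3`, `ups4` compare the vectors of each iteration with
`(Δ̄xᵏ ; Gₖ∇̄ₓ𝓛ᵏ)`. -/
structure Consts.Admissible {d m : ℕ} {Ξ Ω : Type*} [MeasurableSpace Ξ] [MeasurableSpace Ω]
    (C : Consts) (Q : Problem d m Ξ) (X : Set (Vec d)) (Lam : Set (Vec m))
    (pen : PenaltyParams) (R : Trajectory d m Ξ Ω) (Pr : Measure Ω) : Prop where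
  hess_le : ∀ μ ∈ Set.Icc 0 C.muTilde, ∀ x ∈ X, ∀ l ∈ Lam,
    ‖Q.meritHess μ pen.nu x l‖ ≤ C.kappaL
  mu_le : ∀ᵐ ω ∂Pr, ∀ k, R.mu k ω ≤ C.muTilde
  ref_le : ∀ᵐ ω ∂Pr, ∀ k, ‖R.refVec Q pen k ω‖ ≤ C.ups1 * ‖R.scaleVec Q k ω‖
  dir_le : ∀ᵐ ω ∂Pr, ∀ k, ‖R.dir k ω‖ ≤ C.ups3 * ‖R.scaleVec Q k ω‖
  grad_le : ∀ᵐ ω ∂Pr, ∀ k,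
    ‖R.meritGradBar Q pen k ω (R.mu k ω)‖ ≤ C.ups4 * ‖R.scaleVec Q k ω‖

/-- The condition on `ω` (written `w`). -/
def OmegaCondition (pen : PenaltyParams) (ls : LineSearchParams) (C : Consts) (w : ℝ) : Prop :=
  max (32 * pen.rho *
        max (C.kappaL * ls.alphaMax * C.ups3) (ls.kappaGrad * ls.alphaMax * C.ups1 + C.ups4) ^ 2 /
        (ls.beta * pen.gammaRH))
      (4 * (pen.rho - 1)) ≤ w / (1 - w)

/-- The condition on the failure probabilities. -/
def ProbCondition (pen : PenaltyParams) (ls : LineSearchParams) (w : ℝ) : Prop :=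
  (ls.pGrad + √ls.pF) / ((1 - ls.pGrad) * (1 - ls.pF)) ≤
    (pen.rho - 1) / (8 * pen.rho) * min (1 / pen.rho) ((1 - w) / w)

end

/-!
Constants. On the compact set `X × Λ` all problem data are bounded and `GGᵀ` is uniformly
invertible, so that every vector of an iteration is of the order of `s = (Δ̄x; G∇̄ₓ𝓛)`
(`UniformBounds.exists_stepBound`). In the slope of the augmented Lagrangian along the search
direction, the terms with a wrong sign are absorbed at the price of a multiple of `‖c‖²`, which is
dominated as soon as the penalty parameter passes a deterministic threshold; hence the penalty loop
stops, with a bounded result (`Trajectory.penalty_bounds`, `Problem.Regular.exists_consts`).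

Convergence. The potential `w 𝓛_{μ,ν} + (1 - w)/2 α ‖∇𝓛_{μ,ν}‖² + (1 - w)/2 ε` is evaluated with the
penalty parameter before the update of the iteration, which makes it a function of the past. Its
change in an iteration is bounded pathwise (`GoodPath.potential_descent`): it decreases by a multiple
of `α ‖∇𝓛_{μ,ν}‖² + ε` and, in a successful step with accurate estimates, by a multiple of the
predicted decrease `-αS`. Inaccurate gradients cost a multiple of `α ‖∇𝓛_{μ,ν}‖²`, inaccurate merit
values the error of these values, and the penalty update a multiple of its increment. In expectation
the first two losses are absorbed, by the condition on the failure probabilities and a conditional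
Cauchy-Schwarz inequality, and the last one telescopes, the penalty parameters being increasing and
bounded. So the predicted decrease in accurate successful steps is summable in expectation and
tends to zero almost surely (`ae_tendsto_decrease`); neither an eventually constant penalty parameter
nor a deterministic number of penalty updates is needed.

Both estimates are accurate with conditional probability at least some `q > 1/2`. The product of factors `1/(2q)`
for accurate and `2q` for inaccurate iterations has geometrically decaying expectation, so that
accurate iterations prevail on almost every path (`ae_tendsto_prod_zero`). Accurate steps with a
stepsize below a deterministic threshold succeed (`exists_success_threshold`). Since the stepsize is
raised and lowered by the same factor `ρ`, infinitely many accurate steps must succeed with a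
stepsize bounded away from zero (`frequently_good_success`). Along these steps `-αS → 0` forces
`s → 0`, and accuracy of the gradient bounds the KKT residual by a multiple of `‖s‖`
(`UniformBounds.exists_kkt_bound`).
-/


/-! ### Gradients and Hessians of real functions -/

section Hessian

variable {V : Type*} [NormedAddCommGroup V] [InnerProductSpace ℝ V] [CompleteSpace V]

/-- The inverse Riesz isomorphism, as a continuous linear map. (Mathlib's `toDual` is
conjugate-linear, which is an obstacle to the calculus library even over `ℝ`.) -/
noncomputable def rieszCLM (V : Type*) [NormedAddCommGroup V] [InnerProductSpace ℝ V]
    [CompleteSpace V] : (V →L[ℝ] ℝ) →L[ℝ] V where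
  toFun := (InnerProductSpace.toDual ℝ V).symm
  map_add' := map_add _
  map_smul' r l := by simp
  cont := (InnerProductSpace.toDual ℝ V).symm.continuous

lemma gradient_eq_rieszCLM (h : V → ℝ) : gradient h = fun x => rieszCLM V (fderiv ℝ h x) := rfl

lemma inner_rieszCLM (l : V →L[ℝ] ℝ) (v : V) : ⟪rieszCLM V l, v⟫ = l v :=
  InnerProductSpace.toDual_symm_apply

lemma ContDiffOn.gradient_of_isOpen {h : V → ℝ} {U : Set V} {n k : WithTop ℕ∞}
    (hh : ContDiffOn ℝ n h U) (hU : IsOpen U) (hk : k + 1 ≤ n) :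
    ContDiffOn ℝ k (gradient h) U := by
  rw [gradient_eq_rieszCLM]
  exact (rieszCLM V).contDiff.comp_contDiffOn (hh.fderiv_of_isOpen hU hk)

lemma ContDiffOn.differentiableAt_gradient {h : V → ℝ} {U : Set V} (hh : ContDiffOn ℝ 2 h U)
    (hU : IsOpen U) {x : V} (hx : x ∈ U) : DifferentiableAt ℝ (gradient h) x :=
  ((hh.gradient_of_isOpen (k := 1) hU (by norm_num)).contDiffAt (hU.mem_nhds hx)).differentiableAt
    (by norm_num)

lemma ContDiffOn.continuousOn_hess {h : V → ℝ} {U : Set V} (hh : ContDiffOn ℝ 2 h U)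
    (hU : IsOpen U) : ContinuousOn (hess h) U :=
  (hh.gradient_of_isOpen (k := 1) hU (by norm_num)).continuousOn_fderiv_of_isOpen hU le_rfl

lemma inner_hess {h : V → ℝ} {U : Set V} (hh : ContDiffOn ℝ 2 h U) (hU : IsOpen U) {x : V}
    (hx : x ∈ U) (u v : V) : ⟪hess h x u, v⟫ = fderiv ℝ (fderiv ℝ h) x u v := by
  have hd : DifferentiableAt ℝ (fderiv ℝ h) x :=
    ((hh.fderiv_of_isOpen (m := 1) hU (by norm_num)).contDiffAt
      (hU.mem_nhds hx)).differentiableAt (by norm_num)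
  have : hess h x = (rieszCLM V).comp (fderiv ℝ (fderiv ℝ h) x) := by
    unfold hess
    rw [gradient_eq_rieszCLM]
    exact ((rieszCLM V).hasFDerivAt.comp x hd.hasFDerivAt).fderiv
  rw [this, ContinuousLinearMap.comp_apply, inner_rieszCLM]

lemma inner_hess_comm {h : V → ℝ} {U : Set V} (hh : ContDiffOn ℝ 2 h U) (hU : IsOpen U) {x : V}
    (hx : x ∈ U) (u v : V) : ⟪hess h x u, v⟫ = ⟪u, hess h x v⟫ := by
  rw [inner_hess hh hU hx, real_inner_comm, inner_hess hh hU hx]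
  exact (hh.contDiffAt (hU.mem_nhds hx)).isSymmSndFDerivAt (by simp) u v

end Hessian

/-! ### Primal-dual vectors -/

section Stack

variable {d m : ℕ}

@[simp] lemma stack_fst (a : Vec d) (b : Vec m) : (stack a b).ofLp.1 = a := rfl

@[simp] lemma stack_snd (a : Vec d) (b : Vec m) : (stack a b).ofLp.2 = b := rfl

lemma inner_stack (a a' : Vec d) (b b' : Vec m) :
    ⟪stack a b, stack a' b'⟫ = ⟪a, a'⟫ + ⟪b, b'⟫ := WithLp.prod_inner_apply _ _

lemma norm_stack_sq (a : Vec d) (b : Vec m) : ‖stack a b‖ ^ 2 = ‖a‖ ^ 2 + ‖b‖ ^ 2 :=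
  WithLp.prod_norm_sq_eq_of_L2 _

lemma norm_fst_le_stack (a : Vec d) (b : Vec m) : ‖a‖ ≤ ‖stack a b‖ :=
  le_of_sq_le_sq (by nlinarith [norm_stack_sq a b, sq_nonneg ‖b‖]) (norm_nonneg _)

lemma norm_snd_le_stack (a : Vec d) (b : Vec m) : ‖b‖ ≤ ‖stack a b‖ :=
  le_of_sq_le_sq (by nlinarith [norm_stack_sq a b, sq_nonneg ‖a‖]) (norm_nonneg _)

lemma norm_stack_le (a : Vec d) (b : Vec m) : ‖stack a b‖ ≤ ‖a‖ + ‖b‖ :=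
  le_of_sq_le_sq (by nlinarith [norm_stack_sq a b, norm_nonneg a, norm_nonneg b])
    (by positivity)

lemma stack_add_smul (a a' : Vec d) (b b' : Vec m) (r : ℝ) :
    stack (a + r • a') (b + r • b') = stack a b + r • stack a' b' := rfl

lemma stack_sub (a a' : Vec d) (b b' : Vec m) :
    stack a b - stack a' b' = stack (a - a') (b - b') := rfl

/-- The set `X × Λ` of primal-dual vectors. -/
def pdSet (X : Set (Vec d)) (Lam : Set (Vec m)) : Set (PD d m) :=
  {p | p.ofLp.1 ∈ X ∧ p.ofLp.2 ∈ Lam}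

lemma pdSet_eq_image (X : Set (Vec d)) (Lam : Set (Vec m)) :
    pdSet X Lam = WithLp.toLp 2 '' (X ×ˢ Lam) := by
  ext p
  constructor
  · rintro ⟨h1, h2⟩
    exact ⟨p.ofLp, ⟨h1, h2⟩, rfl⟩
  · rintro ⟨q, ⟨h1, h2⟩, rfl⟩
    exact ⟨h1, h2⟩

lemma isCompact_pdSet {X : Set (Vec d)} {Lam : Set (Vec m)} (hX : IsCompact X)
    (hL : IsCompact Lam) : IsCompact (pdSet X Lam) := by
  rw [pdSet_eq_image]
  exact (hX.prod hL).image (WithLp.prod_continuous_toLp 2 _ _)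

lemma convex_pdSet {X : Set (Vec d)} {Lam : Set (Vec m)} (hX : Convex ℝ X)
    (hL : Convex ℝ Lam) : Convex ℝ (pdSet X Lam) := by
  intro p hp q hq a b ha hb hab
  exact ⟨hX hp.1 hq.1 ha hb hab, hL hp.2 hq.2 ha hb hab⟩

lemma isOpen_pdSet_univ {U : Set (Vec d)} (hU : IsOpen U) :
    IsOpen (pdSet U (Set.univ : Set (Vec m))) := by
  have : pdSet U (Set.univ : Set (Vec m)) = (WithLp.fstL 2 ℝ (Vec d) (Vec m)) ⁻¹' U := by
    ext p
    exact ⟨fun h => h.1, fun h => ⟨h, trivial⟩⟩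
  rw [this]
  exact hU.preimage (WithLp.fstL 2 ℝ (Vec d) (Vec m)).continuous

end Stack

/-! ### Derivatives of the augmented Lagrangian -/

namespace Problem

variable {d m : ℕ} {Ξ : Type*} [MeasurableSpace Ξ] (Q : Problem d m Ξ)

/-- `f` and `c` are of class `C³` on the open set `U`. -/
structure SmoothOn (U : Set (Vec d)) : Prop where
  isOpen : IsOpen U
  contDiff_f : ContDiffOn ℝ 3 Q.f U
  contDiff_c : ContDiffOn ℝ 3 Q.c U

variable {Q} {U : Set (Vec d)} {x : Vec d}

lemma inner_GT (x : Vec d) (l : Vec m) (v : Vec d) : ⟪Q.GT x l, v⟫ = ⟪l, Q.G x v⟫ :=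
  ContinuousLinearMap.adjoint_inner_left _ _ _

lemma inner_GT_right (x : Vec d) (l : Vec m) (v : Vec d) : ⟪v, Q.GT x l⟫ = ⟪Q.G x v, l⟫ :=
  ContinuousLinearMap.adjoint_inner_right _ _ _

namespace SmoothOn

lemma contDiff_cj (h : Q.SmoothOn U) (j : Fin m) : ContDiffOn ℝ 3 (fun y => Q.c y j) U :=
  (EuclideanSpace.proj j : Vec m →L[ℝ] ℝ).contDiff.comp_contDiffOn h.contDiff_c

lemma contDiff_G (h : Q.SmoothOn U) : ContDiffOn ℝ 2 Q.G U :=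
  h.contDiff_c.fderiv_of_isOpen h.isOpen (by norm_num)

lemma differentiableAt_c (h : Q.SmoothOn U) (hx : x ∈ U) : DifferentiableAt ℝ Q.c x :=
  (h.contDiff_c.contDiffAt (h.isOpen.mem_nhds hx)).differentiableAt (by norm_num)

lemma differentiableAt_G (h : Q.SmoothOn U) (hx : x ∈ U) : DifferentiableAt ℝ Q.G x :=
  (h.contDiff_G.contDiffAt (h.isOpen.mem_nhds hx)).differentiableAt (by norm_num)

lemma fderiv_cj (h : Q.SmoothOn U) (hx : x ∈ U) (j : Fin m) :
    fderiv ℝ (fun y => Q.c y j) x = (EuclideanSpace.proj j : Vec m →L[ℝ] ℝ).comp (Q.G x) :=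
  ((EuclideanSpace.proj j : Vec m →L[ℝ] ℝ).hasFDerivAt.comp x
    (h.differentiableAt_c hx).hasFDerivAt).fderiv

lemma G_apply (h : Q.SmoothOn U) (hx : x ∈ U) (v : Vec d) (j : Fin m) :
    Q.G x v j = ⟪gradient (fun y => Q.c y j) x, v⟫ := by
  rw [inner_gradient_left, h.fderiv_cj hx]
  rfl

lemma GT_eq_sum (h : Q.SmoothOn U) (hx : x ∈ U) (l : Vec m) :
    Q.GT x l = ∑ j, l j • gradient (fun y => Q.c y j) x := by
  refine ext_inner_right ℝ fun v => ?_
  rw [inner_GT, sum_inner, PiLp.inner_apply]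
  refine Finset.sum_congr rfl fun j _ => ?_
  rw [h.G_apply hx, real_inner_smul_left]
  simp [mul_comm]

lemma hessC_inner (h : Q.SmoothOn U) (hx : x ∈ U) (j : Fin m) (v u : Vec d) :
    ⟪Q.hessC j x v, u⟫ = (fderiv ℝ Q.G x v u) j := by
  unfold hessC
  rw [inner_hess ((h.contDiff_cj j).of_le (by norm_num)) h.isOpen hx]
  have h1 : fderiv ℝ (fun y => Q.c y j) =ᶠ[𝓝 x]
      fun y => (EuclideanSpace.proj j : Vec m →L[ℝ] ℝ).comp (Q.G y) := by
    filter_upwards [h.isOpen.mem_nhds hx] with y hy using h.fderiv_cj hy j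
  rw [h1.fderiv_eq]
  have h2 := (ContinuousLinearMap.compL ℝ (Vec d) (Vec m) ℝ
    (EuclideanSpace.proj j : Vec m →L[ℝ] ℝ)).hasFDerivAt.comp x
      (h.differentiableAt_G hx).hasFDerivAt
  have h3 := h2.fderiv
  have : (fun y => (EuclideanSpace.proj j : Vec m →L[ℝ] ℝ).comp (Q.G y)) =
    (ContinuousLinearMap.compL ℝ (Vec d) (Vec m) ℝ
      (EuclideanSpace.proj j : Vec m →L[ℝ] ℝ)) ∘ Q.G := rfl
  rw [this, h3]
  rfl

lemma hessC_symm (h : Q.SmoothOn U) (hx : x ∈ U) (j : Fin m) (v u : Vec d) :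
    ⟪Q.hessC j x v, u⟫ = ⟪v, Q.hessC j x u⟫ :=
  inner_hess_comm ((h.contDiff_cj j).of_le (by norm_num)) h.isOpen hx v u

lemma hessLag_symm (h : Q.SmoothOn U) (hx : x ∈ U) (l : Vec m) (v u : Vec d) :
    ⟪Q.hessLag (hess Q.f x) x l v, u⟫ = ⟪v, Q.hessLag (hess Q.f x) x l u⟫ := by
  simp only [hessLag, add_apply, sum_apply,
    smul_apply, inner_add_left, inner_add_right, sum_inner, inner_sum,
    real_inner_smul_left, real_inner_smul_right, h.hessC_symm hx,
    inner_hess_comm (h.contDiff_f.of_le (by norm_num)) h.isOpen hx v u]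

/-- The derivative of `(x, λ) ↦ ∇ₓ𝓛(x, λ)`. -/
lemma hasFDerivAt_gradLag (h : Q.SmoothOn U) (hx : x ∈ U) (l : Vec m) :
    HasFDerivAt (fun p : PD d m => Q.gradLag (gradient Q.f p.ofLp.1) p.ofLp.1 p.ofLp.2)
      ((Q.hessLag (hess Q.f x) x l).comp (WithLp.fstL 2 ℝ (Vec d) (Vec m)) +
        (Q.GT x).comp (WithLp.sndL 2 ℝ (Vec d) (Vec m))) (stack x l) := by
  have hfst : HasFDerivAt (fun p : PD d m => p.ofLp.1) (WithLp.fstL 2 ℝ (Vec d) (Vec m))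
    (stack x l) := (WithLp.fstL 2 ℝ (Vec d) (Vec m)).hasFDerivAt
  have hsnd : ∀ j, HasFDerivAt (fun p : PD d m => p.ofLp.2 j)
      ((EuclideanSpace.proj j : Vec m →L[ℝ] ℝ).comp (WithLp.sndL 2 ℝ (Vec d) (Vec m)))
      (stack x l) := fun j =>
    ((EuclideanSpace.proj j : Vec m →L[ℝ] ℝ).comp
      (WithLp.sndL 2 ℝ (Vec d) (Vec m))).hasFDerivAt
  have hev : (fun p : PD d m => Q.gradLag (gradient Q.f p.ofLp.1) p.ofLp.1 p.ofLp.2)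
      =ᶠ[𝓝 (stack x l)] fun p => gradient Q.f p.ofLp.1 +
        ∑ j, p.ofLp.2 j • gradient (fun y => Q.c y j) p.ofLp.1 := by
    filter_upwards [(isOpen_pdSet_univ h.isOpen).mem_nhds
      (show stack x l ∈ pdSet U Set.univ from ⟨hx, trivial⟩)] with p hp
    rw [gradLag, h.GT_eq_sum hp.1]
  have hf : HasFDerivAt (fun p : PD d m => gradient Q.f p.ofLp.1)
      ((hess Q.f x).comp (WithLp.fstL 2 ℝ (Vec d) (Vec m))) (stack x l) :=
    HasFDerivAt.comp (g := gradient Q.f) (stack x l)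
      (((h.contDiff_f.of_le (by norm_num)).differentiableAt_gradient h.isOpen hx).hasFDerivAt) hfst
  have hc : ∀ j, HasFDerivAt (fun p : PD d m => gradient (fun y => Q.c y j) p.ofLp.1)
      ((Q.hessC j x).comp (WithLp.fstL 2 ℝ (Vec d) (Vec m))) (stack x l) := fun j =>
    HasFDerivAt.comp (g := gradient fun y => Q.c y j) (stack x l)
      ((((h.contDiff_cj j).of_le (by norm_num)).differentiableAt_gradient
        h.isOpen hx).hasFDerivAt) hfst
  have hsum := hf.add (HasFDerivAt.fun_sum (u := Finset.univ) fun j _ => (hsnd j).smul (hc j))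
  refine (hsum.congr_of_eventuallyEq hev).congr_fderiv ?_
  ext1 v
  simp only [hessLag, add_apply, sum_apply,
    ContinuousLinearMap.comp_apply, smul_apply,
    ContinuousLinearMap.smulRight_apply, Finset.sum_add_distrib, h.GT_eq_sum hx, add_assoc]
  rfl

/-- `M` is the transposed derivative of `x ↦ G(x)∇ₓ𝓛(x, λ)`. -/
lemma inner_matM (h : Q.SmoothOn U) (hx : x ∈ U) (l y : Vec m) (v : Vec d) :
    ⟪Q.matM (gradient Q.f x) (hess Q.f x) x l y, v⟫ =
      ⟪y, Q.G x (Q.hessLag (hess Q.f x) x l v) +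
        fderiv ℝ Q.G x v (Q.gradLag (gradient Q.f x) x l)⟫ := by
  have hT : ⟪Q.matT (gradient Q.f x) x l y, v⟫ =
      ⟪y, fderiv ℝ Q.G x v (Q.gradLag (gradient Q.f x) x l)⟫ := by
    rw [PiLp.inner_apply y, matT, sum_apply, sum_inner]
    refine Finset.sum_congr rfl fun j _ => ?_
    rw [← h.hessC_inner hx, ContinuousLinearMap.smulRight_apply, real_inner_smul_left,
      h.hessC_symm hx, real_inner_comm]
    simp [mul_comm]
  rw [matM, add_apply, inner_add_left, inner_add_right, hT,
    ContinuousLinearMap.comp_apply, h.hessLag_symm hx, inner_GT]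

/-- `meritGrad`, evaluated at the true derivatives, is the gradient of the augmented Lagrangian. -/
theorem hasGradientAt_merit (h : Q.SmoothOn U) (hx : x ∈ U) (l : Vec m) (μ ν : ℝ) :
    HasGradientAt (fun p : PD d m => Q.merit μ ν p.ofLp.1 p.ofLp.2)
      (Q.meritGrad μ ν (gradient Q.f x) (hess Q.f x) x l) (stack x l) := by
  rw [hasGradientAt_iff_hasFDerivAt]
  have hfst : HasFDerivAt (fun p : PD d m => p.ofLp.1) (WithLp.fstL 2 ℝ (Vec d) (Vec m))
    (stack x l) := (WithLp.fstL 2 ℝ (Vec d) (Vec m)).hasFDerivAt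
  have hsnd : HasFDerivAt (fun p : PD d m => p.ofLp.2) (WithLp.sndL 2 ℝ (Vec d) (Vec m))
    (stack x l) := (WithLp.sndL 2 ℝ (Vec d) (Vec m)).hasFDerivAt
  have hf : HasFDerivAt (fun p : PD d m => Q.f p.ofLp.1)
      ((fderiv ℝ Q.f x).comp (WithLp.fstL 2 ℝ (Vec d) (Vec m))) (stack x l) :=
    HasFDerivAt.comp (g := Q.f) (stack x l) (((h.contDiff_f.contDiffAt
      (h.isOpen.mem_nhds hx)).differentiableAt (by norm_num)).hasFDerivAt) hfst
  have hc : HasFDerivAt (fun p : PD d m => Q.c p.ofLp.1)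
      ((Q.G x).comp (WithLp.fstL 2 ℝ (Vec d) (Vec m))) (stack x l) :=
    HasFDerivAt.comp (g := Q.c) (stack x l) (h.differentiableAt_c hx).hasFDerivAt hfst
  have hG : HasFDerivAt (fun p : PD d m => Q.G p.ofLp.1)
      ((fderiv ℝ Q.G x).comp (WithLp.fstL 2 ℝ (Vec d) (Vec m))) (stack x l) :=
    HasFDerivAt.comp (g := Q.G) (stack x l) (h.differentiableAt_G hx).hasFDerivAt hfst
  have hJ := hG.clm_apply (h.hasFDerivAt_gradLag hx l)
  have := ((hf.add (hsnd.inner ℝ hc)).add (hc.norm_sq.const_mul (μ / 2))).add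
    (hJ.norm_sq.const_mul (ν / 2))
  refine this.congr_fderiv ?_
  ext1 v
  have e1 : ⟪Q.meritGrad μ ν (gradient Q.f x) (hess Q.f x) x l, v⟫ =
      ⟪Q.gradLag (gradient Q.f x) x l + ν • Q.matM (gradient Q.f x) (hess Q.f x) x l
          (Q.G x (Q.gradLag (gradient Q.f x) x l)) + μ • Q.GT x (Q.c x), v.ofLp.1⟫ +
        ⟪Q.c x + ν • Q.G x (Q.GT x (Q.G x (Q.gradLag (gradient Q.f x) x l))), v.ofLp.2⟫ :=
    WithLp.prod_inner_apply _ _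
  rw [InnerProductSpace.toDual_apply_apply, e1]
  simp only [inner_add_left, real_inner_smul_left, h.inner_matM hx, inner_GT,
    ← inner_GT_right x _ (Q.GT x _)]
  rw [show ⟪Q.gradLag (gradient Q.f x) x l, v.ofLp.1⟫ = fderiv ℝ Q.f x v.ofLp.1 +
    ⟪l, Q.G x v.ofLp.1⟫ by rw [gradLag, inner_add_left, inner_GT, inner_gradient_left]]
  have e3 : WithLp.fst v = v.ofLp.1 := rfl
  have e4 : WithLp.snd v = v.ofLp.2 := rfl
  simp only [add_apply, ContinuousLinearMap.comp_apply,
    smul_apply, ContinuousLinearMap.flip_apply, fderivInnerCLM_apply,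
    ContinuousLinearMap.prod_apply, innerSL_apply_apply, stack_fst, stack_snd,
    WithLp.fstL_apply, WithLp.sndL_apply, inner_add_right, map_add, smul_eq_mul, nsmul_eq_mul,
    e3, e4]
  rw [real_inner_comm (Q.c x) v.ofLp.2]
  push_cast
  ring

end SmoothOn

end Problem

/-! ### Smoothness of the augmented Lagrangian and Taylor bounds -/

namespace Problem

variable {d m : ℕ} {Ξ : Type*} [MeasurableSpace Ξ] {Q : Problem d m Ξ} {U : Set (Vec d)}

/-- The augmented Lagrangian as a function of the stacked primal-dual variable. -/
noncomputable def pdMerit (Q : Problem d m Ξ) (μ ν : ℝ) (p : PD d m) : ℝ :=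
  Q.merit μ ν p.ofLp.1 p.ofLp.2

/-- The exact gradient `∇𝓛_{μ,ν}(x, λ)`. -/
noncomputable def exactGrad (Q : Problem d m Ξ) (μ ν : ℝ) (x : Vec d) (l : Vec m) : PD d m :=
  Q.meritGrad μ ν (gradient Q.f x) (hess Q.f x) x l

/-- The exact gradient is affine in `μ`. -/
lemma exactGrad_eq (μ ν : ℝ) (x : Vec d) (l : Vec m) :
    Q.exactGrad μ ν x l = (1 - μ) • Q.exactGrad 0 ν x l + μ • Q.exactGrad 1 ν x l := by
  simp only [exactGrad, meritGrad]
  generalize Q.gradLag (gradient Q.f x) x l +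
    ν • Q.matM (gradient Q.f x) (hess Q.f x) x l (Q.G x (Q.gradLag (gradient Q.f x) x l)) = a
  generalize Q.c x + ν • Q.G x (Q.GT x (Q.G x (Q.gradLag (gradient Q.f x) x l))) = b
  generalize Q.GT x (Q.c x) = e
  rw [zero_smul, one_smul, add_zero]
  have h1 : a + μ • e = (1 - μ) • a + μ • (a + e) := by module
  have h2 : b = (1 - μ) • b + μ • b := by module
  calc stack (a + μ • e) b = stack ((1 - μ) • a + μ • (a + e)) ((1 - μ) • b + μ • b) := by
        rw [← h1, ← h2]
    _ = _ := rfl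

namespace SmoothOn

lemma contDiff_gradLag (h : Q.SmoothOn U) :
    ContDiffOn ℝ 2 (fun p : PD d m => Q.gradLag (gradient Q.f p.ofLp.1) p.ofLp.1 p.ofLp.2)
      (pdSet U Set.univ) := by
  have hfst : ContDiffOn ℝ 2 (fun p : PD d m => p.ofLp.1) (pdSet U Set.univ) :=
    (WithLp.fstL 2 ℝ (Vec d) (Vec m)).contDiff.contDiffOn
  have hmaps : Set.MapsTo (fun p : PD d m => p.ofLp.1) (pdSet U Set.univ) U := fun p hp => hp.1
  have hmain : ContDiffOn ℝ 2 (fun p : PD d m => gradient Q.f p.ofLp.1 +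
        ∑ j, p.ofLp.2 j • gradient (fun y => Q.c y j) p.ofLp.1) (pdSet U Set.univ) := by
    refine ((h.contDiff_f.gradient_of_isOpen h.isOpen (by norm_num)).comp hfst hmaps).add
      (ContDiffOn.sum fun j _ => ?_)
    refine ContDiffOn.smul (f := fun p : PD d m => p.ofLp.2 j)
      (g := fun p : PD d m => gradient (fun y => Q.c y j) p.ofLp.1) ?_ ?_
    · exact ((EuclideanSpace.proj j : Vec m →L[ℝ] ℝ).comp
        (WithLp.sndL 2 ℝ (Vec d) (Vec m))).contDiff.contDiffOn
    · exact ((h.contDiff_cj j).gradient_of_isOpen h.isOpen (by norm_num)).comp hfst hmaps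
  refine hmain.congr fun p hp => ?_
  rw [gradLag, h.GT_eq_sum hp.1]

lemma contDiff_pdMerit (h : Q.SmoothOn U) (μ ν : ℝ) :
    ContDiffOn ℝ 2 (Q.pdMerit μ ν) (pdSet U Set.univ) := by
  have hfst : ContDiffOn ℝ 2 (fun p : PD d m => p.ofLp.1) (pdSet U Set.univ) :=
    (WithLp.fstL 2 ℝ (Vec d) (Vec m)).contDiff.contDiffOn
  have hsnd : ContDiffOn ℝ 2 (fun p : PD d m => p.ofLp.2) (pdSet U Set.univ) :=
    (WithLp.sndL 2 ℝ (Vec d) (Vec m)).contDiff.contDiffOn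
  have hmaps : Set.MapsTo (fun p : PD d m => p.ofLp.1) (pdSet U Set.univ) U := fun p hp => hp.1
  have hf : ContDiffOn ℝ 2 (fun p : PD d m => Q.f p.ofLp.1) (pdSet U Set.univ) :=
    (h.contDiff_f.of_le (by norm_num)).comp hfst hmaps
  have hc : ContDiffOn ℝ 2 (fun p : PD d m => Q.c p.ofLp.1) (pdSet U Set.univ) :=
    (h.contDiff_c.of_le (by norm_num)).comp hfst hmaps
  have hG : ContDiffOn ℝ 2 (fun p : PD d m => Q.G p.ofLp.1) (pdSet U Set.univ) :=
    h.contDiff_G.comp hfst hmaps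
  exact ((hf.add (hsnd.inner ℝ hc)).add (contDiffOn_const.mul (hc.norm_sq ℝ))).add
    (contDiffOn_const.mul ((hG.clm_apply h.contDiff_gradLag).norm_sq ℝ))

lemma gradient_pdMerit (h : Q.SmoothOn U) {p : PD d m} (hp : p ∈ pdSet U Set.univ) (μ ν : ℝ) :
    gradient (Q.pdMerit μ ν) p = Q.exactGrad μ ν p.ofLp.1 p.ofLp.2 :=
  (h.hasGradientAt_merit hp.1 p.ofLp.2 μ ν).gradient

lemma hess_pdMerit (h : Q.SmoothOn U) {p : PD d m} (hp : p ∈ pdSet U Set.univ) (μ ν : ℝ) :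
    hess (Q.pdMerit μ ν) p =
      (1 - μ) • hess (Q.pdMerit 0 ν) p + μ • hess (Q.pdMerit 1 ν) p := by
  have hO : IsOpen (pdSet U (Set.univ : Set (Vec m))) := isOpen_pdSet_univ h.isOpen
  have hev : gradient (Q.pdMerit μ ν) =ᶠ[𝓝 p]
      (1 - μ) • gradient (Q.pdMerit 0 ν) + μ • gradient (Q.pdMerit 1 ν) := by
    filter_upwards [hO.mem_nhds hp] with q hq
    rw [Pi.add_apply, Pi.smul_apply, Pi.smul_apply, h.gradient_pdMerit hq, h.gradient_pdMerit hq,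
      h.gradient_pdMerit hq, exactGrad_eq]
  have h0 := (h.contDiff_pdMerit 0 ν).differentiableAt_gradient hO hp
  have h1 := (h.contDiff_pdMerit 1 ν).differentiableAt_gradient hO hp
  unfold hess
  rw [hev.fderiv_eq]
  rw [fderiv_add (h0.const_smul _) (h1.const_smul _), fderiv_const_smul h0, fderiv_const_smul h1]

/-- The Hessian is affine in `μ`, so its bounds for `μ = 0` and `μ = 1` control all `μ`. -/
lemma exists_hess_bound (h : Q.SmoothOn U) {K : Set (PD d m)} (hK : IsCompact K)
    (hKU : K ⊆ pdSet U Set.univ) (ν mt : ℝ) :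
    ∃ κ : ℝ, 0 ≤ κ ∧ ∀ μ ∈ Set.Icc 0 mt, ∀ p ∈ K, ‖hess (Q.pdMerit μ ν) p‖ ≤ κ := by
  have hO : IsOpen (pdSet U (Set.univ : Set (Vec m))) := isOpen_pdSet_univ h.isOpen
  obtain ⟨C0, h0⟩ := hK.exists_bound_of_continuousOn
    (((h.contDiff_pdMerit 0 ν).continuousOn_hess hO).mono hKU)
  obtain ⟨C1, h1⟩ := hK.exists_bound_of_continuousOn
    (((h.contDiff_pdMerit 1 ν).continuousOn_hess hO).mono hKU)
  refine ⟨(1 + |mt|) * |C0| + |mt| * |C1|, by positivity, fun μ hμ p hp => ?_⟩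
  rw [h.hess_pdMerit (hKU hp)]
  have hμ1 : |μ| ≤ |mt| := by rw [abs_of_nonneg hμ.1]; exact hμ.2.trans (le_abs_self _)
  have hμ2 : |1 - μ| ≤ 1 + |mt| := (abs_sub _ _).trans (by simpa using hμ1)
  refine (norm_add_le _ _).trans (add_le_add ?_ ?_)
  · rw [norm_smul]
    exact mul_le_mul hμ2 ((h0 p hp).trans (le_abs_self _)) (norm_nonneg _) (by positivity)
  · rw [norm_smul]
    exact mul_le_mul hμ1 ((h1 p hp).trans (le_abs_self _)) (norm_nonneg _) (by positivity)

/-- A bound on the Hessian on the convex set `X × Λ` makes the gradient of the augmented Lagrangian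
Lipschitz continuous there. -/
lemma norm_exactGrad_sub_le (h : Q.SmoothOn U) {X : Set (Vec d)} {Lam : Set (Vec m)}
    (hXU : X ⊆ U) (hX : Convex ℝ X) (hL : Convex ℝ Lam) {μ ν κ : ℝ}
    (hκ : ∀ x ∈ X, ∀ l ∈ Lam, ‖Q.meritHess μ ν x l‖ ≤ κ) {x x' : Vec d} {l l' : Vec m}
    (hx : x ∈ X) (hx' : x' ∈ X) (hl : l ∈ Lam) (hl' : l' ∈ Lam) :
    ‖Q.exactGrad μ ν x' l' - Q.exactGrad μ ν x l‖ ≤ κ * ‖stack x' l' - stack x l‖ := by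
  have hO : IsOpen (pdSet U (Set.univ : Set (Vec m))) := isOpen_pdSet_univ h.isOpen
  have hsub : pdSet X Lam ⊆ pdSet U Set.univ := fun p hp => ⟨hXU hp.1, trivial⟩
  have := Convex.norm_image_sub_le_of_norm_fderiv_le (𝕜 := ℝ) (f := gradient (Q.pdMerit μ ν))
    (s := pdSet X Lam) (C := κ) (x := stack x l) (y := stack x' l')
    (fun p hp => (h.contDiff_pdMerit μ ν).differentiableAt_gradient hO (hsub hp))
    (fun p hp => hκ _ hp.1 _ hp.2) (convex_pdSet hX hL) ⟨hx, hl⟩ ⟨hx', hl'⟩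
  rwa [h.gradient_pdMerit ⟨hXU hx', trivial⟩, h.gradient_pdMerit ⟨hXU hx, trivial⟩] at this

/-- A second order upper bound for the augmented Lagrangian around points of `X × Λ`. The
displaced point may lie outside of `X × Λ`, as test points of a line search may. -/
lemma exists_taylor_bound (h : Q.SmoothOn U) {X : Set (Vec d)} {Lam : Set (Vec m)}
    (hXU : X ⊆ U) (hX : IsCompact X) (hL : IsCompact Lam) (ν mt : ℝ) :
    ∃ δ κ : ℝ, 0 < δ ∧ 0 ≤ κ ∧ ∀ μ ∈ Set.Icc 0 mt, ∀ x ∈ X, ∀ l ∈ Lam, ∀ a b,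
      ‖stack a b‖ ≤ δ → Q.merit μ ν (x + a) (l + b) ≤
        Q.merit μ ν x l + ⟪Q.exactGrad μ ν x l, stack a b⟫ + κ * ‖stack a b‖ ^ 2 := by
  have hO : IsOpen (pdSet U (Set.univ : Set (Vec m))) := isOpen_pdSet_univ h.isOpen
  have hsub : pdSet X Lam ⊆ pdSet U Set.univ := fun p hp => ⟨hXU hp.1, trivial⟩
  obtain ⟨δ, hδ, hδU⟩ := (isCompact_pdSet hX hL).exists_cthickening_subset_open hO hsub
  obtain ⟨κ, hκ0, hκ⟩ := h.exists_hess_bound (isCompact_pdSet hX hL).cthickening hδU ν mt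
  refine ⟨δ, κ, hδ, hκ0, fun μ hμ x hx l hl a b hab => ?_⟩
  set p : PD d m := stack x l
  set q : PD d m := stack a b
  have hp : p ∈ pdSet X Lam := ⟨hx, hl⟩
  have hball : Metric.closedBall p ‖q‖ ⊆ Metric.cthickening δ (pdSet X Lam) :=
    (Metric.closedBall_subset_closedBall hab).trans
      (Metric.closedBall_subset_cthickening hp δ)
  have hlip : ∀ y ∈ Metric.closedBall p ‖q‖,
      ‖gradient (Q.pdMerit μ ν) y - gradient (Q.pdMerit μ ν) p‖ ≤ κ * ‖q‖ := fun y hy => by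
    have := Convex.norm_image_sub_le_of_norm_fderiv_le (𝕜 := ℝ) (f := gradient (Q.pdMerit μ ν))
      (s := Metric.closedBall p ‖q‖) (C := κ) (x := p) (y := y)
      (fun z hz => (h.contDiff_pdMerit μ ν).differentiableAt_gradient hO (hδU (hball hz)))
      (fun z hz => hκ μ hμ z (hball hz)) (convex_closedBall _ _)
      (Metric.mem_closedBall_self (norm_nonneg _)) hy
    refine this.trans (mul_le_mul_of_nonneg_left ?_ hκ0)
    rwa [← dist_eq_norm]
  have hmv := Convex.norm_image_sub_le_of_norm_hasFDerivWithin_le' (𝕜 := ℝ)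
    (f := Q.pdMerit μ ν) (s := Metric.closedBall p ‖q‖) (C := κ * ‖q‖) (x := p) (y := p + q)
    (f' := fun y => InnerProductSpace.toDual ℝ _ (gradient (Q.pdMerit μ ν) y))
    (φ := InnerProductSpace.toDual ℝ _ (gradient (Q.pdMerit μ ν) p))
    (fun y hy => by
      have hy' := hδU (hball hy)
      have := h.hasGradientAt_merit hy'.1 y.ofLp.2 μ ν
      rw [h.gradient_pdMerit hy']
      exact (hasGradientAt_iff_hasFDerivAt.1 this).hasFDerivWithinAt)
    (fun y hy => by
      rw [← map_sub, LinearIsometryEquiv.norm_map]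
      exact hlip y hy)
    (convex_closedBall _ _) (Metric.mem_closedBall_self (norm_nonneg _))
    (by simp [Metric.mem_closedBall, dist_eq_norm])
  rw [add_sub_cancel_left, InnerProductSpace.toDual_apply_apply,
    h.gradient_pdMerit (hsub hp)] at hmv
  have h3 := (le_abs_self _).trans hmv
  have e1 : Q.pdMerit μ ν (p + q) = Q.merit μ ν (x + a) (l + b) := rfl
  have e2 : Q.pdMerit μ ν p = Q.merit μ ν x l := rfl
  have e3 : Q.exactGrad μ ν p.ofLp.1 p.ofLp.2 = Q.exactGrad μ ν x l := rfl
  rw [e1, e2, e3] at h3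
  nlinarith [h3]

end SmoothOn

/-! ### Uniform bounds on the problem data -/

/-- `K` bounds all problem data on the compact set `X × Λ`, and `τ` is a lower bound for the
eigenvalues of `G Gᵀ`. -/
structure UniformBounds (Q : Problem d m Ξ) (X : Set (Vec d)) (Lam : Set (Vec m))
    (K τ : ℝ) : Prop where
  one_le : 1 ≤ K
  tau_pos : 0 < τ
  norm_f : ∀ x ∈ X, |Q.f x| ≤ K
  norm_gradf : ∀ x ∈ X, ‖gradient Q.f x‖ ≤ K
  norm_hessf : ∀ x ∈ X, ‖hess Q.f x‖ ≤ K
  norm_c : ∀ x ∈ X, ‖Q.c x‖ ≤ K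
  norm_G : ∀ x ∈ X, ‖Q.G x‖ ≤ K
  norm_hessC : ∀ x ∈ X, ∀ j, ‖Q.hessC j x‖ ≤ K
  norm_lam : ∀ l ∈ Lam, ‖l‖ ≤ K
  coercive : ∀ x ∈ X, ∀ y, τ * ‖y‖ ^ 2 ≤ ‖Q.GT x y‖ ^ 2

lemma SmoothOn.exists_uniformBounds (h : Q.SmoothOn U) {X : Set (Vec d)} {Lam : Set (Vec m)}
    (hXU : X ⊆ U) (hX : IsCompact X) (hL : IsCompact Lam)
    (hG : ∀ x ∈ X, Function.Surjective (Q.G x)) : ∃ K τ, Q.UniformBounds X Lam K τ := by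
  have hU := h.isOpen
  have cG : ContinuousOn Q.G X := h.contDiff_G.continuousOn.mono hXU
  obtain ⟨K1, h1⟩ := hX.exists_bound_of_continuousOn (h.contDiff_f.continuousOn.mono hXU)
  obtain ⟨K2, h2⟩ := hX.exists_bound_of_continuousOn
    ((h.contDiff_f.gradient_of_isOpen (k := 2) hU (by norm_num)).continuousOn.mono hXU)
  obtain ⟨K3, h3⟩ := hX.exists_bound_of_continuousOn
    (((h.contDiff_f.of_le (by norm_num)).continuousOn_hess hU).mono hXU)
  obtain ⟨K4, h4⟩ := hX.exists_bound_of_continuousOn (h.contDiff_c.continuousOn.mono hXU)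
  obtain ⟨K5, h5⟩ := hX.exists_bound_of_continuousOn cG
  obtain ⟨K6, h6⟩ := hX.exists_bound_of_continuousOn (f := fun x j => Q.hessC j x)
    (continuousOn_pi.2 fun j =>
      (((h.contDiff_cj j).of_le (by norm_num)).continuousOn_hess hU).mono hXU)
  obtain ⟨K7, h7⟩ := hL.exists_bound_of_continuousOn (f := fun l => l) continuousOn_id
  have hcomp : IsCompact (X ×ˢ Metric.sphere (0 : Vec m) 1) := hX.prod (isCompact_sphere _ _)
  have hcont : ContinuousOn (fun q : Vec d × Vec m => ‖Q.GT q.1 q.2‖)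
      (X ×ˢ Metric.sphere (0 : Vec m) 1) := by
    have hGT : ContinuousOn (fun q : Vec d × Vec m => Q.GT q.1)
        (X ×ˢ Metric.sphere (0 : Vec m) 1) :=
      ContinuousLinearMap.adjoint.continuous.comp_continuousOn
        (cG.comp continuousOn_fst fun q hq => hq.1)
    exact (hGT.clm_apply continuousOn_snd).norm
  -- `‖Gᵀy‖` is positive, by surjectivity of `G`, on the compact set `X × {‖y‖ = 1}`
  obtain ⟨σ, hσ, hσ'⟩ := hcomp.exists_forall_le' hcont (a := 0) (by
    rintro ⟨x, y⟩ ⟨hx, hy⟩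
    rw [norm_pos_iff]
    intro h0
    obtain ⟨v, hv⟩ := hG x hx y
    have : ⟪y, y⟫ = 0 := by
      nth_rewrite 2 [← hv]
      rw [← inner_GT]
      simp only at h0
      rw [h0, inner_zero_left]
    rw [inner_self_eq_zero] at this
    simp [this] at hy)
  refine ⟨1 + |K1| + |K2| + |K3| + |K4| + |K5| + |K6| + |K7|, σ ^ 2, ?_⟩
  have p1 := abs_nonneg K1
  have p2 := abs_nonneg K2
  have p3 := abs_nonneg K3
  have p4 := abs_nonneg K4
  have p5 := abs_nonneg K5
  have p6 := abs_nonneg K6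
  have p7 := abs_nonneg K7
  refine ⟨by linarith, by positivity, fun x hx => ?_, fun x hx => ?_, fun x hx => ?_,
    fun x hx => ?_, fun x hx => ?_, fun x hx j => ?_, fun l hl => ?_, fun x hx y => ?_⟩
  · have := h1 x hx
    rw [Real.norm_eq_abs] at this
    linarith [le_abs_self K1]
  · linarith [h2 x hx, le_abs_self K2]
  · linarith [h3 x hx, le_abs_self K3]
  · linarith [h4 x hx, le_abs_self K4]
  · linarith [h5 x hx, le_abs_self K5]
  · linarith [h6 x hx, le_abs_self K6, norm_le_pi_norm (fun j => Q.hessC j x) j]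
  · linarith [h7 l hl, le_abs_self K7]
  · rcases eq_or_ne y 0 with rfl | hy
    · simp
    · have hn : 0 < ‖y‖ := norm_pos_iff.2 hy
      have := hσ' (x, ‖y‖⁻¹ • y) ⟨hx, by simp [norm_smul, hn.ne']⟩
      simp only [map_smul, norm_smul, norm_inv, norm_norm] at this
      rw [← mul_pow]
      refine pow_le_pow_left₀ (by positivity) ?_ 2
      rwa [inv_mul_eq_div, le_div_iff₀ hn] at this

end Problem

/-! ### The search direction and the penalty parameter -/

namespace Problem

variable {d m : ℕ} {Ξ : Type*} [MeasurableSpace Ξ] {Q : Problem d m Ξ}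
  {X : Set (Vec d)} {Lam : Set (Vec m)} {K τ : ℝ}

/-- The data of one iteration: `(dx, dlam)` is a search direction at `(x, l)`, computed from the
matrix `B` and from estimates `g`, `H` of the derivatives of the objective. -/
structure IsStep (Q : Problem d m Ξ) (X : Set (Vec d)) (Lam : Set (Vec m)) (γ κB M1 M2 : ℝ)
    (x : Vec d) (l : Vec m) (g : Vec d) (H B : Vec d →L[ℝ] Vec d) (dx : Vec d) (dlam : Vec m) :
    Prop where
  mem_X : x ∈ X
  mem_Lam : l ∈ Lam
  norm_B : ‖B‖ ≤ κB
  B_pos : ∀ v, Q.G x v = 0 → γ * ‖v‖ ^ 2 ≤ ⟪v, B v⟫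
  g_close : ‖g - gradient Q.f x‖ ≤ M1
  H_close : ‖H - hess Q.f x‖ ≤ M2
  stationary : ∃ dt, B dx + Q.GT x dt = -Q.gradLag g x l
  feasible : Q.G x dx = -Q.c x
  dual : Q.G x (Q.GT x dlam) =
    -(Q.G x (Q.gradLag g x l) + ContinuousLinearMap.adjoint (Q.matM g H x l) dx)

namespace UniformBounds

lemma norm_GT (hb : Q.UniformBounds X Lam K τ) {x : Vec d} (hx : x ∈ X) : ‖Q.GT x‖ ≤ K := by
  rw [GT, LinearIsometryEquiv.norm_map]
  exact hb.norm_G x hx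

lemma K_pos (hb : Q.UniformBounds X Lam K τ) : 0 < K := zero_lt_one.trans_le hb.one_le

lemma norm_G_apply (hb : Q.UniformBounds X Lam K τ) {x : Vec d} (hx : x ∈ X) (v : Vec d) :
    ‖Q.G x v‖ ≤ K * ‖v‖ := (Q.G x).le_of_opNorm_le (hb.norm_G x hx) v

lemma norm_GT_apply (hb : Q.UniformBounds X Lam K τ) {x : Vec d} (hx : x ∈ X) (y : Vec m) :
    ‖Q.GT x y‖ ≤ K * ‖y‖ := (Q.GT x).le_of_opNorm_le (hb.norm_GT hx) y

lemma le_norm_G_GT (hb : Q.UniformBounds X Lam K τ) {x : Vec d} (hx : x ∈ X) (y : Vec m) :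
    τ * ‖y‖ ≤ ‖Q.G x (Q.GT x y)‖ := by
  rcases eq_or_ne y 0 with rfl | hy
  · simp
  have hn : 0 < ‖y‖ := norm_pos_iff.2 hy
  have h1 := hb.coercive x hx y
  have h2 : ‖Q.GT x y‖ ^ 2 ≤ ‖y‖ * ‖Q.G x (Q.GT x y)‖ := by
    rw [← real_inner_self_eq_norm_sq, inner_GT]
    exact real_inner_le_norm _ _
  exact le_of_mul_le_mul_left (by nlinarith) hn

/-- The Jacobian has a right inverse `Gᵀ(GGᵀ)⁻¹` of norm at most `K / τ`. -/
lemma exists_preimage (hb : Q.UniformBounds X Lam K τ) {x : Vec d} (hx : x ∈ X) (y : Vec m) :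
    ∃ v, Q.G x v = y ∧ ‖v‖ ≤ K / τ * ‖y‖ := by
  have hinj : Function.Injective ((Q.G x).comp (Q.GT x)).toLinearMap := by
    rw [← LinearMap.ker_eq_bot, LinearMap.ker_eq_bot']
    intro z hz
    have h1 := hb.le_norm_G_GT hx z
    have h2 : Q.G x (Q.GT x z) = 0 := hz
    rw [h2, norm_zero] at h1
    have := hb.tau_pos
    exact norm_le_zero_iff.1 (by nlinarith)
  obtain ⟨z, hz⟩ := LinearMap.injective_iff_surjective.1 hinj y
  have hz' : Q.G x (Q.GT x z) = y := hz
  refine ⟨Q.GT x z, hz', ?_⟩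
  have h1 := hb.le_norm_G_GT hx z
  rw [hz'] at h1
  have h2 : ‖z‖ ≤ ‖y‖ / τ := by rw [le_div_iff₀ hb.tau_pos]; linarith
  calc ‖Q.GT x z‖ ≤ K * ‖z‖ := hb.norm_GT_apply hx z
    _ ≤ K * (‖y‖ / τ) := mul_le_mul_of_nonneg_left h2 hb.K_pos.le
    _ = _ := by ring

lemma norm_gradLag (hb : Q.UniformBounds X Lam K τ) {x : Vec d} (hx : x ∈ X) {l : Vec m}
    (hl : l ∈ Lam) {M1 : ℝ} {g : Vec d} (hg : ‖g - gradient Q.f x‖ ≤ M1) :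
    ‖Q.gradLag g x l‖ ≤ M1 + K + K ^ 2 := by
  have h1 : ‖g‖ ≤ M1 + K := by
    have := norm_add_le (g - gradient Q.f x) (gradient Q.f x)
    rw [sub_add_cancel] at this
    linarith [hb.norm_gradf x hx]
  have h2 : ‖Q.GT x l‖ ≤ K * K := (hb.norm_GT_apply hx l).trans
    (mul_le_mul_of_nonneg_left (hb.norm_lam l hl) hb.K_pos.le)
  exact (norm_add_le _ _).trans (by nlinarith)

lemma norm_matM (hb : Q.UniformBounds X Lam K τ) {x : Vec d} (hx : x ∈ X) {l : Vec m}
    (hl : l ∈ Lam) {M1 M2 : ℝ} {g : Vec d} {H : Vec d →L[ℝ] Vec d}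
    (hg : ‖g - gradient Q.f x‖ ≤ M1) (hH : ‖H - hess Q.f x‖ ≤ M2) :
    ‖Q.matM g H x l‖ ≤ (M2 + K + m * K ^ 2) * K + m * (K * (M1 + K + K ^ 2)) := by
  have hK := hb.K_pos
  have hM1 := (norm_nonneg _).trans hg
  have hM2 := (norm_nonneg _).trans hH
  have h1 : ‖H‖ ≤ M2 + K := by
    have := norm_add_le (H - hess Q.f x) (hess Q.f x)
    rw [sub_add_cancel] at this
    linarith [hb.norm_hessf x hx]
  have hlj : ∀ (y : Vec m) j, ‖y j‖ ≤ ‖y‖ := fun y j => PiLp.norm_apply_le y j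
  have h2 : ‖Q.hessLag H x l‖ ≤ M2 + K + m * K ^ 2 := by
    refine (norm_add_le _ _).trans (add_le_add h1 ?_)
    refine (norm_sum_le _ _).trans ((Finset.sum_le_card_nsmul _ _ (K ^ 2) fun j _ => ?_).trans ?_)
    · rw [norm_smul, pow_two]
      exact mul_le_mul ((hlj l j).trans (hb.norm_lam l hl)) (hb.norm_hessC x hx j)
        (norm_nonneg _) hK.le
    · simp
  have h3 : ‖Q.matT g x l‖ ≤ m * (K * (M1 + K + K ^ 2)) := by
    refine (norm_sum_le _ _).trans ((Finset.sum_le_card_nsmul _ _ (K * (M1 + K + K ^ 2))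
      fun j _ => ?_).trans (by simp))
    have hw : ‖Q.hessC j x (Q.gradLag g x l)‖ ≤ K * (M1 + K + K ^ 2) :=
      ((Q.hessC j x).le_of_opNorm_le (hb.norm_hessC x hx j) _).trans
        (mul_le_mul_of_nonneg_left (hb.norm_gradLag hx hl hg) hK.le)
    refine ContinuousLinearMap.opNorm_le_bound _ (by positivity) fun y => ?_
    rw [ContinuousLinearMap.smulRight_apply, norm_smul, mul_comm]
    exact mul_le_mul hw (hlj y j) (norm_nonneg _) (by positivity)
  refine (norm_add_le _ _).trans (add_le_add ?_ h3)
  exact (ContinuousLinearMap.opNorm_comp_le _ _).trans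
    (mul_le_mul h2 (hb.norm_GT hx) (norm_nonneg _) (by positivity))

end UniformBounds

/-- `K'` bounds, for all search directions at points of `X × Λ`, the quantities of the iteration
relative to `s = (dx; G∇ₓ𝓛)`, and it is a threshold for the penalty parameter from which on the
direction is a descent direction of the augmented Lagrangian. -/
structure StepBound (Q : Problem d m Ξ) (X : Set (Vec d)) (Lam : Set (Vec m))
    (γ κB M1 M2 K' : ℝ) : Prop where
  one_le : 1 ≤ K'
  norm_c : ∀ {x l g H B dx dlam}, Q.IsStep X Lam γ κB M1 M2 x l g H B dx dlam →
    ‖Q.c x‖ ≤ K' * ‖stack dx (Q.G x (Q.gradLag g x l))‖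
  norm_dir : ∀ {x l g H B dx dlam}, Q.IsStep X Lam γ κB M1 M2 x l g H B dx dlam →
    ‖stack dx dlam‖ ≤ K' * ‖stack dx (Q.G x (Q.gradLag g x l))‖
  norm_gradLag : ∀ {x l g H B dx dlam}, Q.IsStep X Lam γ κB M1 M2 x l g H B dx dlam →
    ‖Q.gradLag g x l‖ ≤ K' * ‖stack dx (Q.G x (Q.gradLag g x l))‖
  slope : ∀ {x l g H B dx dlam}, Q.IsStep X Lam γ κB M1 M2 x l g H B dx dlam →
    ∀ μ ν : ℝ, γ ≤ ν → ⟪Q.meritGrad μ ν g H x l, stack dx dlam⟫ ≤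
      -(γ / 2) * ‖stack dx (Q.G x (Q.gradLag g x l))‖ ^ 2 - (μ - K') * ‖Q.c x‖ ^ 2

lemma IsStep.inner_meritGrad {γ κB M1 M2 : ℝ} {x l g H B dx dlam}
    (h : Q.IsStep X Lam γ κB M1 M2 x l g H B dx dlam) (μ ν : ℝ) :
    ⟪Q.meritGrad μ ν g H x l, stack dx dlam⟫ =
      ⟪Q.gradLag g x l, dx⟫ + ⟪Q.c x, dlam⟫ - ν * ‖Q.G x (Q.gradLag g x l)‖ ^ 2
        - μ * ‖Q.c x‖ ^ 2 := by
  rw [meritGrad, inner_stack]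
  simp only [inner_add_left, real_inner_smul_left, inner_GT]
  rw [h.feasible, ← inner_GT_right, inner_GT, h.dual, inner_neg_right, inner_neg_right,
    inner_add_right, ContinuousLinearMap.adjoint_inner_right, real_inner_self_eq_norm_sq,
    real_inner_self_eq_norm_sq]
  ring

/-- The size of the search direction, of the multipliers and of `∇ₓ𝓛` in terms of `‖dx‖` and
`‖G∇ₓ𝓛‖`: the multipliers are obtained by applying `G` to the equations and inverting `GGᵀ`, whose
eigenvalues are at least `τ`. -/
lemma IsStep.norm_estimates {γ κB M1 M2 KM b0 C1 C2 : ℝ} {x l g H B dx dlam}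
    (hb : Q.UniformBounds X Lam K τ) (h : Q.IsStep X Lam γ κB M1 M2 x l g H B dx dlam)
    (hb0 : κB ≤ b0) (hKM : ‖Q.matM g H x l‖ ≤ KM)
    (hC1 : 1 + KM ≤ C1 * τ) (hC2 : 1 + K * b0 ≤ C2 * τ) :
    ∃ dt, B dx + Q.GT x dt = -Q.gradLag g x l ∧
      ‖dlam‖ ≤ C1 * (‖dx‖ + ‖Q.G x (Q.gradLag g x l)‖) ∧
      ‖dt‖ ≤ C2 * (‖dx‖ + ‖Q.G x (Q.gradLag g x l)‖) ∧
      ‖Q.gradLag g x l‖ ≤ (b0 + K * C2) * (‖dx‖ + ‖Q.G x (Q.gradLag g x l)‖) := by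
  have hK := hb.K_pos
  have hτ := hb.tau_pos
  have hx := h.mem_X
  have hb0n : 0 ≤ b0 := ((norm_nonneg _).trans h.norm_B).trans hb0
  have hKMn : 0 ≤ KM := (norm_nonneg _).trans hKM
  obtain ⟨dt, hdt⟩ := h.stationary
  have hB : ‖B dx‖ ≤ b0 * ‖dx‖ := B.le_of_opNorm_le (h.norm_B.trans hb0) dx
  have hM : ‖ContinuousLinearMap.adjoint (Q.matM g H x l) dx‖ ≤ KM * ‖dx‖ := by
    refine ContinuousLinearMap.le_of_opNorm_le _ ?_ dx
    rwa [LinearIsometryEquiv.norm_map]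
  have hdual := h.dual
  generalize Q.gradLag g x l = w at *
  have ha0 : 0 ≤ ‖dx‖ := norm_nonneg _
  have hbb0 : 0 ≤ ‖Q.G x w‖ := norm_nonneg _
  have r3 : ‖dt‖ ≤ C2 * (‖dx‖ + ‖Q.G x w‖) := by
    have h1 := hb.le_norm_G_GT hx dt
    have h0 : Q.G x (Q.GT x dt) = -(Q.G x w + Q.G x (B dx)) := by
      have : Q.GT x dt = -w - B dx := by rw [← hdt]; abel
      rw [this, map_sub, map_neg]
      abel
    rw [h0, norm_neg] at h1
    have h2 := norm_add_le (Q.G x w) (Q.G x (B dx))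
    have h3 : ‖Q.G x (B dx)‖ ≤ K * (b0 * ‖dx‖) :=
      (hb.norm_G_apply hx _).trans (mul_le_mul_of_nonneg_left hB hK.le)
    have h4 : (1 + K * b0) * (‖dx‖ + ‖Q.G x w‖) ≤ C2 * τ * (‖dx‖ + ‖Q.G x w‖) :=
      mul_le_mul_of_nonneg_right hC2 (by positivity)
    refine le_of_mul_le_mul_left ?_ hτ
    nlinarith [mul_nonneg (mul_nonneg hK.le hb0n) hbb0]
  refine ⟨dt, hdt, ?_, r3, ?_⟩
  · have h1 := hb.le_norm_G_GT hx dlam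
    rw [hdual, norm_neg] at h1
    have h2 := norm_add_le (Q.G x w) (ContinuousLinearMap.adjoint (Q.matM g H x l) dx)
    have h4 : (1 + KM) * (‖dx‖ + ‖Q.G x w‖) ≤ C1 * τ * (‖dx‖ + ‖Q.G x w‖) :=
      mul_le_mul_of_nonneg_right hC1 (by positivity)
    refine le_of_mul_le_mul_left ?_ hτ
    nlinarith [mul_nonneg hKMn hbb0]
  · have h0 : w = -(B dx + Q.GT x dt) := by rw [hdt, neg_neg]
    have h1 : ‖w‖ ≤ ‖B dx‖ + ‖Q.GT x dt‖ := by
      rw [h0, norm_neg]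
      exact norm_add_le _ _
    have h2 : ‖Q.GT x dt‖ ≤ K * (C2 * (‖dx‖ + ‖Q.G x w‖)) :=
      (hb.norm_GT_apply hx _).trans (mul_le_mul_of_nonneg_left r3 hK.le)
    nlinarith [mul_nonneg hb0n hbb0]

/-- Curvature of `B` along a direction `u` that need not lie in the kernel of the Jacobian: the
loss is of the order of the constraint residual. -/
lemma UniformBounds.curvature_bound (hb : Q.UniformBounds X Lam K τ) {γ b0 : ℝ} (hγ : 0 < γ)
    {x : Vec d} (hx : x ∈ X) {B : Vec d →L[ℝ] Vec d} (hB : ‖B‖ ≤ b0)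
    (hpos : ∀ v, Q.G x v = 0 → γ * ‖v‖ ^ 2 ≤ ⟪v, B v⟫) (u : Vec d) :
    γ * ‖u‖ ^ 2 - (2 * γ * (K / τ) + 2 * b0 * (K / τ) + b0 * (K / τ) ^ 2) *
      ‖Q.G x u‖ * (‖u‖ + ‖Q.G x u‖) ≤ ⟪u, B u⟫ := by
  have hK := hb.K_pos
  have hτ := hb.tau_pos
  have hb0n : 0 ≤ b0 := (norm_nonneg _).trans hB
  have hBv : ∀ v, ‖B v‖ ≤ b0 * ‖v‖ := fun v => B.le_of_opNorm_le hB v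
  obtain ⟨v, hv, hvn⟩ := hb.exists_preimage hx (Q.G x u)
  have hker : Q.G x (u - v) = 0 := by rw [map_sub, hv, sub_self]
  have hpos' := hpos _ hker
  have hu1 : ‖u‖ ^ 2 - 2 * ‖u‖ * ‖v‖ ≤ ‖u - v‖ ^ 2 := by
    rw [norm_sub_sq_real]
    nlinarith [real_inner_le_norm u v, sq_nonneg ‖v‖]
  have hu2 : ‖u - v‖ ≤ ‖u‖ + ‖v‖ := norm_sub_le _ _
  have hsplit : ⟪u, B u⟫ = ⟪u - v, B (u - v)⟫ + ⟪u - v, B v⟫ + ⟪v, B u⟫ := by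
    rw [map_sub, inner_sub_right]
    simp only [inner_sub_left]
    ring
  have i1 : -((‖u‖ + ‖v‖) * (b0 * ‖v‖)) ≤ ⟪u - v, B v⟫ :=
    (abs_le.1 ((abs_real_inner_le_norm (u - v) (B v)).trans
      (mul_le_mul hu2 (hBv v) (norm_nonneg _) (by positivity)))).1
  have i2 : -(‖v‖ * (b0 * ‖u‖)) ≤ ⟪v, B u⟫ :=
    (abs_le.1 ((abs_real_inner_le_norm v (B u)).trans
      (mul_le_mul_of_nonneg_left (hBv u) (norm_nonneg v)))).1
  have hcvn : 0 ≤ K / τ := by positivity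
  generalize K / τ = cv at *
  have hv0 := norm_nonneg v
  have ha0 := norm_nonneg u
  have hq0 := norm_nonneg (Q.G x u)
  generalize ‖Q.G x u‖ = q at *
  generalize ‖v‖ = s at *
  generalize ‖u‖ = a at *
  have j1 : a * s ≤ cv * (a * q) := by
    calc a * s ≤ a * (cv * q) := mul_le_mul_of_nonneg_left hvn ha0
      _ = _ := by ring
  have j2 : s * s ≤ cv ^ 2 * (q * q) := by
    calc s * s ≤ (cv * q) * (cv * q) := mul_le_mul hvn hvn hv0 (by positivity)
      _ = _ := by ring
  have k1 : γ * (a * s) ≤ γ * (cv * (a * q)) := mul_le_mul_of_nonneg_left j1 hγ.le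
  have k2 : b0 * (a * s) ≤ b0 * (cv * (a * q)) := mul_le_mul_of_nonneg_left j1 hb0n
  have k3 : b0 * (s * s) ≤ b0 * (cv ^ 2 * (q * q)) := mul_le_mul_of_nonneg_left j2 hb0n
  have k4 : γ * (a ^ 2 - 2 * a * s) ≤ γ * ‖u - v‖ ^ 2 := mul_le_mul_of_nonneg_left hu1 hγ.le
  have n1 : 0 ≤ (2 * γ * cv + 2 * b0 * cv) * (q * q) := by positivity
  have n2 : 0 ≤ b0 * cv ^ 2 * (q * a) := by positivity
  rw [hsplit]
  linarith

/-- Completing squares: products with `q` are absorbed at the price of a multiple of `q²`. Here `a`,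
`b`, `q` stand for `‖dx‖`, `‖G∇ₓ𝓛‖`, `‖c‖`. -/
lemma absorb_products {γ ν L a b q t : ℝ} (hγ : 0 < γ) (hν : γ ≤ ν)
    (h : t ≤ -γ * a ^ 2 + L * q * (a + b + q)) :
    t - ν * b ^ 2 ≤ -(γ / 2) * (a ^ 2 + b ^ 2) + (L ^ 2 / γ + L) * q ^ 2 := by
  have h1 : L * q * a ≤ γ / 2 * a ^ 2 + L ^ 2 / γ / 2 * q ^ 2 := by
    have : 0 ≤ (γ * a - L * q) ^ 2 / (2 * γ) := by positivity
    have e : (γ * a - L * q) ^ 2 / (2 * γ) =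
      γ / 2 * a ^ 2 + L ^ 2 / γ / 2 * q ^ 2 - L * q * a := by field_simp; ring
    linarith
  have h2 : L * q * b ≤ γ / 2 * b ^ 2 + L ^ 2 / γ / 2 * q ^ 2 := by
    have : 0 ≤ (γ * b - L * q) ^ 2 / (2 * γ) := by positivity
    have e : (γ * b - L * q) ^ 2 / (2 * γ) =
      γ / 2 * b ^ 2 + L ^ 2 / γ / 2 * q ^ 2 - L * q * b := by field_simp; ring
    linarith
  have h3 : γ * b ^ 2 ≤ ν * b ^ 2 := mul_le_mul_of_nonneg_right hν (sq_nonneg b)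
  linarith

/-- All vectors of an iteration are of the order of `s = (dx; G∇ₓ𝓛)`, and the part of the slope that
does not depend on `μ` exceeds `-(γ/2)‖s‖²` by at most a multiple of `‖c‖²`. -/
theorem UniformBounds.exists_stepBound (hb : Q.UniformBounds X Lam K τ) {γ : ℝ} (hγ : 0 < γ)
    (κB M1 M2 : ℝ) : ∃ K', Q.StepBound X Lam γ κB M1 M2 K' := by
  have hK := hb.K_pos
  have hτ := hb.tau_pos
  obtain ⟨b0, hb0, hb0n⟩ : ∃ b0, κB ≤ b0 ∧ 0 ≤ b0 := ⟨|κB|, le_abs_self _, abs_nonneg _⟩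
  obtain ⟨KM, hKM, hKMn⟩ : ∃ KM,
      (M2 + K + m * K ^ 2) * K + m * (K * (M1 + K + K ^ 2)) ≤ KM ∧ 0 ≤ KM :=
    ⟨_, le_abs_self _, abs_nonneg _⟩
  obtain ⟨C1, hC1, hC1n⟩ : ∃ C1, 1 + KM ≤ C1 * τ ∧ 0 ≤ C1 :=
    ⟨(1 + KM) / τ, by field_simp; rfl, by positivity⟩
  obtain ⟨C2, hC2, hC2n⟩ : ∃ C2, 1 + K * b0 ≤ C2 * τ ∧ 0 ≤ C2 :=
    ⟨(1 + K * b0) / τ, by field_simp; rfl, by positivity⟩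
  obtain ⟨L0, hL0, hL0n⟩ : ∃ L0,
      2 * γ * (K / τ) + 2 * b0 * (K / τ) + b0 * (K / τ) ^ 2 = L0 ∧ 0 ≤ L0 :=
    ⟨_, rfl, by positivity⟩
  have hLg : 0 ≤ (L0 + C1 + C2) ^ 2 / γ := by positivity
  have hKC : 0 ≤ K * C2 := by positivity
  have main := fun {x l g H B dx dlam} (h : Q.IsStep X Lam γ κB M1 M2 x l g H B dx dlam) =>
    h.norm_estimates hb hb0
      ((hb.norm_matM h.mem_X h.mem_Lam h.g_close h.H_close).trans hKM) hC1 hC2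
  refine ⟨1 + K + (1 + 2 * C1) + 2 * (b0 + K * C2) +
    ((L0 + C1 + C2) ^ 2 / γ + (L0 + C1 + C2)), ⟨?_, fun {x l g H B dx dlam} h => ?_,
    fun {x l g H B dx dlam} h => ?_, fun {x l g H B dx dlam} h => ?_,
    fun {x l g H B dx dlam} h μ ν hν => ?_⟩⟩
  · linarith
  · have h1 := hb.norm_G_apply h.mem_X dx
    rw [h.feasible, norm_neg] at h1
    exact h1.trans (mul_le_mul (by linarith) (norm_fst_le_stack _ _) (norm_nonneg _) (by linarith))
  · obtain ⟨dt, -, h1, -, -⟩ := main h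
    have h2 := norm_fst_le_stack dx (Q.G x (Q.gradLag g x l))
    have h3 := norm_snd_le_stack dx (Q.G x (Q.gradLag g x l))
    have h0 := norm_nonneg (stack dx (Q.G x (Q.gradLag g x l)))
    refine (norm_stack_le _ _).trans ?_
    have h4 : C1 * (‖dx‖ + ‖Q.G x (Q.gradLag g x l)‖) ≤
        C1 * (2 * ‖stack dx (Q.G x (Q.gradLag g x l))‖) :=
      mul_le_mul_of_nonneg_left (by linarith) hC1n
    refine le_trans (b := (1 + 2 * C1) * ‖stack dx (Q.G x (Q.gradLag g x l))‖) (by linarith) ?_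
    exact mul_le_mul_of_nonneg_right (by linarith) h0
  · obtain ⟨dt, -, -, -, h1⟩ := main h
    have h2 := norm_fst_le_stack dx (Q.G x (Q.gradLag g x l))
    have h3 := norm_snd_le_stack dx (Q.G x (Q.gradLag g x l))
    have h0 := norm_nonneg (stack dx (Q.G x (Q.gradLag g x l)))
    have h4 : (b0 + K * C2) * (‖dx‖ + ‖Q.G x (Q.gradLag g x l)‖) ≤
        (b0 + K * C2) * (2 * ‖stack dx (Q.G x (Q.gradLag g x l))‖) :=
      mul_le_mul_of_nonneg_left (by linarith) (by positivity)
    refine le_trans (b := 2 * (b0 + K * C2) * ‖stack dx (Q.G x (Q.gradLag g x l))‖)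
      (by linarith) ?_
    exact mul_le_mul_of_nonneg_right (by linarith) h0
  · obtain ⟨dt, hdt, h1, h2, -⟩ := main h
    have hcurv := hb.curvature_bound hγ h.mem_X (h.norm_B.trans hb0) h.B_pos dx
    rw [h.inner_meritGrad, norm_stack_sq]
    have hw2 : ⟪Q.gradLag g x l, dx⟫ = -⟪dx, B dx⟫ + ⟪dt, Q.c x⟫ := by
      have h0 : Q.gradLag g x l = -(B dx + Q.GT x dt) := by rw [hdt, neg_neg]
      rw [h0, inner_neg_left, inner_add_left, inner_GT, h.feasible, inner_neg_right,
        real_inner_comm]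
      ring
    rw [h.feasible, norm_neg, hL0] at hcurv
    have i3 := (real_inner_le_norm dt (Q.c x)).trans
      (mul_le_mul_of_nonneg_right h2 (norm_nonneg (Q.c x)))
    have i4 := (real_inner_le_norm (Q.c x) dlam).trans
      (mul_le_mul_of_nonneg_left h1 (norm_nonneg (Q.c x)))
    have ha := norm_nonneg dx
    have hbn := norm_nonneg (Q.G x (Q.gradLag g x l))
    have hq := norm_nonneg (Q.c x)
    rw [hw2]
    generalize ‖Q.G x (Q.gradLag g x l)‖ = b at *
    generalize ‖Q.c x‖ = q at *
    generalize ‖dx‖ = a at *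
    have n1 : 0 ≤ L0 * (q * b) := by positivity
    have n2 : 0 ≤ (C1 + C2) * (q * q) := by positivity
    have habs := absorb_products (t := -⟪dx, B dx⟫ + ⟪dt, Q.c x⟫ + ⟪Q.c x, dlam⟫)
      (a := a) (b := b) (q := q) (L := L0 + C1 + C2) hγ hν (by linarith)
    have n3 : 0 ≤ (1 + K + (1 + 2 * C1) + 2 * (b0 + K * C2)) * q ^ 2 := by positivity
    linarith

/-- Beyond a threshold, every penalty parameter passes the exit condition of the penalty loop. -/
theorem StepBound.penalty_ok {γ κB M1 M2 K' : ℝ} (hS : Q.StepBound X Lam γ κB M1 M2 K')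
    (hγ : 0 < γ) {x l g H B dx dlam} (h : Q.IsStep X Lam γ κB M1 M2 x l g H B dx dlam)
    (hdir : 0 < ‖stack dx dlam‖) {μ ν : ℝ} (hν : γ ≤ ν) (hμ : K' + K' ^ 2 / (2 * γ) ≤ μ) :
    ⟪Q.meritGrad μ ν g H x l, stack dx dlam⟫ ≤
      -(γ / 2) * ‖stack dx (Q.G x (Q.gradLag g x l))‖ ^ 2 ∧
    ‖Q.c x‖ ≤ ‖Q.meritGrad μ ν g H x l‖ := by
  have h1 := hS.slope h μ ν hν
  have h2 := hS.norm_dir h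
  have hK' := hS.one_le
  have hcs := (abs_le.1 (abs_real_inner_le_norm (Q.meritGrad μ ν g H x l) (stack dx dlam))).1
  have hn := norm_nonneg (Q.meritGrad μ ν g H x l)
  generalize ‖stack dx (Q.G x (Q.gradLag g x l))‖ = s at *
  generalize ‖Q.c x‖ = q at *
  have hq : K' ^ 2 / (2 * γ) * q ^ 2 ≤ (μ - K') * q ^ 2 :=
    mul_le_mul_of_nonneg_right (by linarith) (sq_nonneg q)
  have hq0 : 0 ≤ K' ^ 2 / (2 * γ) * q ^ 2 := by positivity
  refine ⟨by linarith, ?_⟩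
  have hs : 0 < s := by
    by_contra hs
    nlinarith
  -- the arithmetic-geometric mean inequality for the two terms of the slope bound
  have hamgm : K' * s * q ≤ γ / 2 * s ^ 2 + K' ^ 2 / (2 * γ) * q ^ 2 := by
    have : 0 ≤ (γ * s - K' * q) ^ 2 / (2 * γ) := by positivity
    have e : (γ * s - K' * q) ^ 2 / (2 * γ) =
      γ / 2 * s ^ 2 + K' ^ 2 / (2 * γ) * q ^ 2 - K' * s * q := by field_simp; ring
    linarith
  have h3 : ‖Q.meritGrad μ ν g H x l‖ * ‖stack dx dlam‖ ≤
      ‖Q.meritGrad μ ν g H x l‖ * (K' * s) := mul_le_mul_of_nonneg_left h2 hn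
  refine le_of_mul_le_mul_left (a := K' * s) ?_ (by positivity)
  linarith

end Problem

/-! ### Bounds for the vectors of one iteration -/

namespace Problem

variable {d m : ℕ} {Ξ : Type*} [MeasurableSpace Ξ] {Q : Problem d m Ξ}
  {X : Set (Vec d)} {Lam : Set (Vec m)} {K τ : ℝ}

lemma UniformBounds.norm_G_GT_apply (hb : Q.UniformBounds X Lam K τ) {x : Vec d} (hx : x ∈ X)
    (y : Vec m) : ‖Q.G x (Q.GT x y)‖ ≤ K ^ 2 * ‖y‖ := by
  have h1 := hb.norm_G_apply hx (Q.GT x y)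
  have h2 := mul_le_mul_of_nonneg_left (hb.norm_GT_apply hx y) hb.K_pos.le
  nlinarith

lemma UniformBounds.norm_refVec_le (hb : Q.UniformBounds X Lam K τ) {x : Vec d} (hx : x ∈ X)
    {ν KM : ℝ} (hν : 0 ≤ ν) {M : Vec m →L[ℝ] Vec d} (hM : ‖M‖ ≤ KM) (w : Vec d) :
    ‖stack (w + ν • M (Q.G x w) + Q.GT x (Q.c x)) (ν • Q.G x (Q.GT x (Q.G x w)))‖ ≤
      ‖w‖ + ν * KM * ‖Q.G x w‖ + K * ‖Q.c x‖ + ν * K ^ 2 * ‖Q.G x w‖ := by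
  have h1 : ‖ν • M (Q.G x w)‖ ≤ ν * KM * ‖Q.G x w‖ := by
    rw [norm_smul, Real.norm_of_nonneg hν, mul_assoc]
    exact mul_le_mul_of_nonneg_left (M.le_of_opNorm_le hM _) hν
  have h2 : ‖ν • Q.G x (Q.GT x (Q.G x w))‖ ≤ ν * K ^ 2 * ‖Q.G x w‖ := by
    rw [norm_smul, Real.norm_of_nonneg hν, mul_assoc]
    exact mul_le_mul_of_nonneg_left (hb.norm_G_GT_apply hx _) hν
  have h3 := norm_add₃_le (a := w) (b := ν • M (Q.G x w)) (c := Q.GT x (Q.c x))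
  linarith [norm_stack_le (w + ν • M (Q.G x w) + Q.GT x (Q.c x))
    (ν • Q.G x (Q.GT x (Q.G x w))), hb.norm_GT_apply hx (Q.c x)]

lemma UniformBounds.norm_meritGrad_le (hb : Q.UniformBounds X Lam K τ) {x : Vec d} (hx : x ∈ X)
    {μ ν KM : ℝ} (hμ : 0 ≤ μ) (hν : 0 ≤ ν) {g : Vec d} {H : Vec d →L[ℝ] Vec d} {l : Vec m}
    (hM : ‖Q.matM g H x l‖ ≤ KM) :
    ‖Q.meritGrad μ ν g H x l‖ ≤
      ‖Q.gradLag g x l‖ + ν * KM * ‖Q.G x (Q.gradLag g x l)‖ + (μ * K + 1) * ‖Q.c x‖ +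
        ν * K ^ 2 * ‖Q.G x (Q.gradLag g x l)‖ := by
  unfold meritGrad
  generalize Q.gradLag g x l = w
  generalize Q.matM g H x l = M at *
  have h1 : ‖ν • M (Q.G x w)‖ ≤ ν * KM * ‖Q.G x w‖ := by
    rw [norm_smul, Real.norm_of_nonneg hν, mul_assoc]
    exact mul_le_mul_of_nonneg_left (M.le_of_opNorm_le hM _) hν
  have h2 : ‖ν • Q.G x (Q.GT x (Q.G x w))‖ ≤ ν * K ^ 2 * ‖Q.G x w‖ := by
    rw [norm_smul, Real.norm_of_nonneg hν, mul_assoc]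
    exact mul_le_mul_of_nonneg_left (hb.norm_G_GT_apply hx _) hν
  have h4 : ‖μ • Q.GT x (Q.c x)‖ ≤ μ * K * ‖Q.c x‖ := by
    rw [norm_smul, Real.norm_of_nonneg hμ, mul_assoc]
    exact mul_le_mul_of_nonneg_left (hb.norm_GT_apply hx _) hμ
  have h3 := norm_add₃_le (a := w) (b := ν • M (Q.G x w)) (c := μ • Q.GT x (Q.c x))
  linarith [norm_stack_le (w + ν • M (Q.G x w) + μ • Q.GT x (Q.c x))
    (Q.c x + ν • Q.G x (Q.GT x (Q.G x w))),
    norm_add_le (Q.c x) (ν • Q.G x (Q.GT x (Q.G x w)))]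

/-- The estimated gradients of the augmented Lagrangian are bounded on `X × Λ`. -/
lemma UniformBounds.exists_meritGrad_bound (hb : Q.UniformBounds X Lam K τ) {ν : ℝ} (hν : 0 ≤ ν)
    (mt M1 M2 : ℝ) : ∃ A, 0 ≤ A ∧ ∀ μ ∈ Set.Icc 0 mt, ∀ x ∈ X, ∀ l ∈ Lam, ∀ g H,
      ‖g - gradient Q.f x‖ ≤ M1 → ‖H - hess Q.f x‖ ≤ M2 → ‖Q.meritGrad μ ν g H x l‖ ≤ A := by
  have hK := hb.K_pos
  obtain ⟨W, hW, hWn⟩ : ∃ W, M1 + K + K ^ 2 ≤ W ∧ 0 ≤ W := ⟨_, le_abs_self _, abs_nonneg _⟩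
  obtain ⟨KM, hKM, hKMn⟩ : ∃ KM,
      (M2 + K + m * K ^ 2) * K + m * (K * (M1 + K + K ^ 2)) ≤ KM ∧ 0 ≤ KM :=
    ⟨_, le_abs_self _, abs_nonneg _⟩
  refine ⟨W + ν * KM * (K * W) + (|mt| * K + 1) * K + ν * K ^ 2 * (K * W), by positivity,
    fun μ hμ x hx l hl g H hg hH => ?_⟩
  refine (hb.norm_meritGrad_le hx hμ.1 hν ((hb.norm_matM hx hl hg hH).trans hKM)).trans ?_
  have h1 := (hb.norm_gradLag hx hl hg).trans hW
  have h2 : ‖Q.G x (Q.gradLag g x l)‖ ≤ K * W :=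
    (hb.norm_G_apply hx _).trans (mul_le_mul_of_nonneg_left h1 hK.le)
  have h3 : μ ≤ |mt| := hμ.2.trans (le_abs_self _)
  have h4 : (μ * K + 1) * ‖Q.c x‖ ≤ (|mt| * K + 1) * K :=
    mul_le_mul (by nlinarith) (hb.norm_c x hx) (norm_nonneg _) (by positivity)
  have h5 := mul_le_mul_of_nonneg_left h2 (mul_nonneg hν hKMn)
  have h6 := mul_le_mul_of_nonneg_left h2 (mul_nonneg hν (sq_nonneg K))
  linarith

/-- The augmented Lagrangian is bounded on `X × Λ`. -/
lemma UniformBounds.exists_merit_bound (hb : Q.UniformBounds X Lam K τ) {ν : ℝ} (hν : 0 ≤ ν)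
    (mt : ℝ) : ∃ A, 0 ≤ A ∧ ∀ μ ∈ Set.Icc 0 mt, ∀ x ∈ X, ∀ l ∈ Lam, |Q.merit μ ν x l| ≤ A := by
  have hK := hb.K_pos
  refine ⟨K + K * K + |mt| / 2 * K ^ 2 + ν / 2 * (K * (K + K ^ 2)) ^ 2, by positivity,
    fun μ hμ x hx l hl => ?_⟩
  have h1 := hb.norm_f x hx
  have h2 : |⟪l, Q.c x⟫| ≤ K * K := (abs_real_inner_le_norm _ _).trans
    (mul_le_mul (hb.norm_lam l hl) (hb.norm_c x hx) (norm_nonneg _) hK.le)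
  have h3 : |μ / 2 * ‖Q.c x‖ ^ 2| ≤ |mt| / 2 * K ^ 2 := by
    rw [abs_of_nonneg (by have := hμ.1; positivity)]
    exact mul_le_mul (by linarith [hμ.2, le_abs_self mt])
      (pow_le_pow_left₀ (norm_nonneg _) (hb.norm_c x hx) 2) (by positivity) (by positivity)
  have h5 : ‖Q.gradLag (gradient Q.f x) x l‖ ≤ K + K ^ 2 := by
    have := hb.norm_gradLag (g := gradient Q.f x) (M1 := 0) hx hl (by simp)
    linarith
  have h4 : |ν / 2 * ‖Q.G x (Q.gradLag (gradient Q.f x) x l)‖ ^ 2| ≤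
      ν / 2 * (K * (K + K ^ 2)) ^ 2 := by
    rw [abs_of_nonneg (by positivity)]
    refine mul_le_mul_of_nonneg_left (pow_le_pow_left₀ (norm_nonneg _) ?_ 2) (by positivity)
    exact (hb.norm_G_apply hx _).trans (mul_le_mul_of_nonneg_left h5 hK.le)
  unfold merit meritVal
  rw [abs_le] at *
  constructor <;> linarith [h1.1, h1.2, h2.1, h2.2, h3.1, h3.2, h4.1, h4.2]

lemma merit_sub_merit (μ μ' ν : ℝ) (x : Vec d) (l : Vec m) :
    Q.merit μ' ν x l - Q.merit μ ν x l = (μ' - μ) / 2 * ‖Q.c x‖ ^ 2 := by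
  unfold merit meritVal
  ring

lemma meritGrad_sub_meritGrad (μ μ' ν : ℝ) (g : Vec d) (H : Vec d →L[ℝ] Vec d) (x : Vec d)
    (l : Vec m) : Q.meritGrad μ' ν g H x l - Q.meritGrad μ ν g H x l =
      stack ((μ' - μ) • Q.GT x (Q.c x)) 0 := by
  unfold meritGrad
  rw [stack_sub, sub_self, sub_smul]
  congr 1
  abel

lemma UniformBounds.norm_exactGrad_sub_le (hb : Q.UniformBounds X Lam K τ) {x : Vec d}
    (hx : x ∈ X) (l : Vec m) (μ μ' ν : ℝ) :
    ‖Q.exactGrad μ' ν x l - Q.exactGrad μ ν x l‖ ≤ |μ' - μ| * K ^ 2 := by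
  unfold exactGrad
  rw [meritGrad_sub_meritGrad]
  refine (norm_stack_le _ _).trans ?_
  rw [norm_zero, add_zero, norm_smul, Real.norm_eq_abs]
  refine mul_le_mul_of_nonneg_left ?_ (abs_nonneg _)
  calc ‖Q.GT x (Q.c x)‖ ≤ K * ‖Q.c x‖ := hb.norm_GT_apply hx _
    _ ≤ K * K := mul_le_mul_of_nonneg_left (hb.norm_c x hx) hb.K_pos.le
    _ = K ^ 2 := by ring

/-- The error of the estimated gradient of the augmented Lagrangian does not depend on `μ`; it is
the vector that occurs in the accuracy event `𝓐ₖ`. -/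
lemma meritGrad_sub_exactGrad (μ ν : ℝ) (g : Vec d) (H : Vec d →L[ℝ] Vec d) (x : Vec d)
    (l : Vec m) : Q.meritGrad μ ν g H x l - Q.exactGrad μ ν x l =
      stack (g - gradient Q.f x +
        ν • (Q.matM g H x l (Q.G x (Q.gradLag g x l)) -
          Q.matM (gradient Q.f x) (hess Q.f x) x l (Q.G x (Q.gradLag (gradient Q.f x) x l))))
        (ν • Q.G x (Q.GT x (Q.G x (g - gradient Q.f x)))) := by
  unfold exactGrad meritGrad
  rw [stack_sub]
  have e : g - gradient Q.f x = Q.gradLag g x l - Q.gradLag (gradient Q.f x) x l := by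
    unfold gradLag
    abel
  rw [e]
  generalize Q.gradLag g x l = w
  generalize Q.gradLag (gradient Q.f x) x l = w'
  congr 1
  · rw [smul_sub]
    abel
  · simp only [map_sub, smul_sub]
    abel

/-- If the gradient of the augmented Lagrangian is estimated with an error of the order of
`s = (dx; G∇ₓ𝓛)`, then the KKT residual is of the order of `s`. -/
theorem UniformBounds.exists_kkt_bound (hb : Q.UniformBounds X Lam K τ) {γ κB M1 M2 K' : ℝ}
    (hS : Q.StepBound X Lam γ κB M1 M2 K') {ν : ℝ} (hν : 0 < ν) {r : ℝ} (hr : 0 ≤ r) :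
    ∃ A, 0 ≤ A ∧ ∀ {x l g H B dx dlam} (_ : Q.IsStep X Lam γ κB M1 M2 x l g H B dx dlam) (μ : ℝ),
      ‖Q.meritGrad μ ν g H x l - Q.exactGrad μ ν x l‖ ≤
        r * ‖stack dx (Q.G x (Q.gradLag g x l))‖ →
      Q.kktResidual x l ≤ A * ‖stack dx (Q.G x (Q.gradLag g x l))‖ := by
  have hK := hb.K_pos
  have hτ := hb.tau_pos
  obtain ⟨KM, hKM, hKMn⟩ : ∃ KM,
      (max M2 0 + K + m * K ^ 2) * K + m * (K * (max M1 0 + K + K ^ 2)) ≤ KM ∧ 0 ≤ KM :=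
    ⟨_, le_abs_self _, abs_nonneg _⟩
  have hK' : 0 ≤ K' := zero_le_one.trans hS.one_le
  refine ⟨(r + ν * (KM + KM * (1 + r / (τ * ν)))) + K' + K', by positivity,
    fun {x l g H B dx dlam} h μ herr => ?_⟩
  have hx := h.mem_X
  have hM : ‖Q.matM g H x l‖ ≤ KM :=
    (hb.norm_matM hx h.mem_Lam (h.g_close.trans (le_max_left _ _))
      (h.H_close.trans (le_max_left _ _))).trans hKM
  have hM' : ‖Q.matM (gradient Q.f x) (hess Q.f x) x l‖ ≤ KM :=
    (hb.norm_matM hx h.mem_Lam (by simp) (by simp)).trans hKM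
  have hw := hS.norm_gradLag h
  have hc := hS.norm_c h
  have hGw := norm_snd_le_stack dx (Q.G x (Q.gradLag g x l))
  rw [meritGrad_sub_exactGrad] at herr
  have e1 := (norm_fst_le_stack _ _).trans herr
  have e2 := (norm_snd_le_stack _ _).trans herr
  generalize Q.matM g H x l = M at *
  generalize Q.matM (gradient Q.f x) (hess Q.f x) x l = M' at *
  have e : Q.gradLag (gradient Q.f x) x l = Q.gradLag g x l - (g - gradient Q.f x) := by
    unfold gradLag
    abel
  unfold kktResidual
  rw [e] at e1 ⊢
  generalize hs : ‖stack dx (Q.G x (Q.gradLag g x l))‖ = s at *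
  have hs0 : 0 ≤ s := hs ▸ norm_nonneg _
  generalize g - gradient Q.f x = u at *
  generalize Q.gradLag g x l = w at *
  rw [norm_smul, Real.norm_of_nonneg hν.le] at e2
  -- the second block of the error bounds `G(g - ∇f)`, hence `g - ∇f` by the first one
  have hGu : ‖Q.G x u‖ ≤ r / (τ * ν) * s := by
    have h1 := mul_le_mul_of_nonneg_left (hb.le_norm_G_GT hx (Q.G x u)) hν.le
    rw [div_mul_eq_mul_div, le_div_iff₀ (by positivity)]
    nlinarith
  have hGwu : ‖Q.G x (w - u)‖ ≤ (1 + r / (τ * ν)) * s := by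
    rw [map_sub]
    linarith [norm_sub_le (Q.G x w) (Q.G x u)]
  have hMw : ‖M (Q.G x w)‖ ≤ KM * s :=
    (M.le_of_opNorm_le hM _).trans (mul_le_mul_of_nonneg_left hGw hKMn)
  have hMw' : ‖M' (Q.G x (w - u))‖ ≤ KM * ((1 + r / (τ * ν)) * s) :=
    (M'.le_of_opNorm_le hM' _).trans (mul_le_mul_of_nonneg_left hGwu hKMn)
  have hu : ‖u‖ ≤ (r + ν * (KM + KM * (1 + r / (τ * ν)))) * s := by
    have h1 : ‖u‖ ≤ ‖u + ν • (M (Q.G x w) - M' (Q.G x (w - u)))‖ +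
        ‖ν • (M (Q.G x w) - M' (Q.G x (w - u)))‖ := by
      have := norm_sub_le (u + ν • (M (Q.G x w) - M' (Q.G x (w - u))))
        (ν • (M (Q.G x w) - M' (Q.G x (w - u))))
      rwa [add_sub_cancel_right] at this
    rw [norm_smul, Real.norm_of_nonneg hν.le] at h1
    have h2 := mul_le_mul_of_nonneg_left
      ((norm_sub_le (M (Q.G x w)) (M' (Q.G x (w - u)))).trans (add_le_add hMw hMw')) hν.le
    linarith
  linarith [norm_stack_le (w - u) (Q.c x), norm_sub_le w u]

end Problem

/-! ### Executions: path properties -/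

lemma norm_batchMean_sub_le {Ξ V : Type*} [NormedAddCommGroup V] [NormedSpace ℝ V] {n : ℕ}
    (hn : 1 ≤ n) {h : Ξ → V} {z : Fin n → Ξ} {v : V} {M : ℝ} (hz : ∀ i, ‖h (z i) - v‖ ≤ M) :
    ‖batchMean h z - v‖ ≤ M := by
  have hn' : (0 : ℝ) < n := by exact_mod_cast hn
  have e : batchMean h z - v = (n : ℝ)⁻¹ • ∑ i, (h (z i) - v) := by
    rw [Finset.sum_sub_distrib, smul_sub, batchMean]
    simp [← Nat.cast_smul_eq_nsmul ℝ, smul_smul, hn'.ne']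
  rw [e, norm_smul, norm_inv, Real.norm_of_nonneg hn'.le, inv_mul_le_iff₀ hn']
  refine (norm_sum_le _ _).trans ((Finset.sum_le_card_nsmul _ _ M fun i _ => hz i).trans ?_)
  simp

namespace Trajectory

variable {d m : ℕ} {Ξ Ω : Type*} [MeasurableSpace Ξ]
  {R : Trajectory d m Ξ Ω} {Q : Problem d m Ξ} {pen : PenaltyParams} {ls : LineSearchParams}
  {X : Set (Vec d)} {Lam : Set (Vec m)} {M0 M1 M2 : ℝ}

/-- The data of every iteration are those of a step in the sense of `Problem.IsStep`. -/
def StepAt (R : Trajectory d m Ξ Ω) (Q : Problem d m Ξ) (pen : PenaltyParams) (X : Set (Vec d))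
    (Lam : Set (Vec m)) (M1 M2 : ℝ) (k : ℕ) (ω : Ω) : Prop :=
  Q.IsStep X Lam pen.gammaRH pen.kappaB M1 M2 (R.x k ω) (R.lam k ω) (R.gBar Q k ω)
    (R.HBar Q k ω) (R.B k ω) (R.dx k ω) (R.dlam k ω)

/-- The penalty parameters are positive, increasing and bounded: each while loop stops as soon as
the threshold `T` is passed. -/
lemma penalty_bounds {K' T : ℝ} {ω : Ω}
    (hS : Q.StepBound X Lam pen.gammaRH pen.kappaB M1 M2 K')
    (hT : K' + K' ^ 2 / (2 * pen.gammaRH) ≤ T)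
    (hstep : ∀ k, R.StepAt Q pen X Lam M1 M2 k ω) (hdir : ∀ k, 0 < ‖R.dir k ω‖)
    (hpen : ∀ k, R.PenaltyUpdate Q pen k ω) (k : ℕ) :
    pen.mu0 ≤ R.muBefore pen k ω ∧ R.muBefore pen k ω ≤ R.mu k ω ∧
      R.mu k ω ≤ max pen.mu0 (pen.rho * T) ∧ R.PenaltyOK Q pen k ω (R.mu k ω) := by
  have hρ := pen.one_lt_rho
  have hρ0 : 0 < pen.rho := zero_lt_one.trans hρ
  have hpos := pen.mu0_pos
  have key : ∀ k, pen.mu0 ≤ R.muBefore pen k ω →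
      R.muBefore pen k ω ≤ max pen.mu0 (pen.rho * T) →
      R.muBefore pen k ω ≤ R.mu k ω ∧ R.mu k ω ≤ max pen.mu0 (pen.rho * T) ∧
        R.PenaltyOK Q pen k ω (R.mu k ω) := by
    intro k hk hk'
    have hok : ∀ μ, T ≤ μ → R.PenaltyOK Q pen k ω μ := fun μ hμ =>
      hS.penalty_ok pen.gammaRH_pos (hstep k) (hdir k) pen.gammaRH_le_nu (hT.trans hμ)
    have hk0 : 0 < R.muBefore pen k ω := hpos.trans_le hk
    have hex : ∃ j : ℕ, R.PenaltyOK Q pen k ω (pen.rho ^ j * R.muBefore pen k ω) := by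
      obtain ⟨j, hj⟩ := pow_unbounded_of_one_lt (T / R.muBefore pen k ω) hρ
      refine ⟨j, hok _ ?_⟩
      rw [div_lt_iff₀ hk0] at hj
      exact hj.le
    classical
    obtain ⟨j, hj, hmin⟩ : ∃ j, R.PenaltyOK Q pen k ω (pen.rho ^ j * R.muBefore pen k ω) ∧
        ∀ i < j, ¬ R.PenaltyOK Q pen k ω (pen.rho ^ i * R.muBefore pen k ω) :=
      ⟨Nat.find hex, Nat.find_spec hex, fun i hi => Nat.find_min hex hi⟩
    rw [hpen k j hj hmin]
    refine ⟨le_mul_of_one_le_left hk0.le (one_le_pow₀ hρ.le), ?_, hj⟩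
    cases j with
    | zero => simpa using hk'
    | succ i =>
      have h1 : pen.rho ^ i * R.muBefore pen k ω < T := by
        by_contra hcon
        exact hmin i (Nat.lt_succ_self i) (hok _ (not_lt.1 hcon))
      refine le_max_of_le_right ?_
      rw [pow_succ', mul_assoc]
      exact mul_le_mul_of_nonneg_left h1.le hρ0.le
  have hall : ∀ k, pen.mu0 ≤ R.muBefore pen k ω ∧
      R.muBefore pen k ω ≤ max pen.mu0 (pen.rho * T) := by
    intro k
    induction k with
    | zero => exact ⟨le_rfl, le_max_left _ _⟩
    | succ j ih =>
      obtain ⟨h1, h2, -⟩ := key j ih.1 ih.2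
      exact ⟨ih.1.trans h1, h2⟩
  exact ⟨(hall k).1, key k (hall k).1 (hall k).2⟩

variable [MeasurableSpace Ω] {Pr : Measure Ω}

/-- A property of almost every draw holds for all points of all batches, since there are only
countably many of them. Hence it does not matter how the sample sizes select the batches. -/
lemma IsExecution.ae_batch (hE : R.IsExecution Q pen ls Pr) {p : Ξ → Prop}
    (hp : ∀ᵐ ζ ∂Q.P, p ζ) : ∀ᵐ ω ∂Pr, ∀ k n i, p (R.Zg k n ω i) := by
  rw [ae_all_iff]
  intro k
  rw [ae_all_iff]
  intro n
  rw [ae_all_iff]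
  intro i
  have h1 : ∀ᵐ z ∂(Measure.pi fun _ : Fin n => Q.P), p (z i) :=
    (measurePreserving_eval (fun _ : Fin n => Q.P) i).quasiMeasurePreserving.ae hp
  rw [← hE.law_Zg k n] at h1
  exact ae_of_ae_map (hE.measurable_Zg k n).aemeasurable h1

lemma IsExecution.ae_stepAt (hE : R.IsExecution Q pen ls Pr)
    (hI : R.IterateAssumptions Q pen X Lam Pr) (hQ : Q.Regular X Lam M0 M1 M2) :
    ∀ᵐ ω ∂Pr, ∀ k, R.StepAt Q pen X Lam M1 M2 k ω := by
  filter_upwards [hI.mem_X, hI.mem_Lam, hI.B_bound, hE.B_pos, hE.newton, hE.size_g,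
    hE.ae_batch hQ.noise_gradF, hE.ae_batch hQ.noise_hessF] with ω hx hl hB hBp hN hsz hg hH k
  have hn : ∀ k, 1 ≤ R.Ng k ω := fun k => by
    cases k with
    | zero => exact hsz.1
    | succ j => exact le_trans (by omega) (hsz.2 j)
  obtain ⟨⟨dt, h1, h2⟩, h3⟩ := hN k
  exact ⟨hx k, hl k, hB k, hBp k,
    norm_batchMean_sub_le (hn k) fun i => hg k _ i _ (hx k),
    norm_batchMean_sub_le (hn k) fun i => hH k _ i _ (hx k), ⟨dt, h1⟩, h2, h3⟩

end Trajectory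

lemma PenaltyParams.nu_pos (pen : PenaltyParams) : 0 < pen.nu :=
  pen.gammaRH_pos.trans_le pen.gammaRH_le_nu

namespace Problem

variable {d m : ℕ} {Ξ : Type*} [MeasurableSpace Ξ] {Q : Problem d m Ξ}
  {X : Set (Vec d)} {Lam : Set (Vec m)} {M0 M1 M2 : ℝ}

lemma Regular.exists_smoothOn (hQ : Q.Regular X Lam M0 M1 M2) : ∃ U, X ⊆ U ∧ Q.SmoothOn U := by
  obtain ⟨U, hU, hXU, hf, hc, -⟩ := hQ.smooth
  exact ⟨U, hXU, hU, hf, hc⟩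

lemma Regular.exists_bounds (hQ : Q.Regular X Lam M0 M1 M2) :
    ∃ K τ, Q.UniformBounds X Lam K τ := by
  obtain ⟨U, hXU, hU⟩ := hQ.exists_smoothOn
  exact hU.exists_uniformBounds hXU hQ.compact_X hQ.compact_Lam hQ.full_rank

/-- Constants that serve all executions: `penalty_bounds` bounds the penalty parameters, `StepBound`
the vectors of an iteration, and compactness the Hessian. -/
theorem Regular.exists_consts (hQ : Q.Regular X Lam M0 M1 M2) (pen : PenaltyParams) :
    ∃ C : Consts, ∀ (Ω : Type*) [MeasurableSpace Ω] (Pr : Measure Ω) [IsProbabilityMeasure Pr]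
      (ls : LineSearchParams) (R : Trajectory d m Ξ Ω),
      R.IsExecution Q pen ls Pr → R.IterateAssumptions Q pen X Lam Pr →
      C.Admissible Q X Lam pen R Pr := by
  obtain ⟨K, τ, hb⟩ := hQ.exists_bounds
  obtain ⟨U, hXU, hU⟩ := hQ.exists_smoothOn
  obtain ⟨K', hS⟩ := hb.exists_stepBound pen.gammaRH_pos pen.kappaB M1 M2
  have hK := hb.K_pos
  have hK' : 0 ≤ K' := zero_le_one.trans hS.one_le
  have hν := pen.nu_pos
  obtain ⟨mt, hmt⟩ : ∃ mt, mt = max pen.mu0 (pen.rho * (K' + K' ^ 2 / (2 * pen.gammaRH))) :=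
    ⟨_, rfl⟩
  have hmt0 : 0 < mt := by
    rw [hmt]
    exact lt_max_of_lt_left pen.mu0_pos
  obtain ⟨κ, -, hκ⟩ := hU.exists_hess_bound
    (K := pdSet X Lam) (isCompact_pdSet hQ.compact_X hQ.compact_Lam)
    (fun p hp => ⟨hXU hp.1, trivial⟩) pen.nu mt
  obtain ⟨KM, hKM, hKMn⟩ : ∃ KM,
      (M2 + K + m * K ^ 2) * K + m * (K * (M1 + K + K ^ 2)) ≤ KM ∧ 0 ≤ KM :=
    ⟨_, le_abs_self _, abs_nonneg _⟩
  refine ⟨⟨mt, κ, K' + pen.nu * KM + K * K' + pen.nu * K ^ 2, K',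
    K' + pen.nu * KM + (mt * K + 1) * K' + pen.nu * K ^ 2⟩, ?_⟩
  intro Ω _ Pr _ ls R hE hI
  have hstep := hE.ae_stepAt hI hQ
  have hpath : ∀ᵐ ω ∂Pr, ∀ k, R.StepAt Q pen X Lam M1 M2 k ω ∧
      0 ≤ R.mu k ω ∧ R.mu k ω ≤ mt := by
    filter_upwards [hstep, hI.dir_pos, hE.penalty] with ω h1 h2 h3 k
    obtain ⟨p1, p2, p3, -⟩ := Trajectory.penalty_bounds hS le_rfl h1 h2 h3 k
    exact ⟨h1 k, by linarith [pen.mu0_pos], hmt ▸ p3⟩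
  have hM : ∀ {k ω}, R.StepAt Q pen X Lam M1 M2 k ω → ‖R.MBar Q k ω‖ ≤ KM := fun h =>
    (hb.norm_matM h.mem_X h.mem_Lam h.g_close h.H_close).trans hKM
  refine ⟨fun μ hμ x hx l hl => hκ μ hμ (stack x l) ⟨hx, hl⟩, ?_, ?_, ?_, ?_⟩
  · filter_upwards [hpath] with ω h k using (h k).2.2
  · filter_upwards [hpath] with ω h k
    have hk := (h k).1
    have h1 := hb.norm_refVec_le hk.mem_X hν.le (hM hk) (R.gradLagBar Q k ω)
    have h2 := hS.norm_gradLag hk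
    have h3 := hS.norm_c hk
    have h4 := norm_snd_le_stack (R.dx k ω) (Q.G (R.x k ω) (R.gradLagBar Q k ω))
    refine h1.trans ?_
    change _ ≤ _ * ‖stack (R.dx k ω) (Q.G (R.x k ω) (R.gradLagBar Q k ω))‖
    change ‖R.gradLagBar Q k ω‖ ≤
      K' * ‖stack (R.dx k ω) (Q.G (R.x k ω) (R.gradLagBar Q k ω))‖ at h2
    change _ ≤ K' * ‖stack (R.dx k ω) (Q.G (R.x k ω) (R.gradLagBar Q k ω))‖ at h3
    have h5 := mul_le_mul_of_nonneg_left h4 (mul_nonneg hν.le hKMn)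
    have h6 := mul_le_mul_of_nonneg_left h4 (mul_nonneg hν.le (sq_nonneg K))
    have h7 := mul_le_mul_of_nonneg_left h3 hK.le
    linarith
  · filter_upwards [hpath] with ω h k using hS.norm_dir (h k).1
  · filter_upwards [hpath] with ω h k
    obtain ⟨hk, hμ0, hμ1⟩ := h k
    have h1 := hb.norm_meritGrad_le hk.mem_X hμ0 hν.le (hM hk)
    have h2 := hS.norm_gradLag hk
    have h3 := hS.norm_c hk
    have h4 := norm_snd_le_stack (R.dx k ω) (Q.G (R.x k ω) (R.gradLagBar Q k ω))
    refine h1.trans ?_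
    change ‖R.gradLagBar Q k ω‖ + pen.nu * KM * ‖Q.G (R.x k ω) (R.gradLagBar Q k ω)‖ + _ +
      pen.nu * K ^ 2 * ‖Q.G (R.x k ω) (R.gradLagBar Q k ω)‖ ≤
        _ * ‖stack (R.dx k ω) (Q.G (R.x k ω) (R.gradLagBar Q k ω))‖
    change ‖R.gradLagBar Q k ω‖ ≤
      K' * ‖stack (R.dx k ω) (Q.G (R.x k ω) (R.gradLagBar Q k ω))‖ at h2
    change _ ≤ K' * ‖stack (R.dx k ω) (Q.G (R.x k ω) (R.gradLagBar Q k ω))‖ at h3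
    have h5 := mul_le_mul_of_nonneg_left h4 (mul_nonneg hν.le hKMn)
    have h6 := mul_le_mul_of_nonneg_left h4 (mul_nonneg hν.le (sq_nonneg K))
    have h7 : (R.mu k ω * K + 1) * ‖Q.c (R.x k ω)‖ ≤ (mt * K + 1) *
        (K' * ‖stack (R.dx k ω) (Q.G (R.x k ω) (R.gradLagBar Q k ω))‖) :=
      mul_le_mul (by nlinarith) h3 (norm_nonneg _) (by positivity)
    linarith

end Problem

/-! ### One-step decrease of the potential -/

/-- The change of the potential in a successful step. `E` is the total error of the two merit
values, `a` and `b` say whether the gradient and the merit values are estimated accurately. -/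
lemma descent_of_success {w ρ β γ Υ α α' D D' ℓ ε ε' L L' E s : ℝ} (a b : Prop)
    [Decidable a] [Decidable b]
    (hw0 : 0 < w) (hw1 : w < 1) (hρ : 1 < ρ) (hβ : 0 < β) (hγ : 0 < γ) (hα : 0 < α)
    (hΩ1 : 32 * ρ * Υ ^ 2 / (β * γ) ≤ w / (1 - w)) (hΩ2 : 4 * (ρ - 1) ≤ w / (1 - w))
    (hℓ : α * (γ / 2) * s ^ 2 ≤ ℓ) (hα' : α' ≤ ρ * α)
    (hD : 0 ≤ D) (hD'0 : 0 ≤ D') (hD' : D' ≤ D + Υ * s)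
    (hE : 0 ≤ E) (hL : L' - L ≤ -(β * ℓ) + E) (hε : 0 < ε)
    (hrel : ε ≤ β * ℓ → ε' = ρ * ε) (hunrel : ¬ ε ≤ β * ℓ → ε' = ε / ρ)
    (hA : a → D ≤ Υ * s) (hB : b → E ≤ β * ℓ / 2) :
    w * (L' - L) + (1 - w) / 2 * (α' * D' ^ 2 - α * D ^ 2) + (1 - w) / 2 * (ε' - ε) ≤
      -((1 - w) / 2 * (1 - 1 / ρ) * ((if a then α * D ^ 2 else 0) + ε)) +
        (1 - w) * ρ * (if a then 0 else α * D ^ 2) + w * (if b then 0 else E) -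
        w * β / 8 * (if a ∧ b then ℓ else 0) := by
  have hw : 0 < 1 - w := by linarith
  have hρ0 : 0 < ρ := by linarith
  have hℓ0 : 0 ≤ ℓ := le_trans (by positivity) hℓ
  have hρi : 1 / ρ ≤ 1 := by rw [div_le_one hρ0]; exact hρ.le
  have hρi0 : 0 < 1 / ρ := by positivity
  have hX0 : 0 ≤ α * D ^ 2 := by positivity
  have hβℓ : 0 ≤ w * (β * ℓ) := by positivity
  -- the squared gradient norm grows by at most a multiple of the predicted decrease
  have hΥs : (1 - w) * (ρ * (α * (Υ * s) ^ 2)) ≤ w * (β * ℓ) / 16 := by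
    rw [div_le_div_iff₀ (by positivity) hw] at hΩ1
    have h1 : 32 * ρ * Υ ^ 2 * (1 - w) * (α * s ^ 2) ≤ w * (β * γ) * (α * s ^ 2) :=
      mul_le_mul_of_nonneg_right hΩ1 (by positivity)
    have h2 : w * β * (α * (γ / 2) * s ^ 2) ≤ w * β * ℓ :=
      mul_le_mul_of_nonneg_left hℓ (by positivity)
    linarith
  have hgrow : α' * D' ^ 2 ≤ ρ * α * (D + Υ * s) ^ 2 :=
    mul_le_mul hα' (pow_le_pow_left₀ hD'0 hD' 2) (by positivity) (by positivity)
  have hsq : (D + Υ * s) ^ 2 ≤ 2 * D ^ 2 + 2 * (Υ * s) ^ 2 := by nlinarith [sq_nonneg (D - Υ * s)]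
  have hgrow' : α' * D' ^ 2 ≤ ρ * α * (2 * D ^ 2 + 2 * (Υ * s) ^ 2) :=
    hgrow.trans (mul_le_mul_of_nonneg_left hsq (by positivity))
  have hgrow2 : (1 - w) / 2 * (α' * D' ^ 2) ≤
      (1 - w) * ρ * (α * D ^ 2) + (1 - w) * (ρ * (α * (Υ * s) ^ 2)) := by
    have := mul_le_mul_of_nonneg_left hgrow' (by positivity : 0 ≤ (1 - w) / 2)
    linarith
  have heps : (1 - w) / 2 * (ε' - ε) ≤ -((1 - w) / 2 * (1 - 1 / ρ) * ε) + w * (β * ℓ) / 4 := by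
    by_cases h : ε ≤ β * ℓ
    · rw [hrel h]
      rw [le_div_iff₀ hw] at hΩ2
      have h1 : 4 * (ρ - 1) * (1 - w) * ε ≤ w * (β * ℓ) :=
        (mul_le_mul_of_nonneg_right hΩ2 hε.le).trans (mul_le_mul_of_nonneg_left h hw0.le)
      -- `ρ + 1/ρ ≥ 2`, hence `1 - 1/ρ ≤ ρ - 1`
      have h2 : 1 - 1 / ρ ≤ ρ - 1 := by
        have : 1 - 1 / ρ = (ρ - 1) / ρ := by field_simp
        rw [this, div_le_iff₀ hρ0]
        nlinarith
      have h3 : (1 - w) / 2 * (1 - 1 / ρ) * ε ≤ (1 - w) / 2 * (ρ - 1) * ε :=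
        mul_le_mul_of_nonneg_right (mul_le_mul_of_nonneg_left h2 (by positivity)) hε.le
      linarith
    · rw [hunrel h]
      have : (1 - w) / 2 * (ε / ρ - ε) = -((1 - w) / 2 * (1 - 1 / ρ) * ε) := by ring
      rw [this]
      linarith
  have hLw : w * (L' - L) ≤ -(w * (β * ℓ)) + w * E := by
    have := mul_le_mul_of_nonneg_left hL hw0.le
    linarith
  have hEw : 0 ≤ w * E := by positivity
  have hXw : 0 ≤ (1 - w) / 2 * (1 / ρ) * (α * D ^ 2) := by positivity
  have hX2 : 0 ≤ (1 - w) / 2 * (α * D ^ 2) := by positivity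
  have hBw : b → w * E ≤ w * (β * ℓ) / 2 := fun hb => by
    have := mul_le_mul_of_nonneg_left (hB hb) hw0.le
    linarith
  by_cases ha : a
  · have hDs : (1 - w) * ρ * (α * D ^ 2) ≤ (1 - w) * (ρ * (α * (Υ * s) ^ 2)) := by
      have : D ^ 2 ≤ (Υ * s) ^ 2 := pow_le_pow_left₀ hD (hA ha) 2
      rw [mul_assoc]
      gcongr
    by_cases hb : b
    · have := hBw hb
      simp only [ha, hb, if_true, and_self]
      linarith
    · simp only [ha, hb, if_true, if_false, and_false]
      linarith
  · by_cases hb : b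
    · have := hBw hb
      simp only [ha, hb, if_true, if_false, false_and]
      linarith
    · simp only [ha, hb, if_false, and_self]
      linarith

/-! ### Stepsizes bounded away from zero infinitely often -/

/-- A stepsize that is multiplied by `ρ` after successes and divided by `ρ` after failures cannot
stay away from the successful good steps with large stepsize: good steps with small stepsize succeed
and raise it, failing good steps lower it, and good steps prevail (which is expressed by the
convergence to zero of the product of the factors `r < 1` for good and `r⁻¹` for bad steps). -/
lemma frequently_good_success {ρ αmax αt r : ℝ} (hρ : 1 < ρ) (hαmax : 0 < αmax) (hαt : 0 < αt)
    (hr0 : 0 < r) (hr1 : r < 1) :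
    ∃ a > 0, ∀ (α : ℕ → ℝ) (good succ : ℕ → Prop) [DecidablePred good],
      α 0 = αmax → (∀ k, succ k → α (k + 1) = min αmax (ρ * α k)) →
      (∀ k, ¬ succ k → α (k + 1) = α k / ρ) →
      (∀ k, good k → α k ≤ αt → succ k) →
      Tendsto (fun n => ∏ j ∈ Finset.range n, if good j then r else r⁻¹) atTop (𝓝 0) →
      ∃ᶠ k in atTop, good k ∧ succ k ∧ a ≤ α k := by
  have hρ0 : 0 < ρ := by linarith
  obtain ⟨I, hI⟩ := pow_unbounded_of_one_lt (αmax / αt) hρ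
  have hI' : αmax / ρ ^ I ≤ αt := by
    rw [div_le_iff₀ (by positivity)]
    rw [div_lt_iff₀ hαt] at hI
    linarith
  refine ⟨αmax / ρ ^ I, by positivity, fun α good succ _ h0 hs hf hgs hlim => ?_⟩
  classical
  -- the exponent `i` in `α = αmax / ρ ^ i`
  have hex : ∃ i : ℕ → ℕ, (∀ k, α k = αmax / ρ ^ i k) ∧
      (∀ k, succ k → i (k + 1) = i k - 1) ∧ (∀ k, ¬ succ k → i (k + 1) = i k + 1) := by
    let i : ℕ → ℕ := fun k => Nat.rec 0 (fun k n => if succ k then n - 1 else n + 1) k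
    have his : ∀ k, i (k + 1) = if succ k then i k - 1 else i k + 1 := fun k => rfl
    refine ⟨i, fun k => ?_, fun k hk => by rw [his, if_pos hk], fun k hk => by rw [his, if_neg hk]⟩
    induction k with
    | zero => simp [h0, i]
    | succ k ih =>
      rw [his]
      by_cases hk : succ k
      · rw [if_pos hk, hs k hk, ih]
        rcases Nat.eq_zero_or_pos (i k) with hz | hz
        · rw [hz]
          simp only [pow_zero, div_one, zero_tsub]
          exact min_eq_left (le_mul_of_one_le_left hαmax.le hρ.le)
        · obtain ⟨j, hj⟩ : ∃ j, i k = j + 1 := ⟨i k - 1, by omega⟩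
          rw [hj, Nat.add_sub_cancel]
          have e : ρ * (αmax / ρ ^ (j + 1)) = αmax / ρ ^ j := by
            field_simp
            ring
          rw [e]
          exact min_eq_right (div_le_self hαmax.le (one_le_pow₀ hρ.le))
      · rw [if_neg hk, hf k hk, ih, pow_succ, div_div]
  obtain ⟨i, hi, hi1, hi2⟩ := hex
  -- otherwise, from some `N` on, no good step succeeds with exponent at most `I`
  by_contra hcon
  rw [not_frequently, eventually_atTop] at hcon
  obtain ⟨N, hN⟩ := hcon
  have hle : ∀ k, i k ≤ I → αmax / ρ ^ I ≤ α k := fun k hk => by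
    rw [hi k]
    exact div_le_div_of_nonneg_left hαmax.le (by positivity) (pow_le_pow_right₀ hρ.le hk)
  have hge : ∀ k, I ≤ i k → α k ≤ αt := fun k hk => by
    rw [hi k]
    exact (div_le_div_of_nonneg_left hαmax.le (by positivity)
      (pow_le_pow_right₀ hρ.le hk)).trans hI'
  -- the distance of the exponent to `I` drops by one in good steps and grows by at most one in the
  -- others, which contradicts the prevalence of good steps
  let V : ℕ → ℕ := fun k => (i k - I) + (I - i k)
  have hVg : ∀ k ≥ N, good k → V k = V (k + 1) + 1 := by
    intro k hk hg
    have hno := hN k hk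
    simp only [V]
    rcases le_or_gt (i k) I with h | h
    · have hns : ¬ succ k := fun hsk => hno ⟨hg, hsk, hle k h⟩
      have hne : i k ≠ I := fun he => hns (hgs k hg (hge k he.ge))
      rw [hi2 k hns]
      omega
    · rw [hi1 k (hgs k hg (hge k h.le))]
      omega
  have hVb : ∀ k, V (k + 1) ≤ V k + 1 := by
    intro k
    simp only [V]
    by_cases hk : succ k
    · rw [hi1 k hk]; omega
    · rw [hi2 k hk]; omega
  let Y : ℕ → ℝ := fun n => ∏ j ∈ Finset.range n, if good j then r else r⁻¹
  have hY0 : ∀ n, 0 < Y n := fun n => Finset.prod_pos fun j _ => by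
    split_ifs <;> positivity
  have hmono : ∀ n ≥ N, r ^ V n * Y n ≤ r ^ V (n + 1) * Y (n + 1) := by
    intro n hn
    have hYs : Y (n + 1) = Y n * (if good n then r else r⁻¹) := Finset.prod_range_succ _ _
    rw [hYs]
    by_cases hg : good n
    · rw [if_pos hg, hVg n hn hg, pow_succ]
      exact le_of_eq (by ring)
    · rw [if_neg hg]
      have h1 : r ^ (V n + 1) ≤ r ^ V (n + 1) := pow_le_pow_of_le_one hr0.le hr1.le (hVb n)
      have h2 : r ^ V n ≤ r ^ V (n + 1) * r⁻¹ := by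
        rw [← div_eq_mul_inv, le_div_iff₀ hr0, ← pow_succ]
        exact h1
      calc r ^ V n * Y n ≤ (r ^ V (n + 1) * r⁻¹) * Y n :=
            mul_le_mul_of_nonneg_right h2 (hY0 n).le
        _ = _ := by ring
  have hall : ∀ n ≥ N, r ^ V N * Y N ≤ Y n := by
    intro n hn
    have : r ^ V N * Y N ≤ r ^ V n * Y n := by
      induction n, hn using Nat.le_induction with
      | base => exact le_rfl
      | succ n hn ih => exact ih.trans (hmono n hn)
    exact this.trans (mul_le_of_le_one_left (hY0 n).le (pow_le_one₀ hr0.le hr1.le))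
  have hpos : 0 < r ^ V N * Y N := mul_pos (pow_pos hr0 _) (hY0 N)
  obtain ⟨n, hn1, hn2⟩ := ((hlim.eventually (gt_mem_nhds hpos)).and (eventually_ge_atTop N)).exists
  exact absurd (hall n hn2) (not_le.2 hn1)

/-! ### Conditional expectations tested against known weights -/

section CondExp

variable {Ω : Type*} {m m0 : MeasurableSpace Ω} {Pr : Measure Ω}

/-- A conditional bound, integrated against a bounded nonnegative weight that is measurable with
respect to the conditioning σ-algebra. -/
lemma integral_mul_le_of_condExp_le [IsFiniteMeasure Pr] (hm : m ≤ m0) {W f g : Ω → ℝ}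
    (hW : Measurable[m] W) (hW0 : 0 ≤ᵐ[Pr] W) {C : ℝ} (hWC : ∀ᵐ ω ∂Pr, W ω ≤ C)
    (hf : Integrable f Pr) (hg : Integrable g Pr) (hfg : Pr[f | m] ≤ᵐ[Pr] g) :
    ∫ ω, W ω * f ω ∂Pr ≤ ∫ ω, W ω * g ω ∂Pr := by
  have hWb : ∀ᵐ ω ∂Pr, ‖W ω‖ ≤ C := by
    filter_upwards [hW0, hWC] with ω h1 h2
    rwa [Real.norm_of_nonneg h1]
  have hWm : AEStronglyMeasurable W Pr := (hW.mono hm le_rfl).aestronglyMeasurable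
  have hWf : Integrable (W * f) Pr := hf.bdd_mul hWm hWb
  have hWg : Integrable (fun ω => W ω * g ω) Pr := hg.bdd_mul hWm hWb
  have h1 : ∫ ω, W ω * f ω ∂Pr = ∫ ω, W ω * (Pr[f | m]) ω ∂Pr := by
    have h2 := condExp_mul_of_stronglyMeasurable_left hW.stronglyMeasurable hWf hf
    have h3 : ∫ ω, (W * f) ω ∂Pr = ∫ ω, (Pr[W * f | m]) ω ∂Pr := (integral_condExp hm).symm
    calc ∫ ω, W ω * f ω ∂Pr = ∫ ω, (Pr[W * f | m]) ω ∂Pr := h3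
      _ = _ := integral_congr_ae h2
  rw [h1]
  refine integral_mono_ae (integrable_condExp.bdd_mul hWm hWb) hWg ?_
  filter_upwards [hW0, hfg] with ω h1 h2 using mul_le_mul_of_nonneg_left h2 h1

lemma integral_mul_indicator_le [IsFiniteMeasure Pr] (hm : m ≤ m0) {W : Ω → ℝ} {s : Set Ω} {p : ℝ}
    (hs : MeasurableSet s) (hW : Measurable[m] W) (hW0 : 0 ≤ᵐ[Pr] W) {C : ℝ}
    (hWC : ∀ᵐ ω ∂Pr, W ω ≤ C) (hp : Pr⟦s | m⟧ ≤ᵐ[Pr] fun _ => p) :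
    ∫ ω, W ω * s.indicator (fun _ => (1 : ℝ)) ω ∂Pr ≤ p * ∫ ω, W ω ∂Pr := by
  have := integral_mul_le_of_condExp_le hm hW hW0 hWC ((integrable_const 1).indicator hs)
    (integrable_const p) hp
  rwa [integral_mul_const, mul_comm] at this

end CondExp

/-- Nonnegative functions with summable integrals tend to zero almost everywhere. -/
lemma ae_tendsto_zero_of_sum_integral_le {Ω : Type*} [MeasurableSpace Ω] {Pr : Measure Ω}
    {f : ℕ → Ω → ℝ} (hf : ∀ k, Integrable (f k) Pr) (hf0 : ∀ k, 0 ≤ᵐ[Pr] f k) {C : ℝ}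
    (hC : ∀ n, ∑ k ∈ Finset.range n, ∫ ω, f k ω ∂Pr ≤ C) :
    ∀ᵐ ω ∂Pr, Tendsto (fun k => f k ω) atTop (𝓝 0) := by
  have hsum : ∫⁻ ω, ∑' k, ENNReal.ofReal (f k ω) ∂Pr ≠ ⊤ := by
    rw [lintegral_tsum fun k => (hf k).aestronglyMeasurable.aemeasurable.ennreal_ofReal]
    refine ne_top_of_le_ne_top ENNReal.ofReal_ne_top
      (ENNReal.tsum_le_of_sum_range_le (c := ENNReal.ofReal C) fun n => ?_)
    have h1 : ∀ k, ∫⁻ ω, ENNReal.ofReal (f k ω) ∂Pr = ENNReal.ofReal (∫ ω, f k ω ∂Pr) :=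
      fun k => (ofReal_integral_eq_lintegral_ofReal (hf k) (hf0 k)).symm
    simp only [h1]
    rw [← ENNReal.ofReal_sum_of_nonneg fun k _ => integral_nonneg_of_ae (hf0 k)]
    exact ENNReal.ofReal_le_ofReal (hC n)
  have hae := ae_lt_top' (AEMeasurable.tsum
    fun k => (hf k).aestronglyMeasurable.aemeasurable.ennreal_ofReal) hsum
  filter_upwards [hae, ae_all_iff.2 hf0] with ω h1 h2
  have h3 := ENNReal.tendsto_atTop_zero_of_tsum_ne_top h1.ne
  have h4 := (ENNReal.tendsto_toReal ENNReal.zero_ne_top).comp h3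
  rw [ENNReal.toReal_zero] at h4
  refine h4.congr fun k => ?_
  exact ENNReal.toReal_ofReal (h2 k)

open Classical in
/-- If good events occur with conditional probability at least `q > 1/2`, then almost surely the
good events prevail in the long run: the product of factors `r = 1/(2q) < 1` for good and `r⁻¹` for
bad events tends to zero, because its expectation decays geometrically. -/
lemma ae_tendsto_prod_zero {Ω : Type*} [m0 : MeasurableSpace Ω] {Pr : Measure Ω}
    [IsProbabilityMeasure Pr] {ℱ : ℕ → MeasurableSpace Ω} (hℱm : Monotone ℱ) (hℱ : ∀ k, ℱ k ≤ m0)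
    {good : ℕ → Set Ω} (hgood : ∀ k, MeasurableSet[ℱ (k + 1)] (good k)) {q : ℝ} (hq : 1 / 2 < q)
    (hprob : ∀ k (W : Ω → ℝ), Measurable[ℱ k] W → (∀ ω, 0 ≤ W ω) → ∀ C, (∀ ω, W ω ≤ C) →
      q * ∫ ω, W ω ∂Pr ≤ ∫ ω, W ω * (good k).indicator (fun _ => (1 : ℝ)) ω ∂Pr) :
    ∀ᵐ ω ∂Pr, Tendsto (fun n => ∏ j ∈ Finset.range n,
      if ω ∈ good j then 1 / (2 * q) else (1 / (2 * q))⁻¹) atTop (𝓝 0) := by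
  have hq0 : 0 < q := by linarith
  set r : ℝ := 1 / (2 * q) with hr
  have hr0 : 0 < r := by positivity
  have hr1 : r < 1 := by rw [hr, div_lt_one (by positivity)]; linarith
  have hri : 1 ≤ r⁻¹ := (one_le_inv₀ hr0).2 hr1.le
  let Y : ℕ → Ω → ℝ := fun n ω => ∏ j ∈ Finset.range n,
    (if ω ∈ good j then r else r⁻¹)
  have hfac : ∀ j ω, 0 ≤ (if ω ∈ good j then r else r⁻¹) ∧
      (if ω ∈ good j then r else r⁻¹) ≤ r⁻¹ := by
    intro j ω
    by_cases h : ω ∈ good j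
    · simp only [h, if_true]
      exact ⟨hr0.le, hr1.le.trans hri⟩
    · simp only [h, if_false, le_refl, and_true]
      positivity
  have hY0 : ∀ n ω, 0 ≤ Y n ω := fun n ω => Finset.prod_nonneg fun j _ => (hfac j ω).1
  have hYb : ∀ n ω, Y n ω ≤ r⁻¹ ^ n := fun n ω => by
    have := Finset.prod_le_prod (s := Finset.range n) (fun j _ => (hfac j ω).1)
      fun j _ => (hfac j ω).2
    simpa using this
  have hYm : ∀ n, Measurable[ℱ n] (Y n) := fun n =>
    Finset.measurable_prod _ fun j hj =>
      Measurable.ite (hℱm (Finset.mem_range.1 hj) _ (hgood j)) measurable_const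
        measurable_const
  have hYi : ∀ n, Integrable (Y n) Pr := fun n =>
    Integrable.of_bound ((hYm n).mono (hℱ n) le_rfl).aestronglyMeasurable (r⁻¹ ^ n)
      (Eventually.of_forall fun ω => by rw [Real.norm_of_nonneg (hY0 n ω)]; exact hYb n ω)
  -- the factor by which the expectation of the product shrinks
  set θ : ℝ := r⁻¹ - (r⁻¹ - r) * q with hθ
  have hθ1 : θ < 1 := by
    have e : θ = 1 - 2 * (q - 1 / 2) ^ 2 := by
      rw [hθ, hr]
      field_simp
      ring
    rw [e]
    nlinarith
  have hrec : ∀ n, ∫ ω, Y (n + 1) ω ∂Pr ≤ θ * ∫ ω, Y n ω ∂Pr := by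
    intro n
    have hgm : MeasurableSet (good n) := hℱ _ _ (hgood n)
    have e : ∀ ω, Y (n + 1) ω = r⁻¹ * Y n ω -
        (r⁻¹ - r) * (Y n ω * (good n).indicator (fun _ => (1 : ℝ)) ω) := by
      intro ω
      have : Y (n + 1) ω = Y n ω * (if ω ∈ good n then r else r⁻¹) :=
        Finset.prod_range_succ _ _
      rw [this]
      by_cases h : ω ∈ good n
      · simp only [h, if_true, Set.indicator_of_mem]
        ring
      · simp only [h, if_false, not_false_eq_true, Set.indicator_of_notMem]
        ring
    simp only [e]
    have hi : Integrable (fun ω => Y n ω * (good n).indicator (fun _ => (1 : ℝ)) ω) Pr := by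
      refine ((hYi n).indicator hgm).congr (Eventually.of_forall fun ω => ?_)
      by_cases h : ω ∈ good n <;> simp [h]
    rw [integral_sub ((hYi n).const_mul _) (hi.const_mul _), integral_const_mul,
      integral_const_mul]
    have := hprob n (Y n) (hYm n) (hY0 n) _ (hYb n)
    have := mul_le_mul_of_nonneg_left this (by linarith : 0 ≤ r⁻¹ - r)
    rw [hθ]
    linarith
  have hnn : ∀ n, 0 ≤ ∫ ω, Y n ω ∂Pr := fun n => integral_nonneg (hY0 n)
  refine ae_tendsto_zero_of_sum_integral_le hYi (fun n => Eventually.of_forall (hY0 n))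
    (C := (1 - θ)⁻¹ * ∫ ω, Y 0 ω ∂Pr) fun n => ?_
  have htel : (1 - θ) * ∑ k ∈ Finset.range n, ∫ ω, Y k ω ∂Pr ≤
      ∫ ω, Y 0 ω ∂Pr - ∫ ω, Y n ω ∂Pr := by
    induction n with
    | zero => simp
    | succ n ih =>
      rw [Finset.sum_range_succ, mul_add]
      linarith [hrec n]
  rw [inv_mul_eq_div, le_div_iff₀ (by linarith), mul_comm]
  exact htel.trans (sub_le_self _ (hnn n))

/-! ### Measurability -/

section SigmaMeasurable

variable {ι : Type*} {β : ι → Type*} [∀ i, MeasurableSpace (β i)]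

lemma measurableSet_sigma_iff {s : Set (Sigma β)} :
    MeasurableSet s ↔ ∀ i, MeasurableSet (Sigma.mk i ⁻¹' s) := by
  simp only [MeasurableSpace.measurableSet_iInf, MeasurableSpace.map_def]

lemma measurable_of_sigma {γ : Type*} [MeasurableSpace γ] {f : Sigma β → γ}
    (hf : ∀ i, Measurable fun b => f ⟨i, b⟩) : Measurable f := fun _ hs =>
  measurableSet_sigma_iff.2 fun i => hf i hs

/-- Selecting a random member of a countable family of random variables is measurable. -/
lemma measurable_sigma_select {Ω : Type*} [MeasurableSpace Ω] [Countable ι] [MeasurableSpace ι]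
    [MeasurableSingletonClass ι] {N : Ω → ι} {Z : (i : ι) → Ω → β i} (hN : Measurable N)
    (hZ : ∀ i, Measurable (Z i)) : Measurable fun ω => (⟨N ω, Z (N ω) ω⟩ : Sigma β) := by
  intro s hs
  have e : (fun ω => (⟨N ω, Z (N ω) ω⟩ : Sigma β)) ⁻¹' s =
      ⋃ i, N ⁻¹' {i} ∩ Z i ⁻¹' (Sigma.mk i ⁻¹' s) := by
    ext ω
    simp only [Set.mem_preimage, Set.mem_iUnion, Set.mem_inter_iff, Set.mem_singleton_iff]
    constructor
    · intro h
      exact ⟨N ω, rfl, h⟩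
    · rintro ⟨i, rfl, h⟩
      exact h
  rw [e]
  exact MeasurableSet.iUnion fun i => (hN (measurableSet_singleton i)).inter
    (hZ i (measurableSet_sigma_iff.1 hs i))

end SigmaMeasurable

lemma measurableSet_le_real {Ω : Type*} {mΩ : MeasurableSpace Ω} {f g : Ω → ℝ}
    (hf : Measurable f) (hg : Measurable g) : MeasurableSet {ω | f ω ≤ g ω} :=
  measurableSet_le hf hg

lemma measurable_max_abs {Ω : Type*} {mΩ : MeasurableSpace Ω} {f g : Ω → ℝ}
    (hf : Measurable f) (hg : Measurable g) : Measurable fun ω => max |f ω| |g ω| :=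
  hf.norm.max hg.norm

lemma measurable_batchMean {Ω Ξ E V : Type*} {mΩ : MeasurableSpace Ω} [MeasurableSpace Ξ]
    [Nonempty Ξ] [MeasurableSpace E] [NormedAddCommGroup V] [NormedSpace ℝ V] [MeasurableSpace V]
    [BorelSpace V] [SecondCountableTopology V] {h : E → Ξ → V}
    (hh : Measurable fun p : E × Ξ => h p.1 p.2) {y : Ω → E} (hy : Measurable y)
    {z : Ω → Σ n : ℕ, (Fin n → Ξ)} (hz : Measurable z) :
    Measurable fun ω => batchMean (h (y ω)) (z ω).2 := by
  classical
  -- the `i`-th point of a batch, with a default value beyond its end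
  let pt : ℕ → (Σ n : ℕ, (Fin n → Ξ)) → Ξ := fun i b =>
    if hi : i < b.1 then b.2 ⟨i, hi⟩ else Classical.arbitrary Ξ
  have hpt : ∀ i, Measurable (pt i) := fun i => measurable_of_sigma fun n => by
    by_cases hi : i < n
    · have : (fun b : Fin n → Ξ => pt i ⟨n, b⟩) = fun b => b ⟨i, hi⟩ := by
        funext b
        exact dif_pos hi
      rw [this]
      exact measurable_pi_apply _
    · have : (fun b : Fin n → Ξ => pt i ⟨n, b⟩) = fun _ => Classical.arbitrary Ξ := by
        funext b
        exact dif_neg hi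
      rw [this]
      exact measurable_const
  have hfst : Measurable fun b : Σ n : ℕ, (Fin n → Ξ) => b.1 :=
    measurable_of_sigma fun n => measurable_const
  have hF : Measurable fun p : ℕ × Ω =>
      (p.1 : ℝ)⁻¹ • ∑ i ∈ Finset.range p.1, h (y p.2) (pt i (z p.2)) :=
    measurable_from_prod_countable_right fun n => Measurable.const_smul
      (g := fun ω => ∑ i ∈ Finset.range n, h (y ω) (pt i (z ω)))
      (Finset.measurable_sum _ fun i _ => hh.comp (hy.prodMk ((hpt i).comp hz))) (n : ℝ)⁻¹
  convert hF.comp ((hfst.comp hz).prodMk measurable_id) using 1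
  funext ω
  simp only [batchMean, Function.comp_apply, id]
  congr 1
  rw [Finset.sum_range]
  refine Finset.sum_congr rfl fun i _ => ?_
  simp only [pt, i.2, dif_pos]

namespace Problem

variable {d m : ℕ} {Ξ : Type*} [MeasurableSpace Ξ] {Q : Problem d m Ξ}
  {Ω : Type*} {mΩ : MeasurableSpace Ω} {x g w : Ω → Vec d} {l y : Ω → Vec m}
  {H : Ω → (Vec d →L[ℝ] Vec d)}

lemma _root_.Measurable.clm_apply_vec {a b : ℕ} {f : Ω → (Vec a →L[ℝ] Vec b)} {x : Ω → Vec a}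
    (hf : Measurable f) (hx : Measurable x) : Measurable fun ω => f ω (x ω) :=
  isBoundedBilinearMap_apply.continuous.measurable.comp (hf.prodMk hx)

lemma _root_.Measurable.stack (hx : Measurable x) (hl : Measurable l) :
    Measurable fun ω => stack (x ω) (l ω) :=
  (WithLp.prod_continuous_toLp 2 _ _).measurable.comp (hx.prodMk hl)

lemma measurable_gradient (h : Vec d → ℝ) : Measurable (gradient h) :=
  (rieszCLM (Vec d)).continuous.measurable.comp (measurable_fderiv ℝ h)

lemma measurable_hess (h : Vec d → ℝ) : Measurable (hess h) := measurable_fderiv ℝ (gradient h)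

lemma measurable_G_apply (hx : Measurable x) (hw : Measurable w) :
    Measurable fun ω => Q.G (x ω) (w ω) :=
  ((measurable_fderiv ℝ Q.c).comp hx).clm_apply_vec hw

lemma measurable_GT_apply (hx : Measurable x) (hy : Measurable y) :
    Measurable fun ω => Q.GT (x ω) (y ω) :=
  (ContinuousLinearMap.adjoint.continuous.measurable.comp
    ((measurable_fderiv ℝ Q.c).comp hx)).clm_apply_vec hy

lemma measurable_coord (hy : Measurable y) (j : Fin m) : Measurable fun ω => y ω j :=
  (EuclideanSpace.proj j : Vec m →L[ℝ] ℝ).continuous.measurable.comp hy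

lemma measurable_gradLag (hg : Measurable g) (hx : Measurable x) (hl : Measurable l) :
    Measurable fun ω => Q.gradLag (g ω) (x ω) (l ω) :=
  hg.add (measurable_GT_apply hx hl)

lemma measurable_matM_apply (hg : Measurable g) (hH : Measurable H) (hx : Measurable x)
    (hl : Measurable l) (hy : Measurable y) :
    Measurable fun ω => Q.matM (g ω) (H ω) (x ω) (l ω) (y ω) := by
  have hC : ∀ (j : Fin m) {u : Ω → Vec d}, Measurable u →
      Measurable fun ω => Q.hessC j (x ω) (u ω) := fun j u hu =>
    ((measurable_hess fun v => Q.c v j).comp hx).clm_apply_vec hu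
  have e : (fun ω => Q.matM (g ω) (H ω) (x ω) (l ω) (y ω)) = fun ω =>
      (H ω (Q.GT (x ω) (y ω)) + ∑ j, l ω j • Q.hessC j (x ω) (Q.GT (x ω) (y ω))) +
        ∑ j, y ω j • Q.hessC j (x ω) (Q.gradLag (g ω) (x ω) (l ω)) := by
    funext ω
    simp only [matM, hessLag, matT, add_apply, sum_apply, smul_apply,
      ContinuousLinearMap.comp_apply, ContinuousLinearMap.smulRight_apply]
    rfl
  rw [e]
  have hGT := measurable_GT_apply (Q := Q) hx hy
  refine ((hH.clm_apply_vec hGT).add (Finset.measurable_sum _ fun j _ => ?_)).add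
    (Finset.measurable_sum _ fun j _ => ?_)
  · exact (measurable_coord hl j).smul (hC j hGT)
  · exact (measurable_coord hy j).smul (hC j (measurable_gradLag hg hx hl))

lemma measurable_meritGrad (hc : Measurable Q.c) {μ : Ω → ℝ} (hμ : Measurable μ) (ν : ℝ)
    (hg : Measurable g) (hH : Measurable H) (hx : Measurable x) (hl : Measurable l) :
    Measurable fun ω => Q.meritGrad (μ ω) ν (g ω) (H ω) (x ω) (l ω) := by
  have hw := measurable_gradLag (Q := Q) hg hx hl
  have hGw := measurable_G_apply (Q := Q) hx hw
  exact ((hw.add ((measurable_matM_apply hg hH hx hl hGw).const_smul ν)).add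
    (hμ.smul (measurable_GT_apply hx (hc.comp hx)))).stack
    ((hc.comp hx).add ((measurable_G_apply hx (measurable_GT_apply hx hGw)).const_smul ν))

lemma measurable_exactGrad (hc : Measurable Q.c) {μ : Ω → ℝ} (hμ : Measurable μ) (ν : ℝ)
    (hx : Measurable x) (hl : Measurable l) :
    Measurable fun ω => Q.exactGrad (μ ω) ν (x ω) (l ω) :=
  measurable_meritGrad hc hμ ν ((measurable_gradient Q.f).comp hx)
    ((measurable_hess Q.f).comp hx) hx hl

lemma measurable_meritVal (hc : Measurable Q.c) {μ v : Ω → ℝ} (hμ : Measurable μ) (ν : ℝ)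
    (hv : Measurable v) (hg : Measurable g) (hx : Measurable x) (hl : Measurable l) :
    Measurable fun ω => Q.meritVal (μ ω) ν (v ω) (g ω) (x ω) (l ω) :=
  ((hv.add (hl.inner (hc.comp hx))).add ((hμ.div_const 2).mul ((hc.comp hx).norm.pow_const 2))).add
    (((measurable_G_apply hx (measurable_gradLag hg hx hl)).norm.pow_const 2).const_mul (ν / 2))

lemma measurable_f (hF : Measurable fun p : Vec d × Ξ => Q.F p.1 p.2) : Measurable Q.f :=
  (StronglyMeasurable.integral_prod_right (f := Q.F) (ν := Q.P) hF.stronglyMeasurable).measurable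

lemma measurable_merit (hc : Measurable Q.c) (hF : Measurable fun p : Vec d × Ξ => Q.F p.1 p.2)
    {μ : Ω → ℝ} (hμ : Measurable μ) (ν : ℝ) (hx : Measurable x) (hl : Measurable l) :
    Measurable fun ω => Q.merit (μ ω) ν (x ω) (l ω) :=
  measurable_meritVal hc hμ ν ((measurable_f hF).comp hx) ((measurable_gradient Q.f).comp hx) hx hl

end Problem

namespace Trajectory

variable {d m : ℕ} {Ξ Ω : Type*} [MeasurableSpace Ξ]
  {R : Trajectory d m Ξ Ω} {Q : Problem d m Ξ} {pen : PenaltyParams} {ls : LineSearchParams}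
  {X : Set (Vec d)} {Lam : Set (Vec m)} {M0 M1 M2 : ℝ}

lemma past_le_mid (k : ℕ) : R.past k ≤ R.mid k := le_sup_left

lemma comap_xiG_le_past (k : ℕ) (j : Fin k) :
    MeasurableSpace.comap (R.xiG j) inferInstance ≤ R.past k :=
  le_sup_of_le_right (le_iSup_of_le j le_sup_left)

lemma comap_xiF_le_past (k : ℕ) (j : Fin k) :
    MeasurableSpace.comap (R.xiF j) inferInstance ≤ R.past k :=
  le_sup_of_le_right (le_iSup_of_le j le_sup_right)

lemma past_mono : Monotone R.past := by
  intro k n hkn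
  refine sup_le le_sup_left (iSup_le fun j => ?_)
  exact sup_le (comap_xiG_le_past n ⟨j, j.2.trans_le hkn⟩)
    (comap_xiF_le_past n ⟨j, j.2.trans_le hkn⟩)

lemma mid_le_past_succ (k : ℕ) : R.mid k ≤ R.past (k + 1) :=
  sup_le (past_mono (Nat.le_succ k)) (comap_xiG_le_past (k + 1) ⟨k, Nat.lt_succ_self k⟩)

lemma measurable_xiG_mid (k : ℕ) : Measurable[R.mid k] (R.xiG k) :=
  measurable_iff_comap_le.2 le_sup_right

lemma measurable_xiF_past (k : ℕ) : Measurable[R.past (k + 1)] (R.xiF k) :=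
  measurable_iff_comap_le.2 (comap_xiF_le_past (k + 1) ⟨k, Nat.lt_succ_self k⟩)

variable [mΩ : MeasurableSpace Ω] {Pr : Measure Ω}

namespace IsExecution

lemma past_le (hE : R.IsExecution Q pen ls Pr) (k : ℕ) : R.past k ≤ mΩ := by
  refine sup_le (sup_le hE.measurable_x0.comap_le hE.measurable_lam0.comap_le)
    (iSup_le fun j => sup_le ?_ ?_)
  · exact (measurable_sigma_select (hE.measurable_Ng j) (hE.measurable_Zg j)).comap_le
  · exact (measurable_sigma_select (hE.measurable_Nf j) (hE.measurable_Zf j)).comap_le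

lemma mid_le (hE : R.IsExecution Q pen ls Pr) (k : ℕ) : R.mid k ≤ mΩ :=
  (mid_le_past_succ k).trans (hE.past_le (k + 1))

lemma measurable_gBar (hE : R.IsExecution Q pen ls Pr) (hQ : Q.Regular X Lam M0 M1 M2) (k : ℕ) :
    Measurable[R.mid k] (R.gBar Q k) := by
  have : Nonempty Ξ := nonempty_of_isProbabilityMeasure Q.P
  exact measurable_batchMean (mΩ := R.mid k) hQ.measurable_gradF
    ((hE.adapted_x k).mono (past_le_mid k) le_rfl) (measurable_xiG_mid k)

lemma measurable_HBar (hE : R.IsExecution Q pen ls Pr) (hQ : Q.Regular X Lam M0 M1 M2) (k : ℕ) :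
    Measurable[R.mid k] (R.HBar Q k) := by
  have : Nonempty Ξ := nonempty_of_isProbabilityMeasure Q.P
  exact measurable_batchMean (mΩ := R.mid k) hQ.measurable_hessF
    ((hE.adapted_x k).mono (past_le_mid k) le_rfl) (measurable_xiG_mid k)

lemma measurable_meritGradBar (hE : R.IsExecution Q pen ls Pr)
    (hQ : Q.Regular X Lam M0 M1 M2) (k : ℕ) {μ : Ω → ℝ} (hμ : Measurable[R.mid k] μ) :
    Measurable[R.mid k] fun ω => R.meritGradBar Q pen k ω (μ ω) :=
  Problem.measurable_meritGrad (mΩ := R.mid k) hQ.measurable_c hμ _ (hE.measurable_gBar hQ k)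
    (hE.measurable_HBar hQ k) ((hE.adapted_x k).mono (past_le_mid k) le_rfl)
    ((hE.adapted_lam k).mono (past_le_mid k) le_rfl)

lemma measurable_slope (hE : R.IsExecution Q pen ls Pr) (hQ : Q.Regular X Lam M0 M1 M2) (k : ℕ) :
    Measurable[R.mid k] (R.slope Q pen k) :=
  Measurable.inner (hE.measurable_meritGradBar hQ k (hE.adapted_mu k))
    (Measurable.stack (mΩ := R.mid k) (hE.adapted_dx k) (hE.adapted_dlam k))

lemma measurable_muBefore (hE : R.IsExecution Q pen ls Pr) (k : ℕ) :
    Measurable[R.past k] (R.muBefore pen k) := by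
  cases k with
  | zero => exact measurable_const
  | succ j => exact (hE.adapted_mu j).mono (mid_le_past_succ j) le_rfl

lemma measurable_meritBarAt (hE : R.IsExecution Q pen ls Pr) (hQ : Q.Regular X Lam M0 M1 M2)
    (k : ℕ) {y : Ω → Vec d} {l : Ω → Vec m} (hy : Measurable[R.past (k + 1)] y)
    (hl : Measurable[R.past (k + 1)] l) :
    Measurable[R.past (k + 1)] fun ω => R.meritBarAt Q pen k ω (y ω) (l ω) := by
  have : Nonempty Ξ := nonempty_of_isProbabilityMeasure Q.P
  exact Problem.measurable_meritVal (mΩ := R.past (k + 1)) hQ.measurable_c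
    ((hE.adapted_mu k).mono (mid_le_past_succ k) le_rfl) _
    (measurable_batchMean (mΩ := R.past (k + 1)) hQ.measurable_F hy (measurable_xiF_past k))
    (measurable_batchMean (mΩ := R.past (k + 1)) hQ.measurable_gradF hy (measurable_xiF_past k))
    hy hl

lemma measurable_x_succ (hE : R.IsExecution Q pen ls Pr) (k : ℕ) :
    Measurable[R.past (k + 1)] (R.x k) := (hE.adapted_x k).mono (past_mono (Nat.le_succ k)) le_rfl

lemma measurable_lam_succ (hE : R.IsExecution Q pen ls Pr) (k : ℕ) :
    Measurable[R.past (k + 1)] (R.lam k) :=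
  (hE.adapted_lam k).mono (past_mono (Nat.le_succ k)) le_rfl

lemma measurable_alpha_succ (hE : R.IsExecution Q pen ls Pr) (k : ℕ) :
    Measurable[R.past (k + 1)] (R.alpha k) :=
  (hE.adapted_alpha k).mono (past_mono (Nat.le_succ k)) le_rfl

lemma measurable_xTrial (hE : R.IsExecution Q pen ls Pr) (k : ℕ) :
    Measurable[R.past (k + 1)] (R.xTrial k) :=
  Measurable.add (hE.measurable_x_succ k) (Measurable.smul (hE.measurable_alpha_succ k)
    ((hE.adapted_dx k).mono (mid_le_past_succ k) le_rfl))

lemma measurable_lamTrial (hE : R.IsExecution Q pen ls Pr) (k : ℕ) :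
    Measurable[R.past (k + 1)] (R.lamTrial k) :=
  Measurable.add (hE.measurable_lam_succ k) (Measurable.smul (hE.measurable_alpha_succ k)
    ((hE.adapted_dlam k).mono (mid_le_past_succ k) le_rfl))

lemma measurable_meritErr (hE : R.IsExecution Q pen ls Pr) (hQ : Q.Regular X Lam M0 M1 M2)
    (k : ℕ) : Measurable[R.past (k + 1)] (R.meritErr Q pen k) :=
  Measurable.sub (hE.measurable_meritBarAt hQ k (hE.measurable_x_succ k)
    (hE.measurable_lam_succ k))
    (Problem.measurable_merit (mΩ := R.past (k + 1)) hQ.measurable_c hQ.measurable_F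
      ((hE.adapted_mu k).mono (mid_le_past_succ k) le_rfl) _ (hE.measurable_x_succ k)
      (hE.measurable_lam_succ k))

lemma measurable_meritErrTrial (hE : R.IsExecution Q pen ls Pr)
    (hQ : Q.Regular X Lam M0 M1 M2) (k : ℕ) :
    Measurable[R.past (k + 1)] (R.meritErrTrial Q pen k) :=
  Measurable.sub (hE.measurable_meritBarAt hQ k (hE.measurable_xTrial k)
    (hE.measurable_lamTrial k))
    (Problem.measurable_merit (mΩ := R.past (k + 1)) hQ.measurable_c hQ.measurable_F
      ((hE.adapted_mu k).mono (mid_le_past_succ k) le_rfl) _ (hE.measurable_xTrial k)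
      (hE.measurable_lamTrial k))

lemma measurableSet_eventA (hE : R.IsExecution Q pen ls Pr) (hQ : Q.Regular X Lam M0 M1 M2)
    (k : ℕ) : MeasurableSet[R.mid k] (R.eventA Q pen ls k) := by
  have hx := (hE.adapted_x k).mono (past_le_mid k) le_rfl
  have hl := (hE.adapted_lam k).mono (past_le_mid k) le_rfl
  have hg := hE.measurable_gBar hQ k
  have hH := hE.measurable_HBar hQ k
  have hgf : Measurable[R.mid k] fun ω => gradient Q.f (R.x k ω) :=
    (Problem.measurable_gradient Q.f).comp hx
  have hhf : Measurable[R.mid k] fun ω => hess Q.f (R.x k ω) :=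
    (Problem.measurable_hess Q.f).comp hx
  have hw := Problem.measurable_gradLag (mΩ := R.mid k) (Q := Q) hg hx hl
  have hw' := Problem.measurable_gradLag (mΩ := R.mid k) (Q := Q) hgf hx hl
  have hGw := Problem.measurable_G_apply (mΩ := R.mid k) (Q := Q) hx hw
  have hGw' := Problem.measurable_G_apply (mΩ := R.mid k) (Q := Q) hx hw'
  have hMw := Problem.measurable_matM_apply (mΩ := R.mid k) (Q := Q) hg hH hx hl hGw
  have hMw' := Problem.measurable_matM_apply (mΩ := R.mid k) (Q := Q) hgf hhf hx hl hGw'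
  have hGG : ∀ {y : Ω → Vec m}, Measurable[R.mid k] y →
      Measurable[R.mid k] fun ω => Q.G (R.x k ω) (Q.GT (R.x k ω) (y ω)) := fun hy =>
    Problem.measurable_G_apply (mΩ := R.mid k) (Q := Q) hx
      (Problem.measurable_GT_apply (mΩ := R.mid k) hx hy)
  have hsub := Measurable.sub hg hgf
  have h1 := measurable_norm.comp (Measurable.stack (mΩ := R.mid k)
    (Measurable.add hsub (Measurable.const_smul (Measurable.sub hMw hMw') pen.nu))
    (Measurable.const_smul
      (hGG (Problem.measurable_G_apply (mΩ := R.mid k) (Q := Q) hx hsub)) pen.nu))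
  have h2 := measurable_norm.comp (Measurable.stack (mΩ := R.mid k)
    (Measurable.add (Measurable.add hw (Measurable.const_smul hMw pen.nu))
      (Problem.measurable_GT_apply (mΩ := R.mid k) (Q := Q) hx (hQ.measurable_c.comp hx)))
    (Measurable.const_smul (hGG hGw) pen.nu))
  exact measurableSet_le_real h1
    (Measurable.mul (Measurable.const_mul ((hE.adapted_alpha k).mono (past_le_mid k) le_rfl)
      ls.kappaGrad) h2)

lemma measurableSet_eventB (hE : R.IsExecution Q pen ls Pr) (hQ : Q.Regular X Lam M0 M1 M2)
    (k : ℕ) : MeasurableSet[R.past (k + 1)] (R.eventB Q pen ls k) := by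
  have h1 := hE.measurable_meritErr hQ k
  have h2 := hE.measurable_meritErrTrial hQ k
  have h3 := (hE.measurable_slope hQ k).mono (mid_le_past_succ k) le_rfl
  have h4 := hE.measurable_alpha_succ k
  exact measurableSet_le_real
    (measurable_max_abs h1 h2)
    (Measurable.neg (Measurable.mul (Measurable.const_mul (Measurable.pow_const h4 2) ls.kappaF)
      h3))

lemma measurableSet_armijo (hE : R.IsExecution Q pen ls Pr) (hQ : Q.Regular X Lam M0 M1 M2)
    (k : ℕ) : MeasurableSet[R.past (k + 1)] {ω | R.Armijo Q pen ls k ω} := by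
  have h3 := (hE.measurable_slope hQ k).mono (mid_le_past_succ k) le_rfl
  exact measurableSet_le_real
    (hE.measurable_meritBarAt hQ k (hE.measurable_xTrial k) (hE.measurable_lamTrial k))
    (Measurable.add (hE.measurable_meritBarAt hQ k (hE.measurable_x_succ k)
      (hE.measurable_lam_succ k))
      (Measurable.mul (Measurable.mul_const (hE.measurable_alpha_succ k) ls.beta) h3))

end IsExecution

end Trajectory

/-! ### Pathwise analysis of the line search -/

/-- The cost of replacing the squared gradient norm `X` by `Y` in the one-step estimate of the
potential, where `iA` is the indicator of an inaccurate gradient. -/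
lemma penalty_shift_le {v ρ c X Y B iA : ℝ} (hv0 : 0 ≤ v) (hv1 : v ≤ 1) (hρ : 0 ≤ ρ)
    (hc0 : 0 ≤ c) (hc1 : c ≤ 1 / 2) (hXY : |X - Y| ≤ B) (hi0 : 0 ≤ iA) (hi1 : iA ≤ 1) :
    v / 2 * (X - Y) + c * (Y - X) + (v * ρ + c) * ((X - Y) * iA) ≤ (2 + ρ) * B := by
  have hB0 : 0 ≤ B := (abs_nonneg _).trans hXY
  obtain ⟨h1, h2⟩ := abs_le.1 hXY
  have m1 : v / 2 * (X - Y) ≤ 1 / 2 * B :=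
    (mul_le_mul_of_nonneg_left h2 (by positivity)).trans
      (mul_le_mul_of_nonneg_right (by linarith) hB0)
  have m2 : c * (Y - X) ≤ 1 / 2 * B :=
    (mul_le_mul_of_nonneg_left (by linarith : Y - X ≤ B) hc0).trans
      (mul_le_mul_of_nonneg_right hc1 hB0)
  have m3 : (X - Y) * iA ≤ B :=
    (mul_le_mul_of_nonneg_right h2 hi0).trans (mul_le_of_le_one_right hB0 hi1)
  have hc2 : v * ρ + c ≤ ρ + 1 / 2 := add_le_add (mul_le_of_le_one_left hρ hv1) hc1
  have m4 : (v * ρ + c) * ((X - Y) * iA) ≤ (ρ + 1 / 2) * B :=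
    (mul_le_mul_of_nonneg_left m3 (by positivity)).trans (mul_le_mul_of_nonneg_right hc2 hB0)
  linarith

namespace Trajectory

variable {d m : ℕ} {Ξ Ω : Type*} [MeasurableSpace Ξ]

/-- The properties that almost every path of an execution has. -/
structure GoodPath (R : Trajectory d m Ξ Ω) (Q : Problem d m Ξ) (pen : PenaltyParams)
    (ls : LineSearchParams) (X : Set (Vec d)) (Lam : Set (Vec m)) (M1 M2 : ℝ) (C : Consts)
    (ω : Ω) : Prop where
  step : ∀ k, R.StepAt Q pen X Lam M1 M2 k ω
  dir_pos : ∀ k, 0 < ‖R.dir k ω‖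
  alpha_zero : R.alpha 0 ω = ls.alphaMax
  eps_zero : R.eps 0 ω = ls.eps0
  mu0_le : ∀ k, pen.mu0 ≤ R.muBefore pen k ω
  mu_mono : ∀ k, R.muBefore pen k ω ≤ R.mu k ω
  penaltyOK : ∀ k, R.PenaltyOK Q pen k ω (R.mu k ω)
  mu_le : ∀ k, R.mu k ω ≤ C.muTilde
  ref_le : ∀ k, ‖R.refVec Q pen k ω‖ ≤ C.ups1 * ‖R.scaleVec Q k ω‖
  dir_le : ∀ k, ‖R.dir k ω‖ ≤ C.ups3 * ‖R.scaleVec Q k ω‖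
  grad_le : ∀ k, ‖R.meritGradBar Q pen k ω (R.mu k ω)‖ ≤ C.ups4 * ‖R.scaleVec Q k ω‖
  lineSearch : ∀ k, R.LineSearchUpdate Q pen ls k ω

/-- The predicted decrease `-ᾱₖSₖ`. -/
noncomputable def decrease (R : Trajectory d m Ξ Ω) (Q : Problem d m Ξ) (pen : PenaltyParams)
    (k : ℕ) (ω : Ω) : ℝ := -(R.alpha k ω * R.slope Q pen k ω)

/-- The scaled squared gradient norm of the augmented Lagrangian. The penalty parameter is the one
before the update of iteration `k`, which makes the quantity known before iteration `k`. -/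
noncomputable def gradTerm (R : Trajectory d m Ξ Ω) (Q : Problem d m Ξ) (pen : PenaltyParams)
    (k : ℕ) (ω : Ω) : ℝ :=
  R.alpha k ω * ‖Q.exactGrad (R.muBefore pen k ω) pen.nu (R.x k ω) (R.lam k ω)‖ ^ 2

/-- The potential whose expectation decreases: a weighted sum of the augmented Lagrangian, its scaled
squared gradient norm and the reliability parameter, with the penalty parameter before its update. -/
noncomputable def potential (R : Trajectory d m Ξ Ω) (Q : Problem d m Ξ) (pen : PenaltyParams)
    (w : ℝ) (k : ℕ) (ω : Ω) : ℝ :=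
  w * Q.merit (R.muBefore pen k ω) pen.nu (R.x k ω) (R.lam k ω) +
    (1 - w) / 2 * R.gradTerm Q pen k ω + (1 - w) / 2 * R.eps k ω

/-- The event that both estimates are accurate and the step is successful. -/
def goodSuccess (R : Trajectory d m Ξ Ω) (Q : Problem d m Ξ) (pen : PenaltyParams)
    (ls : LineSearchParams) (k : ℕ) : Set Ω :=
  {ω | (ω ∈ R.eventA Q pen ls k ∧ ω ∈ R.eventB Q pen ls k) ∧ R.Armijo Q pen ls k ω}

/-- The total error of the two merit values. -/
noncomputable def totalErr (R : Trajectory d m Ξ Ω) (Q : Problem d m Ξ) (pen : PenaltyParams)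
    (k : ℕ) (ω : Ω) : ℝ := |R.meritErr Q pen k ω| + |R.meritErrTrial Q pen k ω|

namespace GoodPath

variable {R : Trajectory d m Ξ Ω} {Q : Problem d m Ξ} {pen : PenaltyParams}
  {ls : LineSearchParams} {X : Set (Vec d)} {Lam : Set (Vec m)} {M1 M2 : ℝ} {C : Consts} {ω : Ω}
  {K τ : ℝ}

lemma mu_mem (h : R.GoodPath Q pen ls X Lam M1 M2 C ω) (k : ℕ) :
    R.mu k ω ∈ Set.Icc 0 C.muTilde :=
  ⟨(pen.mu0_pos.le.trans (h.mu0_le k)).trans (h.mu_mono k), h.mu_le k⟩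

lemma muBefore_mem (h : R.GoodPath Q pen ls X Lam M1 M2 C ω) (k : ℕ) :
    R.muBefore pen k ω ∈ Set.Icc 0 C.muTilde :=
  ⟨pen.mu0_pos.le.trans (h.mu0_le k), (h.mu_mono k).trans (h.mu_le k)⟩

lemma alpha_bounds (h : R.GoodPath Q pen ls X Lam M1 M2 C ω) (k : ℕ) :
    0 < R.alpha k ω ∧ R.alpha k ω ≤ ls.alphaMax := by
  have hρ := pen.one_lt_rho
  have hρ0 : 0 < pen.rho := zero_lt_one.trans hρ
  induction k with
  | zero => exact ⟨h.alpha_zero ▸ ls.alphaMax_pos, h.alpha_zero.le⟩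
  | succ k ih =>
    by_cases hA : R.Armijo Q pen ls k ω
    · rw [((h.lineSearch k).success hA).2.2]
      exact ⟨lt_min ls.alphaMax_pos (mul_pos hρ0 ih.1), min_le_left _ _⟩
    · rw [((h.lineSearch k).failure hA).2.2.1]
      exact ⟨div_pos ih.1 hρ0, (div_le_self ih.1.le hρ.le).trans ih.2⟩

lemma scale_pos (h : R.GoodPath Q pen ls X Lam M1 M2 C ω) (k : ℕ) :
    0 < ‖R.scaleVec Q k ω‖ := by
  refine (norm_nonneg _).lt_of_ne fun h0 => ?_
  have h1 := h.dir_le k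
  rw [← h0, mul_zero] at h1
  exact absurd (h.dir_pos k) (not_lt.2 h1)

lemma ups3_pos (h : R.GoodPath Q pen ls X Lam M1 M2 C ω) : 0 < C.ups3 :=
  pos_of_mul_pos_left ((h.dir_pos 0).trans_le (h.dir_le 0)) (norm_nonneg _)

lemma ups1_nonneg (h : R.GoodPath Q pen ls X Lam M1 M2 C ω) : 0 ≤ C.ups1 :=
  nonneg_of_mul_nonneg_left ((norm_nonneg _).trans (h.ref_le 0)) (h.scale_pos 0)

lemma slope_le (h : R.GoodPath Q pen ls X Lam M1 M2 C ω) (k : ℕ) :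
    R.slope Q pen k ω ≤ -(pen.gammaRH / 2) * ‖R.scaleVec Q k ω‖ ^ 2 := (h.penaltyOK k).1

lemma slope_neg (h : R.GoodPath Q pen ls X Lam M1 M2 C ω) (k : ℕ) :
    R.slope Q pen k ω < 0 := by
  have h1 := h.slope_le k
  have h2 : 0 < pen.gammaRH / 2 * ‖R.scaleVec Q k ω‖ ^ 2 := by
    have := pen.gammaRH_pos
    have := h.scale_pos k
    positivity
  linarith

lemma le_decrease (h : R.GoodPath Q pen ls X Lam M1 M2 C ω) (k : ℕ) :
    R.alpha k ω * (pen.gammaRH / 2) * ‖R.scaleVec Q k ω‖ ^ 2 ≤ R.decrease Q pen k ω := by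
  have := mul_le_mul_of_nonneg_left (h.slope_le k) (h.alpha_bounds k).1.le
  unfold decrease
  linarith

lemma decrease_pos (h : R.GoodPath Q pen ls X Lam M1 M2 C ω) (k : ℕ) :
    0 < R.decrease Q pen k ω := by
  have := mul_neg_of_pos_of_neg (h.alpha_bounds k).1 (h.slope_neg k)
  unfold decrease
  linarith

/-- In the accuracy event the gradient error is of the order of the scaling vector. -/
lemma norm_grad_error_le (h : R.GoodPath Q pen ls X Lam M1 M2 C ω) {k : ℕ}
    (hA : ω ∈ R.eventA Q pen ls k) (μ : ℝ) :
    ‖R.meritGradBar Q pen k ω μ - Q.exactGrad μ pen.nu (R.x k ω) (R.lam k ω)‖ ≤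
      ls.kappaGrad * R.alpha k ω * C.ups1 * ‖R.scaleVec Q k ω‖ := by
  have e := Problem.meritGrad_sub_exactGrad (Q := Q) μ pen.nu (R.gBar Q k ω) (R.HBar Q k ω)
    (R.x k ω) (R.lam k ω)
  have h1 : ‖R.meritGradBar Q pen k ω μ - Q.exactGrad μ pen.nu (R.x k ω) (R.lam k ω)‖ ≤
      ls.kappaGrad * R.alpha k ω * ‖R.refVec Q pen k ω‖ := by
    have h2 : R.meritGradBar Q pen k ω μ - Q.exactGrad μ pen.nu (R.x k ω) (R.lam k ω) = _ := e
    rw [h2]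
    exact hA
  refine h1.trans ?_
  rw [mul_assoc _ C.ups1]
  exact mul_le_mul_of_nonneg_left (h.ref_le k)
    (mul_nonneg ls.kappaGrad_pos.le (h.alpha_bounds k).1.le)

/-- `κα_maxΥ₃ ∨ (κ_grad α_max Υ₁ + Υ₄)`: the first term controls the change of the gradient of the
augmented Lagrangian in a successful step, the second the gradient itself if it is estimated
accurately, both relative to the scaling vector. -/
noncomputable def upsilon (ls : LineSearchParams) (C : Consts) : ℝ :=
  max (C.kappaL * ls.alphaMax * C.ups3) (ls.kappaGrad * ls.alphaMax * C.ups1 + C.ups4)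

/-- With an accurate estimate, the exact gradient is at most the estimated one plus its error. -/
lemma exactGrad_le_of_eventA (h : R.GoodPath Q pen ls X Lam M1 M2 C ω) {k : ℕ}
    (hA : ω ∈ R.eventA Q pen ls k) :
    ‖Q.exactGrad (R.mu k ω) pen.nu (R.x k ω) (R.lam k ω)‖ ≤
      upsilon ls C * ‖R.scaleVec Q k ω‖ := by
  have h1 := h.norm_grad_error_le hA (R.mu k ω)
  have h2 := h.grad_le k
  have h3 := norm_sub_norm_le (Q.exactGrad (R.mu k ω) pen.nu (R.x k ω) (R.lam k ω))
    (R.meritGradBar Q pen k ω (R.mu k ω))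
  rw [norm_sub_rev] at h3
  have h4 : ls.kappaGrad * R.alpha k ω * C.ups1 * ‖R.scaleVec Q k ω‖ ≤
      ls.kappaGrad * ls.alphaMax * C.ups1 * ‖R.scaleVec Q k ω‖ := by
    have := h.ups1_nonneg
    have := ls.kappaGrad_pos
    have := (h.alpha_bounds k).2
    gcongr
  have h5 : (ls.kappaGrad * ls.alphaMax * C.ups1 + C.ups4) * ‖R.scaleVec Q k ω‖ ≤
      upsilon ls C * ‖R.scaleVec Q k ω‖ :=
    mul_le_mul_of_nonneg_right (le_max_right _ _) (norm_nonneg _)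
  linarith

lemma stack_next (h : R.GoodPath Q pen ls X Lam M1 M2 C ω) {k : ℕ}
    (hs : R.Armijo Q pen ls k ω) :
    stack (R.x (k + 1) ω) (R.lam (k + 1) ω) - stack (R.x k ω) (R.lam k ω) =
      R.alpha k ω • R.dir k ω := by
  obtain ⟨h1, h2, -⟩ := (h.lineSearch k).success hs
  rw [h1, h2, xTrial, lamTrial, stack_add_smul, add_sub_cancel_left]
  rfl

/-- In a successful step the gradient norm of the augmented Lagrangian changes at most by the order
of the scaling vector. -/
lemma exactGrad_next_le (h : R.GoodPath Q pen ls X Lam M1 M2 C ω) {U : Set (Vec d)}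
    (hU : Q.SmoothOn U) (hXU : X ⊆ U) (hX : Convex ℝ X) (hL : Convex ℝ Lam)
    (hκ : ∀ μ ∈ Set.Icc 0 C.muTilde, ∀ x ∈ X, ∀ l ∈ Lam,
      ‖Q.meritHess μ pen.nu x l‖ ≤ C.kappaL) {k : ℕ} (hs : R.Armijo Q pen ls k ω) :
    ‖Q.exactGrad (R.mu k ω) pen.nu (R.x (k + 1) ω) (R.lam (k + 1) ω)‖ ≤
      ‖Q.exactGrad (R.mu k ω) pen.nu (R.x k ω) (R.lam k ω)‖ +
        upsilon ls C * ‖R.scaleVec Q k ω‖ := by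
  have h1 := hU.norm_exactGrad_sub_le hXU hX hL (hκ _ (h.mu_mem k)) (h.step k).mem_X
    (h.step (k + 1)).mem_X (h.step k).mem_Lam (h.step (k + 1)).mem_Lam
  have hκ0 : 0 ≤ C.kappaL :=
    (norm_nonneg _).trans (hκ _ (h.mu_mem k) _ (h.step k).mem_X _ (h.step k).mem_Lam)
  rw [h.stack_next hs, norm_smul, Real.norm_of_nonneg (h.alpha_bounds k).1.le] at h1
  have h2 : C.kappaL * (R.alpha k ω * ‖R.dir k ω‖) ≤
      C.kappaL * (ls.alphaMax * (C.ups3 * ‖R.scaleVec Q k ω‖)) :=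
    mul_le_mul_of_nonneg_left (mul_le_mul (h.alpha_bounds k).2 (h.dir_le k) (norm_nonneg _)
      ls.alphaMax_pos.le) hκ0
  have h3 : C.kappaL * ls.alphaMax * C.ups3 * ‖R.scaleVec Q k ω‖ ≤
      upsilon ls C * ‖R.scaleVec Q k ω‖ :=
    mul_le_mul_of_nonneg_right (le_max_left _ _) (norm_nonneg _)
  have h4 := norm_sub_norm_le (Q.exactGrad (R.mu k ω) pen.nu (R.x (k + 1) ω) (R.lam (k + 1) ω))
    (Q.exactGrad (R.mu k ω) pen.nu (R.x k ω) (R.lam k ω))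
  linarith

lemma totalErr_le_of_eventB {k : ℕ}
    (hB : ω ∈ R.eventB Q pen ls k) :
    R.totalErr Q pen k ω ≤ 2 * (ls.kappaF * R.alpha k ω) * R.decrease Q pen k ω := by
  have h1 : max |R.meritErr Q pen k ω| |R.meritErrTrial Q pen k ω| ≤
    -(ls.kappaF * R.alpha k ω ^ 2 * R.slope Q pen k ω) := hB
  have h2 := (le_max_left _ _).trans h1
  have h3 := (le_max_right _ _).trans h1
  unfold totalErr decrease
  nlinarith

/-- This is where `κ_f < β / (4 α_max)` enters. -/
lemma totalErr_le_half_of_eventB (h : R.GoodPath Q pen ls X Lam M1 M2 C ω) {k : ℕ}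
    (hB : ω ∈ R.eventB Q pen ls k) :
    R.totalErr Q pen k ω ≤ ls.beta * R.decrease Q pen k ω / 2 := by
  refine (totalErr_le_of_eventB hB).trans ?_
  have h1 : ls.kappaF * R.alpha k ω ≤ ls.beta / 4 := by
    have h2 := ls.kappaF_mem.2
    rw [lt_div_iff₀ (by have := ls.alphaMax_pos; positivity)] at h2
    have := mul_le_mul_of_nonneg_left (h.alpha_bounds k).2 ls.kappaF_mem.1.le
    linarith
  have := mul_le_mul_of_nonneg_right h1 (h.decrease_pos k).le
  linarith

/-- The Armijo condition for the estimated values, in terms of the exact ones. -/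
lemma merit_next_le (h : R.GoodPath Q pen ls X Lam M1 M2 C ω) {k : ℕ}
    (hs : R.Armijo Q pen ls k ω) :
    Q.merit (R.mu k ω) pen.nu (R.x (k + 1) ω) (R.lam (k + 1) ω) -
      Q.merit (R.mu k ω) pen.nu (R.x k ω) (R.lam k ω) ≤
      -(ls.beta * R.decrease Q pen k ω) + R.totalErr Q pen k ω := by
  obtain ⟨h1, h2, -⟩ := (h.lineSearch k).success hs
  rw [h1, h2]
  have hs' : R.meritBarTrial Q pen k ω ≤
    R.meritBar Q pen k ω + R.alpha k ω * ls.beta * R.slope Q pen k ω := hs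
  have e1 : Q.merit (R.mu k ω) pen.nu (R.xTrial k ω) (R.lamTrial k ω) =
    R.meritBarTrial Q pen k ω - R.meritErrTrial Q pen k ω := by
    unfold meritErrTrial; ring
  have e2 : Q.merit (R.mu k ω) pen.nu (R.x k ω) (R.lam k ω) =
    R.meritBar Q pen k ω - R.meritErr Q pen k ω := by
    unfold meritErr; ring
  rw [e1, e2]
  unfold decrease totalErr
  linarith [le_abs_self (R.meritErr Q pen k ω), neg_abs_le (R.meritErrTrial Q pen k ω)]

/-- The reliability parameter grows only where it is dominated by the predicted decrease, so it stays
bounded; it shrinks at most geometrically. -/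
lemma eps_pos_and_le (h : R.GoodPath Q pen ls X Lam M1 M2 C ω) {Dmax : ℝ}
    (hD : ∀ k, R.decrease Q pen k ω ≤ Dmax) (k : ℕ) :
    ls.eps0 / pen.rho ^ k ≤ R.eps k ω ∧
      R.eps k ω ≤ max ls.eps0 (pen.rho * (ls.beta * Dmax)) := by
  have hρ := pen.one_lt_rho
  have hρ0 : 0 < pen.rho := zero_lt_one.trans hρ
  induction k with
  | zero => simp [h.eps_zero]
  | succ k ih =>
    have hpos : 0 < R.eps k ω := lt_of_lt_of_le (div_pos ls.eps0_pos (pow_pos hρ0 k)) ih.1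
    have hdiv : ls.eps0 / pen.rho ^ (k + 1) ≤ R.eps k ω / pen.rho := by
      rw [pow_succ, ← div_div]
      exact div_le_div_of_nonneg_right ih.1 hρ0.le
    have hdiv' : R.eps k ω / pen.rho ≤ max ls.eps0 (pen.rho * (ls.beta * Dmax)) :=
      (div_le_self hpos.le hρ.le).trans ih.2
    by_cases hA : R.Armijo Q pen ls k ω
    · by_cases hR : R.Reliable Q pen ls k ω
      · rw [(h.lineSearch k).reliable hA hR]
        constructor
        · refine hdiv.trans ?_
          exact (div_le_self hpos.le hρ.le).trans (le_mul_of_one_le_left hpos.le hρ.le)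
        · refine le_max_of_le_right (mul_le_mul_of_nonneg_left ?_ hρ0.le)
          have h1 : R.eps k ω ≤ -(R.alpha k ω * ls.beta * R.slope Q pen k ω) := hR
          have h2 := mul_le_mul_of_nonneg_left (hD k) ls.beta_mem.1.le
          unfold decrease at h2
          linarith
      · rw [(h.lineSearch k).unreliable hA hR]
        exact ⟨hdiv, hdiv'⟩
    · rw [((h.lineSearch k).failure hA).2.2.2]
      exact ⟨hdiv, hdiv'⟩

lemma eps_pos (h : R.GoodPath Q pen ls X Lam M1 M2 C ω) (k : ℕ) : 0 < R.eps k ω := by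
  have hρ0 : 0 < pen.rho := zero_lt_one.trans pen.one_lt_rho
  induction k with
  | zero => exact h.eps_zero ▸ ls.eps0_pos
  | succ k ih =>
    by_cases hA : R.Armijo Q pen ls k ω
    · by_cases hR : R.Reliable Q pen ls k ω
      · rw [(h.lineSearch k).reliable hA hR]
        exact mul_pos hρ0 ih
      · rw [(h.lineSearch k).unreliable hA hR]
        exact div_pos ih hρ0
    · rw [((h.lineSearch k).failure hA).2.2.2]
      exact div_pos ih hρ0

/-- The change of the potential in one iteration, with the penalty parameter of the iteration held
fixed. After a failed step only the stepsize and the reliability parameter change. -/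
lemma potential_step (h : R.GoodPath Q pen ls X Lam M1 M2 C ω) {U : Set (Vec d)}
    (hU : Q.SmoothOn U) (hXU : X ⊆ U) (hX : Convex ℝ X) (hL : Convex ℝ Lam)
    (hκ : ∀ μ ∈ Set.Icc 0 C.muTilde, ∀ x ∈ X, ∀ l ∈ Lam,
      ‖Q.meritHess μ pen.nu x l‖ ≤ C.kappaL) {w : ℝ} (hw : w ∈ Set.Ioo (0 : ℝ) 1)
    (hΩ : OmegaCondition pen ls C w) (k : ℕ) :
    w * (Q.merit (R.mu k ω) pen.nu (R.x (k + 1) ω) (R.lam (k + 1) ω) -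
        Q.merit (R.mu k ω) pen.nu (R.x k ω) (R.lam k ω)) +
      (1 - w) / 2 * (R.alpha (k + 1) ω *
          ‖Q.exactGrad (R.mu k ω) pen.nu (R.x (k + 1) ω) (R.lam (k + 1) ω)‖ ^ 2 -
        R.alpha k ω * ‖Q.exactGrad (R.mu k ω) pen.nu (R.x k ω) (R.lam k ω)‖ ^ 2) +
      (1 - w) / 2 * (R.eps (k + 1) ω - R.eps k ω) ≤
    -((1 - w) / 2 * (1 - 1 / pen.rho) * (R.alpha k ω *
        ‖Q.exactGrad (R.mu k ω) pen.nu (R.x k ω) (R.lam k ω)‖ ^ 2 + R.eps k ω)) +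
      ((1 - w) * pen.rho + (1 - w) / 2 * (1 - 1 / pen.rho)) * (R.alpha k ω *
        ‖Q.exactGrad (R.mu k ω) pen.nu (R.x k ω) (R.lam k ω)‖ ^ 2 *
          (R.eventA Q pen ls k)ᶜ.indicator (fun _ => (1 : ℝ)) ω) +
      w * (R.totalErr Q pen k ω * (R.eventB Q pen ls k)ᶜ.indicator (fun _ => (1 : ℝ)) ω) -
      w * ls.beta / 8 * (R.goodSuccess Q pen ls k).indicator (R.decrease Q pen k) ω := by
  classical
  have hρ := pen.one_lt_rho
  have hρ0 : 0 < pen.rho := zero_lt_one.trans hρ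
  have hw1 : 0 < 1 - w := by linarith [hw.2]
  have hE0 : 0 ≤ R.totalErr Q pen k ω := add_nonneg (abs_nonneg _) (abs_nonneg _)
  have hα := (h.alpha_bounds k).1
  have hε := h.eps_pos k
  have hc1 : 0 ≤ (1 - w) / 2 * (1 - 1 / pen.rho) := by
    have : 1 / pen.rho ≤ 1 := by rw [div_le_one hρ0]; exact hρ.le
    exact mul_nonneg (by positivity) (by linarith)
  by_cases hs : R.Armijo Q pen ls k ω
  · have hmain := descent_of_success (ω ∈ R.eventA Q pen ls k) (ω ∈ R.eventB Q pen ls k)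
      (w := w) (ρ := pen.rho) (β := ls.beta) (γ := pen.gammaRH) (Υ := upsilon ls C)
      (α := R.alpha k ω) (α' := R.alpha (k + 1) ω)
      (D := ‖Q.exactGrad (R.mu k ω) pen.nu (R.x k ω) (R.lam k ω)‖)
      (D' := ‖Q.exactGrad (R.mu k ω) pen.nu (R.x (k + 1) ω) (R.lam (k + 1) ω)‖)
      (ℓ := R.decrease Q pen k ω) (ε := R.eps k ω) (ε' := R.eps (k + 1) ω)
      (L := Q.merit (R.mu k ω) pen.nu (R.x k ω) (R.lam k ω))
      (L' := Q.merit (R.mu k ω) pen.nu (R.x (k + 1) ω) (R.lam (k + 1) ω))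
      (E := R.totalErr Q pen k ω) (s := ‖R.scaleVec Q k ω‖)
      hw.1 hw.2 hρ ls.beta_mem.1 pen.gammaRH_pos hα
      ((le_max_left _ _).trans hΩ) ((le_max_right _ _).trans hΩ) (h.le_decrease k)
      (by rw [((h.lineSearch k).success hs).2.2]; exact min_le_right _ _)
      (norm_nonneg _) (norm_nonneg _) (h.exactGrad_next_le hU hXU hX hL hκ hs)
      hE0 (h.merit_next_le hs) hε
      (fun hr => (h.lineSearch k).reliable hs (by
        unfold Reliable
        unfold decrease at hr
        linarith))
      (fun hr => (h.lineSearch k).unreliable hs (by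
        unfold Reliable
        unfold decrease at hr
        intro hcon
        exact hr (by linarith)))
      (fun hA => h.exactGrad_le_of_eventA hA) (fun hB => h.totalErr_le_half_of_eventB hB)
    refine hmain.trans (le_of_eq ?_)
    by_cases hA : ω ∈ R.eventA Q pen ls k <;> by_cases hB : ω ∈ R.eventB Q pen ls k <;>
      simp only [Set.indicator, Set.mem_compl_iff, goodSuccess, Set.mem_ofPred_eq, hA, hB, hs,
        if_true, if_false, and_self, and_true, and_false, not_true_eq_false,
        not_false_eq_true] <;> ring
  · obtain ⟨h1, h2, h3, h4⟩ := (h.lineSearch k).failure hs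
    rw [h1, h2, h3, h4]
    have hT : (R.goodSuccess Q pen ls k).indicator (R.decrease Q pen k) ω = 0 :=
      Set.indicator_of_notMem (fun hcon => hs hcon.2) _
    have hiA : 0 ≤ (R.eventA Q pen ls k)ᶜ.indicator (fun _ => (1 : ℝ)) ω :=
      Set.indicator_nonneg (fun _ _ => zero_le_one) _
    have hiB : 0 ≤ (R.eventB Q pen ls k)ᶜ.indicator (fun _ => (1 : ℝ)) ω :=
      Set.indicator_nonneg (fun _ _ => zero_le_one) _
    rw [hT]
    have hX0 : 0 ≤ R.alpha k ω *
      ‖Q.exactGrad (R.mu k ω) pen.nu (R.x k ω) (R.lam k ω)‖ ^ 2 := by positivity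
    have n1 : 0 ≤ ((1 - w) * pen.rho + (1 - w) / 2 * (1 - 1 / pen.rho)) * (R.alpha k ω *
        ‖Q.exactGrad (R.mu k ω) pen.nu (R.x k ω) (R.lam k ω)‖ ^ 2 *
          (R.eventA Q pen ls k)ᶜ.indicator (fun _ => (1 : ℝ)) ω) :=
      mul_nonneg (add_nonneg (by positivity) hc1) (mul_nonneg hX0 hiA)
    have n2 : 0 ≤ w * (R.totalErr Q pen k ω *
        (R.eventB Q pen ls k)ᶜ.indicator (fun _ => (1 : ℝ)) ω) :=
      mul_nonneg hw.1.le (mul_nonneg hE0 hiB)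
    generalize ‖Q.exactGrad (R.mu k ω) pen.nu (R.x k ω) (R.lam k ω)‖ = D at *
    have e : (1 - w) / 2 * (R.alpha k ω / pen.rho * D ^ 2 - R.alpha k ω * D ^ 2) +
        (1 - w) / 2 * (R.eps k ω / pen.rho - R.eps k ω) =
        -((1 - w) / 2 * (1 - 1 / pen.rho) * (R.alpha k ω * D ^ 2 + R.eps k ω)) := by ring
    linarith

/-- The change of the potential in one iteration. The last term accounts for the update of the
penalty parameter; it telescopes. -/
theorem potential_descent (h : R.GoodPath Q pen ls X Lam M1 M2 C ω) {U : Set (Vec d)}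
    (hU : Q.SmoothOn U) (hXU : X ⊆ U) (hX : Convex ℝ X) (hL : Convex ℝ Lam)
    (hκ : ∀ μ ∈ Set.Icc 0 C.muTilde, ∀ x ∈ X, ∀ l ∈ Lam,
      ‖Q.meritHess μ pen.nu x l‖ ≤ C.kappaL) {w : ℝ} (hw : w ∈ Set.Ioo (0 : ℝ) 1)
    (hΩ : OmegaCondition pen ls C w) (hb : Q.UniformBounds X Lam K τ) {A : ℝ}
    (hA : ∀ μ ∈ Set.Icc 0 C.muTilde, ∀ x ∈ X, ∀ l ∈ Lam, ‖Q.exactGrad μ pen.nu x l‖ ≤ A)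
    (k : ℕ) :
    R.potential Q pen w (k + 1) ω - R.potential Q pen w k ω ≤
    -((1 - w) / 2 * (1 - 1 / pen.rho) * (R.gradTerm Q pen k ω + R.eps k ω)) +
      ((1 - w) * pen.rho + (1 - w) / 2 * (1 - 1 / pen.rho)) * (R.gradTerm Q pen k ω *
          (R.eventA Q pen ls k)ᶜ.indicator (fun _ => (1 : ℝ)) ω) +
      w * (R.totalErr Q pen k ω * (R.eventB Q pen ls k)ᶜ.indicator (fun _ => (1 : ℝ)) ω) -
      w * ls.beta / 8 * (R.goodSuccess Q pen ls k).indicator (R.decrease Q pen k) ω +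
      (K ^ 2 / 2 + (2 + pen.rho) * ls.alphaMax * (K ^ 2 * (2 * A))) *
        (R.muBefore pen (k + 1) ω - R.muBefore pen k ω) := by
  have hmain := h.potential_step hU hXU hX hL hκ hw hΩ k
  have hρ := pen.one_lt_rho
  have hρ0 : 0 < pen.rho := zero_lt_one.trans hρ
  have hw1 : 0 < 1 - w := by linarith [hw.2]
  have hw0 := hw.1
  have hx := (h.step k).mem_X
  have hl := (h.step k).mem_Lam
  have hα := h.alpha_bounds k
  have hnext : R.muBefore pen (k + 1) ω = R.mu k ω := rfl
  have hδ : 0 ≤ R.mu k ω - R.muBefore pen k ω := sub_nonneg.2 (h.mu_mono k)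
  have hm := Problem.merit_sub_merit (Q := Q) (R.muBefore pen k ω) (R.mu k ω) pen.nu (R.x k ω)
    (R.lam k ω)
  have hg := hb.norm_exactGrad_sub_le hx (R.lam k ω) (R.muBefore pen k ω) (R.mu k ω) pen.nu
  rw [abs_of_nonneg hδ] at hg
  have hA1 := hA _ (h.mu_mem k) _ hx _ hl
  have hA2 := hA _ (h.muBefore_mem k) _ hx _ hl
  have hA0 : 0 ≤ A := (norm_nonneg _).trans hA1
  have hc : ‖Q.c (R.x k ω)‖ ^ 2 ≤ K ^ 2 :=
    pow_le_pow_left₀ (norm_nonneg _) (hb.norm_c _ hx) 2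
  have hgd := (abs_norm_sub_norm_le (Q.exactGrad (R.mu k ω) pen.nu (R.x k ω) (R.lam k ω))
    (Q.exactGrad (R.muBefore pen k ω) pen.nu (R.x k ω) (R.lam k ω))).trans hg
  unfold potential gradTerm
  rw [hnext]
  have hiA0 : 0 ≤ (R.eventA Q pen ls k)ᶜ.indicator (fun _ => (1 : ℝ)) ω :=
    Set.indicator_nonneg (fun _ _ => zero_le_one) _
  have hiA1 : (R.eventA Q pen ls k)ᶜ.indicator (fun _ => (1 : ℝ)) ω ≤ 1 :=
    Set.indicator_le_self' (f := fun _ => (1 : ℝ)) (fun _ _ => zero_le_one) ω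
  have hDa := norm_nonneg (Q.exactGrad (R.mu k ω) pen.nu (R.x k ω) (R.lam k ω))
  have hDb := norm_nonneg (Q.exactGrad (R.muBefore pen k ω) pen.nu (R.x k ω) (R.lam k ω))
  generalize (R.eventA Q pen ls k)ᶜ.indicator (fun _ => (1 : ℝ)) ω = iA at *
  generalize (R.totalErr Q pen k ω * (R.eventB Q pen ls k)ᶜ.indicator (fun _ => (1 : ℝ)) ω) = EB
    at *
  generalize (R.goodSuccess Q pen ls k).indicator (R.decrease Q pen k) ω = T at *
  generalize ‖Q.exactGrad (R.mu k ω) pen.nu (R.x (k + 1) ω) (R.lam (k + 1) ω)‖ = D' at *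
  generalize ‖Q.exactGrad (R.mu k ω) pen.nu (R.x k ω) (R.lam k ω)‖ = D at *
  generalize ‖Q.exactGrad (R.muBefore pen k ω) pen.nu (R.x k ω) (R.lam k ω)‖ = Dp at *
  generalize R.mu k ω - R.muBefore pen k ω = δ at *
  generalize R.alpha k ω = α at *
  generalize R.alpha (k + 1) ω = α' at *
  -- the change of the squared gradient norm caused by the penalty update
  have hsq : |D ^ 2 - Dp ^ 2| ≤ δ * K ^ 2 * (2 * A) := by
    have e : D ^ 2 - Dp ^ 2 = (D - Dp) * (D + Dp) := by ring
    rw [e, abs_mul, abs_of_nonneg (add_nonneg hDa hDb)]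
    exact mul_le_mul hgd (by linarith) (add_nonneg hDa hDb) (by positivity)
  have hgt : |α * D ^ 2 - α * Dp ^ 2| ≤ ls.alphaMax * (δ * K ^ 2 * (2 * A)) := by
    rw [← mul_sub, abs_mul, abs_of_pos hα.1]
    exact mul_le_mul hα.2 hsq (abs_nonneg _) (hα.1.le.trans hα.2)
  have hmer : w * (δ / 2 * ‖Q.c (R.x k ω)‖ ^ 2) ≤ δ * (K ^ 2 / 2) := by
    have h1 : δ / 2 * ‖Q.c (R.x k ω)‖ ^ 2 ≤ δ / 2 * K ^ 2 :=
      mul_le_mul_of_nonneg_left hc (by positivity)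
    have h2 : 0 ≤ δ / 2 * ‖Q.c (R.x k ω)‖ ^ 2 := by positivity
    have h3 : w * (δ / 2 * ‖Q.c (R.x k ω)‖ ^ 2) ≤ 1 * (δ / 2 * ‖Q.c (R.x k ω)‖ ^ 2) :=
      mul_le_mul_of_nonneg_right hw.2.le h2
    linarith
  rw [← hm] at hmer
  have hc1 : 0 ≤ (1 - w) / 2 * (1 - 1 / pen.rho) := by
    have : 1 / pen.rho ≤ 1 := by rw [div_le_one hρ0]; exact hρ.le
    exact mul_nonneg (by positivity) (by linarith)
  have hc1' : (1 - w) / 2 * (1 - 1 / pen.rho) ≤ 1 / 2 := by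
    have : 0 < 1 / pen.rho := by positivity
    nlinarith
  have e : (K ^ 2 / 2 + (2 + pen.rho) * ls.alphaMax * (K ^ 2 * (2 * A))) * δ =
      δ * (K ^ 2 / 2) + (2 + pen.rho) * (ls.alphaMax * (δ * K ^ 2 * (2 * A))) := by ring
  rw [e]
  generalize ls.alphaMax * (δ * K ^ 2 * (2 * A)) = B at hgt ⊢
  generalize (1 - w) / 2 * (1 - 1 / pen.rho) = c1 at *
  have hshift := penalty_shift_le (iA := iA) (ρ := pen.rho) hw1.le (by linarith) hρ0.le hc1 hc1' hgt
    hiA0 hiA1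
  linarith

/-- The scaling vector and the predicted decrease are bounded along the path. -/
lemma scale_le (h : R.GoodPath Q pen ls X Lam M1 M2 C ω) {A : ℝ}
    (hA : ∀ μ ∈ Set.Icc 0 C.muTilde, ∀ x ∈ X, ∀ l ∈ Lam, ∀ g H,
      ‖g - gradient Q.f x‖ ≤ M1 → ‖H - hess Q.f x‖ ≤ M2 → ‖Q.meritGrad μ pen.nu g H x l‖ ≤ A)
    (k : ℕ) : ‖R.scaleVec Q k ω‖ ≤ 2 * A * C.ups3 / pen.gammaRH ∧
      R.decrease Q pen k ω ≤
        ls.alphaMax * (A * (C.ups3 * (2 * A * C.ups3 / pen.gammaRH))) := by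
  have hs := h.scale_pos k
  have h1 : ‖R.meritGradBar Q pen k ω (R.mu k ω)‖ ≤ A :=
    hA _ (h.mu_mem k) _ (h.step k).mem_X _ (h.step k).mem_Lam _ _ (h.step k).g_close
      (h.step k).H_close
  have hA0 : 0 ≤ A := (norm_nonneg _).trans h1
  have h2 : |R.slope Q pen k ω| ≤ A * (C.ups3 * ‖R.scaleVec Q k ω‖) :=
    (abs_real_inner_le_norm _ _).trans (mul_le_mul h1 (h.dir_le k) (norm_nonneg _) hA0)
  have h3 := (abs_le.1 h2).1
  have h4 := h.slope_le k
  have hγ := pen.gammaRH_pos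
  have h5 : ‖R.scaleVec Q k ω‖ ≤ 2 * A * C.ups3 / pen.gammaRH := by
    rw [le_div_iff₀ hγ]
    refine le_of_mul_le_mul_right ?_ hs
    nlinarith
  refine ⟨h5, ?_⟩
  have h6 : -R.slope Q pen k ω ≤ A * (C.ups3 * (2 * A * C.ups3 / pen.gammaRH)) := by
    have := mul_le_mul_of_nonneg_left (mul_le_mul_of_nonneg_left h5 h.ups3_pos.le) hA0
    linarith
  have h7 := mul_le_mul (h.alpha_bounds k).2 h6 (by linarith [h.slope_neg k])
    ls.alphaMax_pos.le
  unfold decrease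
  linarith

end GoodPath

/-- With accurate estimates, a step with a small stepsize is successful. The threshold is
deterministic, and small enough to keep the test point where the second order bound holds, since
test points need not lie in `X × Λ`. -/
theorem exists_success_threshold {Q : Problem d m Ξ} {pen : PenaltyParams}
    {ls : LineSearchParams} {X : Set (Vec d)} {Lam : Set (Vec m)} {M1 M2 : ℝ} {C : Consts}
    {U : Set (Vec d)} (hU : Q.SmoothOn U) (hXU : X ⊆ U) (hX : IsCompact X) (hL : IsCompact Lam)
    {A : ℝ} (hA0 : 0 ≤ A)
    (hA : ∀ μ ∈ Set.Icc 0 C.muTilde, ∀ x ∈ X, ∀ l ∈ Lam, ∀ g H,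
      ‖g - gradient Q.f x‖ ≤ M1 → ‖H - hess Q.f x‖ ≤ M2 → ‖Q.meritGrad μ pen.nu g H x l‖ ≤ A) :
    ∃ αt > 0, ∀ (R : Trajectory d m Ξ Ω) (ω : Ω), R.GoodPath Q pen ls X Lam M1 M2 C ω → ∀ k,
      ω ∈ R.eventA Q pen ls k → ω ∈ R.eventB Q pen ls k → R.alpha k ω ≤ αt →
      R.Armijo Q pen ls k ω := by
  obtain ⟨δ, κ, hδ, hκ, hT⟩ := hU.exists_taylor_bound hXU hX hL pen.nu C.muTilde
  have hγ := pen.gammaRH_pos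
  have hβ := ls.beta_mem.2
  have hκF := ls.kappaF_mem.1
  have hκg := ls.kappaGrad_pos
  obtain ⟨W, hW⟩ : ∃ W, W = 2 * ls.kappaF +
    2 * (ls.kappaGrad * |C.ups1| * |C.ups3| + κ * C.ups3 ^ 2) / pen.gammaRH := ⟨_, rfl⟩
  have hW0 : 0 < W := by rw [hW]; positivity
  obtain ⟨Dm, hDm⟩ : ∃ Dm, Dm = |C.ups3| * (2 * A * |C.ups3| / pen.gammaRH) := ⟨_, rfl⟩
  have hDm0 : 0 ≤ Dm := by rw [hDm]; positivity
  refine ⟨min (δ / (Dm + 1)) ((1 - ls.beta) / W),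
    lt_min (by positivity) (div_pos (by linarith) hW0), fun R ω h k hEA hEB hα => ?_⟩
  obtain ⟨hα0, hαm⟩ := h.alpha_bounds k
  have hα1 : R.alpha k ω * (Dm + 1) ≤ δ :=
    (le_div_iff₀ (by positivity)).1 (hα.trans (min_le_left _ _))
  have hα2 : R.alpha k ω * W ≤ 1 - ls.beta :=
    (le_div_iff₀ hW0).1 (hα.trans (min_le_right _ _))
  have hs := h.scale_le hA k
  have hs0 := h.scale_pos k
  have h3 := h.ups3_pos
  have h1 := h.ups1_nonneg
  rw [abs_of_pos h3, abs_of_nonneg h1] at hW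
  rw [abs_of_pos h3] at hDm
  have hdir : ‖R.dir k ω‖ ≤ Dm := by
    rw [hDm]
    exact (h.dir_le k).trans (mul_le_mul_of_nonneg_left hs.1 h3.le)
  have hstk : stack (R.alpha k ω • R.dx k ω) (R.alpha k ω • R.dlam k ω) =
    R.alpha k ω • R.dir k ω := rfl
  have hTk := hT (R.mu k ω) (h.mu_mem k) (R.x k ω) (h.step k).mem_X (R.lam k ω)
    (h.step k).mem_Lam (R.alpha k ω • R.dx k ω) (R.alpha k ω • R.dlam k ω) (by
      rw [hstk, norm_smul, Real.norm_of_nonneg hα0.le]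
      nlinarith)
  rw [hstk, real_inner_smul_right, norm_smul, Real.norm_of_nonneg hα0.le] at hTk
  have hTk' : Q.merit (R.mu k ω) pen.nu (R.xTrial k ω) (R.lamTrial k ω) ≤
    Q.merit (R.mu k ω) pen.nu (R.x k ω) (R.lam k ω) +
      R.alpha k ω * ⟪Q.exactGrad (R.mu k ω) pen.nu (R.x k ω) (R.lam k ω), R.dir k ω⟫ +
      κ * (R.alpha k ω * ‖R.dir k ω‖) ^ 2 := hTk
  have hinner : ⟪Q.exactGrad (R.mu k ω) pen.nu (R.x k ω) (R.lam k ω), R.dir k ω⟫ ≤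
      R.slope Q pen k ω + ls.kappaGrad * R.alpha k ω * C.ups1 * ‖R.scaleVec Q k ω‖ *
        (C.ups3 * ‖R.scaleVec Q k ω‖) := by
    have e : ⟪Q.exactGrad (R.mu k ω) pen.nu (R.x k ω) (R.lam k ω), R.dir k ω⟫ =
        R.slope Q pen k ω - ⟪R.meritGradBar Q pen k ω (R.mu k ω) -
          Q.exactGrad (R.mu k ω) pen.nu (R.x k ω) (R.lam k ω), R.dir k ω⟫ := by
      rw [inner_sub_left, slope]
      ring
    rw [e]
    have := (abs_le.1 ((abs_real_inner_le_norm (R.meritGradBar Q pen k ω (R.mu k ω) -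
      Q.exactGrad (R.mu k ω) pen.nu (R.x k ω) (R.lam k ω)) (R.dir k ω)).trans
        (mul_le_mul (h.norm_grad_error_le hEA (R.mu k ω)) (h.dir_le k) (norm_nonneg _)
          (by positivity)))).1
    linarith
  have herr := GoodPath.totalErr_le_of_eventB hEB
  have hslope := h.slope_le k
  have hdsq : (R.alpha k ω * ‖R.dir k ω‖) ^ 2 ≤
      (R.alpha k ω * (C.ups3 * ‖R.scaleVec Q k ω‖)) ^ 2 :=
    pow_le_pow_left₀ (by positivity) (mul_le_mul_of_nonneg_left (h.dir_le k) hα0.le) 2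
  have e1 : Q.merit (R.mu k ω) pen.nu (R.xTrial k ω) (R.lamTrial k ω) =
    R.meritBarTrial Q pen k ω - R.meritErrTrial Q pen k ω := by
    unfold meritErrTrial; ring
  have e2 : Q.merit (R.mu k ω) pen.nu (R.x k ω) (R.lam k ω) =
    R.meritBar Q pen k ω - R.meritErr Q pen k ω := by
    unfold meritErr; ring
  rw [e1, e2] at hTk'
  unfold totalErr decrease at herr
  unfold Armijo
  have a1 := neg_abs_le (R.meritErr Q pen k ω)
  have a2 := le_abs_self (R.meritErrTrial Q pen k ω)
  generalize ‖R.scaleVec Q k ω‖ = s at *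
  generalize ‖R.dir k ω‖ = D at *
  generalize R.slope Q pen k ω = S at *
  generalize R.alpha k ω = α at *
  have b1 := mul_le_mul_of_nonneg_left hinner hα0.le
  have b2 := mul_le_mul_of_nonneg_left hdsq hκ
  -- all second order terms are at most `W α²` times the predicted slope
  have b3 : 2 * (ls.kappaF * α) * -(α * S) +
      α ^ 2 * ((ls.kappaGrad * C.ups1 * C.ups3 + κ * C.ups3 ^ 2) * s ^ 2) ≤
      α * (α * W) * (-S) := by
    have c1 : (ls.kappaGrad * C.ups1 * C.ups3 + κ * C.ups3 ^ 2) * s ^ 2 ≤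
        2 * (ls.kappaGrad * C.ups1 * C.ups3 + κ * C.ups3 ^ 2) / pen.gammaRH * (-S) := by
      have c2 : 0 ≤ 2 * (ls.kappaGrad * C.ups1 * C.ups3 + κ * C.ups3 ^ 2) / pen.gammaRH := by
        positivity
      have c3 := mul_le_mul_of_nonneg_left
        (by linarith : pen.gammaRH / 2 * s ^ 2 ≤ -S) c2
      refine le_trans (le_of_eq ?_) c3
      field_simp
    have c4 := mul_le_mul_of_nonneg_left c1 (sq_nonneg α)
    rw [hW]
    linarith
  have hS : 0 ≤ -S := by
    have : 0 ≤ pen.gammaRH / 2 * s ^ 2 := by positivity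
    linarith
  have b4 : α * (α * W) * (-S) ≤ α * (1 - ls.beta) * (-S) :=
    mul_le_mul_of_nonneg_right (mul_le_mul_of_nonneg_left hα2 hα0.le) hS
  linarith

end Trajectory

/-! ### Expected decrease of the potential -/

/-- A conditional Cauchy-Schwarz inequality: an error with conditional second moment at most `ε²`
has expectation at most `√p 𝔼[ε]` on an event of conditional probability at most `p`. -/
lemma integral_abs_mul_indicator_le {Ω : Type*} {m m0 : MeasurableSpace Ω} {Pr : Measure Ω}
    [IsFiniteMeasure Pr] (hm : m ≤ m0) {e ε : Ω → ℝ} {s : Set Ω} (hs : MeasurableSet s)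
    (he : Measurable e) (he2 : Integrable (fun ω => e ω ^ 2) Pr)
    (hcond : Pr[fun ω => e ω ^ 2 | m] ≤ᵐ[Pr] fun ω => ε ω ^ 2) (hεm : Measurable[m] ε) {c C : ℝ}
    (hc : 0 < c) (hε : ∀ᵐ ω ∂Pr, c ≤ ε ω ∧ ε ω ≤ C) {p : ℝ} (hp0 : 0 < p)
    (hp : Pr⟦s | m⟧ ≤ᵐ[Pr] fun _ => p) :
    Integrable (fun ω => |e ω| * s.indicator (fun _ => (1 : ℝ)) ω) Pr ∧
      ∫ ω, |e ω| * s.indicator (fun _ => (1 : ℝ)) ω ∂Pr ≤ √p * ∫ ω, ε ω ∂Pr := by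
  have ht : 0 < √p := Real.sqrt_pos.2 hp0
  have hεm0 : AEStronglyMeasurable ε Pr := (hεm.mono hm le_rfl).aestronglyMeasurable
  have hεb : ∀ᵐ ω ∂Pr, ‖ε ω‖ ≤ C := by
    filter_upwards [hε] with ω h
    rw [Real.norm_of_nonneg (hc.le.trans h.1)]
    exact h.2
  have hεi : Integrable ε Pr := Integrable.of_bound hεm0 C hεb
  have hε2 : Integrable (fun ω => ε ω ^ 2) Pr := by
    have := hεi.bdd_mul hεm0 hεb
    simpa only [pow_two] using this
  have hW : Measurable[m] fun ω => (ε ω)⁻¹ := @Measurable.inv _ _ _ _ _ m _ hεm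
  have hW0 : 0 ≤ᵐ[Pr] fun ω => (ε ω)⁻¹ := by
    filter_upwards [hε] with ω h using inv_nonneg.2 (hc.le.trans h.1)
  have hWC : ∀ᵐ ω ∂Pr, (ε ω)⁻¹ ≤ c⁻¹ := by
    filter_upwards [hε] with ω h using inv_anti₀ hc h.1
  have hWb : ∀ᵐ ω ∂Pr, ‖(ε ω)⁻¹‖ ≤ c⁻¹ := by
    filter_upwards [hW0, hWC] with ω h1 h2
    rwa [Real.norm_of_nonneg h1]
  have hWe : Integrable (fun ω => (ε ω)⁻¹ * e ω ^ 2) Pr :=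
    he2.bdd_mul (hW.mono hm le_rfl).aestronglyMeasurable hWb
  have hind : Integrable (fun ω => ε ω * s.indicator (fun _ => (1 : ℝ)) ω) Pr :=
    ((integrable_const (1 : ℝ)).indicator hs).bdd_mul hεm0 hεb
  have i1 : ∫ ω, (ε ω)⁻¹ * e ω ^ 2 ∂Pr ≤ ∫ ω, ε ω ∂Pr := by
    refine (integral_mul_le_of_condExp_le hm hW hW0 hWC he2 hε2 hcond).trans (le_of_eq ?_)
    refine integral_congr_ae ?_
    filter_upwards [hε] with ω h
    have : ε ω ≠ 0 := (hc.trans_le h.1).ne'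
    field_simp
  have i2 : ∫ ω, ε ω * s.indicator (fun _ => (1 : ℝ)) ω ∂Pr ≤ p * ∫ ω, ε ω ∂Pr :=
    integral_mul_indicator_le hm hs hεm (by filter_upwards [hε] with ω h using hc.le.trans h.1)
      (by filter_upwards [hε] with ω h using h.2) hp
  -- Cauchy-Schwarz in the form `|e| ≤ (√p / 2) e² / ε + ε / (2 √p)`, on the event
  have hpt : ∀ᵐ ω ∂Pr, |e ω| * s.indicator (fun _ => (1 : ℝ)) ω ≤
      √p / 2 * ((ε ω)⁻¹ * e ω ^ 2) + (2 * √p)⁻¹ * (ε ω * s.indicator (fun _ => (1 : ℝ)) ω) := by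
    filter_upwards [hε] with ω h
    have hε0 : 0 < ε ω := hc.trans_le h.1
    by_cases hω : ω ∈ s
    · simp only [hω, Set.indicator_of_mem, mul_one]
      have h1 : 0 ≤ (√p * |e ω| - ε ω) ^ 2 / (2 * √p * ε ω) := by positivity
      have h2 : (√p * |e ω| - ε ω) ^ 2 / (2 * √p * ε ω) =
          √p / 2 * ((ε ω)⁻¹ * e ω ^ 2) + (2 * √p)⁻¹ * ε ω - |e ω| := by
        rw [← sq_abs (e ω)]
        field_simp
        ring
      linarith
    · simp only [hω, not_false_eq_true, Set.indicator_of_notMem, mul_zero, add_zero]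
      positivity
  have hnn : ∀ ω, 0 ≤ |e ω| * s.indicator (fun _ => (1 : ℝ)) ω := fun ω =>
    mul_nonneg (abs_nonneg _) (Set.indicator_nonneg (fun _ _ => zero_le_one) _)
  have hdom : Integrable (fun ω => √p / 2 * ((ε ω)⁻¹ * e ω ^ 2) +
      (2 * √p)⁻¹ * (ε ω * s.indicator (fun _ => (1 : ℝ)) ω)) Pr :=
    (hWe.const_mul _).add (hind.const_mul _)
  have hint : Integrable (fun ω => |e ω| * s.indicator (fun _ => (1 : ℝ)) ω) Pr := by
    refine hdom.mono' ?_ ?_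
    · exact ((measurable_norm.comp he).mul (measurable_const.indicator hs)).aestronglyMeasurable
    · filter_upwards [hpt] with ω h
      rwa [Real.norm_of_nonneg (hnn ω)]
  refine ⟨hint, (integral_mono_ae hint hdom hpt).trans ?_⟩
  rw [integral_add (hWe.const_mul _) (hind.const_mul _), integral_const_mul, integral_const_mul]
  have j1 := mul_le_mul_of_nonneg_left i1 (by positivity : 0 ≤ √p / 2)
  have j2 := mul_le_mul_of_nonneg_left i2 (by positivity : 0 ≤ (2 * √p)⁻¹)
  have e1 : (2 * √p)⁻¹ * (p * ∫ ω, ε ω ∂Pr) = √p / 2 * ∫ ω, ε ω ∂Pr := by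
    have h : p = √p * √p := (Real.mul_self_sqrt hp0.le).symm
    rw [h, Real.sqrt_mul_self ht.le]
    field_simp
  linarith

/-- Integrating a pointwise bound by a linear combination. -/
lemma integral_le_of_ae_le_combination {Ω : Type*} [MeasurableSpace Ω] {Pr : Measure Ω}
    {u a b g e s n : Ω → ℝ} {c₁ c₂ c₃ c₄ c₅ : ℝ} (hu : Integrable u Pr) (ha : Integrable a Pr)
    (hb : Integrable b Pr) (hg : Integrable g Pr) (he : Integrable e Pr) (hs : Integrable s Pr)
    (hn : Integrable n Pr)
    (h : ∀ᵐ ω ∂Pr, u ω ≤ -(c₁ * (a ω + b ω)) + c₂ * g ω + c₃ * e ω - c₄ * s ω + c₅ * n ω) :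
    ∫ ω, u ω ∂Pr ≤ -(c₁ * (∫ ω, a ω ∂Pr + ∫ ω, b ω ∂Pr)) + c₂ * ∫ ω, g ω ∂Pr +
      c₃ * ∫ ω, e ω ∂Pr - c₄ * ∫ ω, s ω ∂Pr + c₅ * ∫ ω, n ω ∂Pr := by
  have i1 : Integrable (fun ω => -(c₁ * (a ω + b ω))) Pr := ((ha.add hb).const_mul c₁).neg
  have i2 : Integrable (fun ω => -(c₁ * (a ω + b ω)) + c₂ * g ω) Pr := i1.add (hg.const_mul c₂)
  have i3 : Integrable (fun ω => -(c₁ * (a ω + b ω)) + c₂ * g ω + c₃ * e ω) Pr :=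
    i2.add (he.const_mul c₃)
  have i4 : Integrable (fun ω => -(c₁ * (a ω + b ω)) + c₂ * g ω + c₃ * e ω - c₄ * s ω) Pr :=
    i3.sub (hs.const_mul c₄)
  refine (integral_mono_ae hu (i4.add (hn.const_mul c₅)) h).trans (le_of_eq ?_)
  refine (integral_add i4 (hn.const_mul c₅)).trans ?_
  rw [integral_sub i3 (hs.const_mul c₄), integral_add i2 (he.const_mul c₃),
    integral_add i1 (hg.const_mul c₂), integral_neg, integral_const_mul, integral_const_mul,
    integral_const_mul, integral_const_mul, integral_const_mul, integral_add ha hb]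

/-- The condition on the failure probabilities makes the expected losses from inaccurate gradients and
from inaccurate merit values smaller than the guaranteed decrease, and makes iterations with both
estimates accurate more likely than not. -/
lemma ProbCondition.consequences {pen : PenaltyParams} {ls : LineSearchParams} {w : ℝ}
    (hw : w ∈ Set.Ioo (0 : ℝ) 1) (h : ProbCondition pen ls w) :
    pen.rho * ls.pGrad ≤ (1 - ls.pGrad) * (1 - 1 / pen.rho) / 8 ∧
      w * √ls.pF ≤ (1 - w) * (1 - 1 / pen.rho) / 8 ∧
      1 / 2 < (1 - ls.pGrad) * (1 - ls.pF) := by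
  obtain ⟨hw0, hw1⟩ := hw
  have hρ := pen.one_lt_rho
  have hρ0 : 0 < pen.rho := zero_lt_one.trans hρ
  obtain ⟨hg0, hg1⟩ := ls.pGrad_mem
  obtain ⟨hf0, hf1⟩ := ls.pF_mem
  have hs0 := Real.sqrt_nonneg ls.pF
  have hq0 : 0 < (1 - ls.pGrad) * (1 - ls.pF) := mul_pos (by linarith) (by linarith)
  have hq1 : (1 - ls.pGrad) * (1 - ls.pF) ≤ 1 - ls.pGrad := by nlinarith
  have hr0 : 0 ≤ (pen.rho - 1) / (8 * pen.rho) := div_nonneg (by linarith) (by linarith)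
  have h' := (div_le_iff₀ hq0).1 h
  have hmul : ∀ t, min (1 / pen.rho) ((1 - w) / w) ≤ t → 0 ≤ t →
      ls.pGrad + √ls.pF ≤ (pen.rho - 1) / (8 * pen.rho) * t * (1 - ls.pGrad) := fun t ht ht0 =>
    h'.trans (mul_le_mul (mul_le_mul_of_nonneg_left ht hr0) hq1 hq0.le (mul_nonneg hr0 ht0))
  have e8 : (pen.rho - 1) / (8 * pen.rho) = (1 - 1 / pen.rho) / 8 := by field_simp
  have hi0 : 0 < 1 / pen.rho := by positivity
  have hi1 : 1 / pen.rho ≤ 1 := by rw [div_le_one hρ0]; exact hρ.le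
  have k1 := hmul _ (min_le_left _ _) hi0.le
  have k2 := hmul _ (min_le_right _ _) (div_nonneg (by linarith) hw0.le)
  rw [e8] at k1 k2
  have hle : ls.pGrad + √ls.pF ≤ 1 / 8 := by
    refine k1.trans ?_
    have h1 : (1 - 1 / pen.rho) / 8 * (1 / pen.rho) ≤ 1 / 8 := by nlinarith
    have h2 : 0 ≤ (1 - 1 / pen.rho) / 8 * (1 / pen.rho) :=
      mul_nonneg (by linarith) hi0.le
    nlinarith
  refine ⟨?_, ?_, ?_⟩
  · have h1 := mul_le_mul_of_nonneg_left
      ((le_add_of_nonneg_right hs0).trans k1) hρ0.le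
    refine h1.trans (le_of_eq ?_)
    field_simp
  · have h2 : √ls.pF ≤ (1 - 1 / pen.rho) / 8 * ((1 - w) / w) := by
      refine ((le_add_of_nonneg_left hg0.le).trans k2).trans ?_
      refine mul_le_of_le_one_right (mul_nonneg (by linarith) (div_nonneg (by linarith) hw0.le)) ?_
      linarith
    have h1 := mul_le_mul_of_nonneg_left h2 hw0.le
    refine h1.trans (le_of_eq ?_)
    field_simp
  · have h1 : ls.pF ≤ 1 / 8 * (1 / 8) := by
      rw [← Real.mul_self_sqrt hf0.le]
      exact mul_le_mul (by linarith) (by linarith) hs0 (by norm_num)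
    have h2 : ls.pGrad ≤ 1 / 8 := by linarith
    have h3 : (7 / 8 : ℝ) * (7 / 8) ≤ (1 - ls.pGrad) * (1 - ls.pF) :=
      mul_le_mul (by linarith) (by linarith) (by norm_num) (by linarith)
    linarith

namespace Trajectory

variable {d m : ℕ} {Ξ Ω : Type*} [MeasurableSpace Ξ] [mΩ : MeasurableSpace Ω]
  {R : Trajectory d m Ξ Ω} {Q : Problem d m Ξ} {pen : PenaltyParams} {ls : LineSearchParams}
  {X : Set (Vec d)} {Lam : Set (Vec m)} {M0 M1 M2 : ℝ} {Pr : Measure Ω} {C : Consts}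

/-- The conditions of `GoodPath` hold almost surely; positivity and monotonicity of the penalty
parameters, and termination of the penalty loop, come from `penalty_bounds`. -/
lemma ae_goodPath (hQ : Q.Regular X Lam M0 M1 M2) (hE : R.IsExecution Q pen ls Pr)
    (hI : R.IterateAssumptions Q pen X Lam Pr) (hC : C.Admissible Q X Lam pen R Pr) :
    ∀ᵐ ω ∂Pr, R.GoodPath Q pen ls X Lam M1 M2 C ω := by
  obtain ⟨K, τ, hb⟩ := hQ.exists_bounds
  obtain ⟨K', hS⟩ := hb.exists_stepBound pen.gammaRH_pos pen.kappaB M1 M2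
  filter_upwards [hE.ae_stepAt hI hQ, hI.dir_pos, hE.init, hE.penalty, hC.mu_le, hC.ref_le,
    hC.dir_le, hC.grad_le, hE.lineSearch] with ω h1 h2 h3 h4 h5 h6 h7 h8 h9
  have hp := penalty_bounds hS le_rfl h1 h2 h4
  exact ⟨h1, h2, h3.1, h3.2, fun k => (hp k).1, fun k => (hp k).2.1, fun k => (hp k).2.2.2,
    h5, h6, h7, h8, h9⟩

/-- Deterministic bounds along good paths, which provide integrability. -/
structure PathBounds (Q : Problem d m Ξ) (pen : PenaltyParams) (ls : LineSearchParams)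
    (X : Set (Vec d)) (Lam : Set (Vec m)) (M1 M2 : ℝ) (C : Consts) (R : Trajectory d m Ξ Ω)
    (w T : ℝ) : Prop where
  decrease_le : ∀ {ω}, R.GoodPath Q pen ls X Lam M1 M2 C ω → ∀ k, R.decrease Q pen k ω ≤ T
  gradTerm_nonneg : ∀ {ω}, R.GoodPath Q pen ls X Lam M1 M2 C ω → ∀ k, 0 ≤ R.gradTerm Q pen k ω
  gradTerm_le : ∀ {ω}, R.GoodPath Q pen ls X Lam M1 M2 C ω → ∀ k, R.gradTerm Q pen k ω ≤ T
  eps_le : ∀ {ω}, R.GoodPath Q pen ls X Lam M1 M2 C ω → ∀ k, R.eps k ω ≤ T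
  le_eps : ∀ {ω}, R.GoodPath Q pen ls X Lam M1 M2 C ω → ∀ k,
    ls.eps0 / pen.rho ^ k ≤ R.eps k ω
  potential_le : ∀ {ω}, R.GoodPath Q pen ls X Lam M1 M2 C ω → ∀ k,
    |R.potential Q pen w k ω| ≤ T

omit mΩ in
lemma exists_pathBounds (hQ : Q.Regular X Lam M0 M1 M2) {w : ℝ} (hw : w ∈ Set.Ioo (0 : ℝ) 1) :
    ∃ T, PathBounds Q pen ls X Lam M1 M2 C R w T := by
  obtain ⟨K, τ, hb⟩ := hQ.exists_bounds
  have hν := pen.nu_pos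
  obtain ⟨A, hA0, hA⟩ := hb.exists_meritGrad_bound hν.le C.muTilde M1 M2
  obtain ⟨A', hA'0, hA'⟩ := hb.exists_meritGrad_bound hν.le C.muTilde 0 0
  obtain ⟨Am, hAm0, hAm⟩ := hb.exists_merit_bound hν.le C.muTilde
  obtain ⟨T1, hT1⟩ : ∃ T1, T1 = ls.alphaMax * (A * (C.ups3 * (2 * A * C.ups3 / pen.gammaRH))) :=
    ⟨_, rfl⟩
  obtain ⟨T2, hT2⟩ : ∃ T2, T2 = max ls.eps0 (pen.rho * (ls.beta * T1)) := ⟨_, rfl⟩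
  have hT2p : 0 < T2 := hT2 ▸ lt_max_of_lt_left ls.eps0_pos
  have hαm := ls.alphaMax_pos
  have hT3 : 0 ≤ ls.alphaMax * A' ^ 2 := by positivity
  have hw1 : 0 ≤ 1 - w := by linarith [hw.2]
  have hdec : ∀ {ω}, R.GoodPath Q pen ls X Lam M1 M2 C ω → ∀ k, R.decrease Q pen k ω ≤ T1 :=
    fun h k => hT1 ▸ (h.scale_le hA k).2
  have hgn : ∀ {ω}, R.GoodPath Q pen ls X Lam M1 M2 C ω → ∀ k, 0 ≤ R.gradTerm Q pen k ω :=
    fun h k => mul_nonneg (h.alpha_bounds k).1.le (sq_nonneg _)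
  have hgl : ∀ {ω}, R.GoodPath Q pen ls X Lam M1 M2 C ω → ∀ k,
      R.gradTerm Q pen k ω ≤ ls.alphaMax * A' ^ 2 := fun h k =>
    mul_le_mul (h.alpha_bounds k).2 (pow_le_pow_left₀ (norm_nonneg _)
      (hA' _ (h.muBefore_mem k) _ (h.step k).mem_X _ (h.step k).mem_Lam _ _ (by simp)
        (by simp)) 2) (sq_nonneg _) ls.alphaMax_pos.le
  have hel : ∀ {ω}, R.GoodPath Q pen ls X Lam M1 M2 C ω → ∀ k, R.eps k ω ≤ T2 := fun h k =>
    hT2 ▸ (h.eps_pos_and_le (hdec h) k).2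
  refine ⟨|T1| + ls.alphaMax * A' ^ 2 + T2 + Am, fun h k => ?_, hgn, fun h k => ?_, fun h k => ?_,
    fun h k => (h.eps_pos_and_le (hdec h) k).1, fun {ω} h k => ?_⟩
  · linarith [hdec h k, le_abs_self T1]
  · linarith [hgl h k, abs_nonneg T1]
  · linarith [hel h k, abs_nonneg T1]
  · have h1 := hAm _ (h.muBefore_mem k) _ (h.step k).mem_X _ (h.step k).mem_Lam
    have h2 := hgn h k
    have h3 := hgl h k
    have h4 := h.eps_pos k
    have h5 := hel h k
    have hw0 := hw.1
    unfold potential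
    rw [abs_le] at h1 ⊢
    have m1 : w * Q.merit (R.muBefore pen k ω) pen.nu (R.x k ω) (R.lam k ω) ≤ Am := by
      nlinarith [hw.2]
    have m2 : -Am ≤ w * Q.merit (R.muBefore pen k ω) pen.nu (R.x k ω) (R.lam k ω) := by
      nlinarith [hw.2]
    have m3 : 0 ≤ (1 - w) / 2 * R.gradTerm Q pen k ω := by positivity
    have m4 : 0 ≤ (1 - w) / 2 * R.eps k ω := by positivity
    have m5 : (1 - w) / 2 * R.gradTerm Q pen k ω ≤ ls.alphaMax * A' ^ 2 := by nlinarith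
    have m6 : (1 - w) / 2 * R.eps k ω ≤ T2 := by nlinarith
    have := abs_nonneg T1
    constructor <;> linarith

namespace IsExecution

lemma measurable_gradTerm (hE : R.IsExecution Q pen ls Pr) (hQ : Q.Regular X Lam M0 M1 M2)
    (k : ℕ) : Measurable[R.past k] (R.gradTerm Q pen k) :=
  Measurable.mul (hE.adapted_alpha k) (Measurable.pow_const (measurable_norm.comp
    (Problem.measurable_exactGrad (mΩ := R.past k) hQ.measurable_c (hE.measurable_muBefore k) _
      (hE.adapted_x k) (hE.adapted_lam k))) 2)

lemma measurable_potential (hE : R.IsExecution Q pen ls Pr) (hQ : Q.Regular X Lam M0 M1 M2)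
    (w : ℝ) (k : ℕ) : Measurable (R.potential Q pen w k) := by
  have h1 := Problem.measurable_merit (mΩ := R.past k) hQ.measurable_c hQ.measurable_F
    (hE.measurable_muBefore k) pen.nu (hE.adapted_x k) (hE.adapted_lam k)
  have hp := hE.past_le k
  exact (((h1.mono hp le_rfl).const_mul w).add
    (((hE.measurable_gradTerm hQ k).mono hp le_rfl).const_mul _)).add
    (((hE.adapted_eps k).mono hp le_rfl).const_mul _)

lemma measurable_decrease (hE : R.IsExecution Q pen ls Pr) (hQ : Q.Regular X Lam M0 M1 M2)
    (k : ℕ) : Measurable (R.decrease Q pen k) :=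
  (((hE.adapted_alpha k).mono (hE.past_le k) le_rfl).mul
    ((hE.measurable_slope hQ k).mono (hE.mid_le k) le_rfl)).neg

lemma measurableSet_goodSuccess (hE : R.IsExecution Q pen ls Pr)
    (hQ : Q.Regular X Lam M0 M1 M2) (k : ℕ) : MeasurableSet (R.goodSuccess Q pen ls k) :=
  ((hE.mid_le k _ (hE.measurableSet_eventA hQ k)).inter
    (hE.past_le (k + 1) _ (hE.measurableSet_eventB hQ k))).inter
    (hE.past_le (k + 1) _ (hE.measurableSet_armijo hQ k))

/-- The expected error of the merit values in case of an inaccurate estimate. -/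
lemma integral_totalErr_le [IsProbabilityMeasure Pr] (hE : R.IsExecution Q pen ls Pr)
    (hQ : Q.Regular X Lam M0 M1 M2) {w T : ℝ}
    (hT : PathBounds Q pen ls X Lam M1 M2 C R w T)
    (hgp : ∀ᵐ ω ∂Pr, R.GoodPath Q pen ls X Lam M1 M2 C ω) (k : ℕ) :
    Integrable (fun ω => R.totalErr Q pen k ω *
      (R.eventB Q pen ls k)ᶜ.indicator (fun _ => (1 : ℝ)) ω) Pr ∧
    ∫ ω, R.totalErr Q pen k ω * (R.eventB Q pen ls k)ᶜ.indicator (fun _ => (1 : ℝ)) ω ∂Pr ≤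
      2 * √ls.pF * ∫ ω, R.eps k ω ∂Pr := by
  have hB : MeasurableSet (R.eventB Q pen ls k)ᶜ :=
    (hE.past_le (k + 1) _ (hE.measurableSet_eventB hQ k)).compl
  have hεm : Measurable[R.mid k] (R.eps k) := (hE.adapted_eps k).mono (past_le_mid k) le_rfl
  have hc : 0 < ls.eps0 / pen.rho ^ k :=
    div_pos ls.eps0_pos (pow_pos (zero_lt_one.trans pen.one_lt_rho) k)
  have hε : ∀ᵐ ω ∂Pr, ls.eps0 / pen.rho ^ k ≤ R.eps k ω ∧ R.eps k ω ≤ T := by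
    filter_upwards [hgp] with ω h using ⟨hT.le_eps h k, hT.eps_le h k⟩
  obtain ⟨i1, j1⟩ := integral_abs_mul_indicator_le (hE.mid_le k) hB
    ((hE.measurable_meritErr hQ k).mono (hE.past_le (k + 1)) le_rfl) (hE.variance_merit k).1
    (hE.variance_merit k).2 hεm hc hε ls.pF_mem.1 (hE.accuracy_merit k)
  obtain ⟨i2, j2⟩ := integral_abs_mul_indicator_le (hE.mid_le k) hB
    ((hE.measurable_meritErrTrial hQ k).mono (hE.past_le (k + 1)) le_rfl) (hE.variance_trial k).1
    (hE.variance_trial k).2 hεm hc hε ls.pF_mem.1 (hE.accuracy_merit k)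
  have e : (fun ω => R.totalErr Q pen k ω *
      (R.eventB Q pen ls k)ᶜ.indicator (fun _ => (1 : ℝ)) ω) = fun ω =>
      |R.meritErr Q pen k ω| * (R.eventB Q pen ls k)ᶜ.indicator (fun _ => (1 : ℝ)) ω +
      |R.meritErrTrial Q pen k ω| * (R.eventB Q pen ls k)ᶜ.indicator (fun _ => (1 : ℝ)) ω := by
    funext ω
    unfold totalErr
    ring
  rw [e]
  refine ⟨i1.add i2, ?_⟩
  rw [integral_add i1 i2]
  linarith

/-- The expected potential decreases by a multiple of the expected decrease predicted in good
successful steps, up to the telescoping contribution of the penalty parameter. -/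
theorem integral_potential_le [IsProbabilityMeasure Pr] (hE : R.IsExecution Q pen ls Pr)
    (hQ : Q.Regular X Lam M0 M1 M2) (hI : R.IterateAssumptions Q pen X Lam Pr)
    (hC : C.Admissible Q X Lam pen R Pr) {w T : ℝ} (hw : w ∈ Set.Ioo (0 : ℝ) 1)
    (hΩ : OmegaCondition pen ls C w) (hP : ProbCondition pen ls w)
    (hT : PathBounds Q pen ls X Lam M1 M2 C R w T) :
    ∃ c, 0 ≤ c ∧ ∀ k, Integrable (R.potential Q pen w k) Pr ∧
      Integrable (R.muBefore pen k) Pr ∧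
      Integrable ((R.goodSuccess Q pen ls k).indicator (R.decrease Q pen k)) Pr ∧
      ∫ ω, R.potential Q pen w (k + 1) ω ∂Pr - ∫ ω, R.potential Q pen w k ω ∂Pr ≤
        -(w * ls.beta / 8 *
          ∫ ω, (R.goodSuccess Q pen ls k).indicator (R.decrease Q pen k) ω ∂Pr) +
        c * (∫ ω, R.muBefore pen (k + 1) ω ∂Pr - ∫ ω, R.muBefore pen k ω ∂Pr) := by
  have hgp := ae_goodPath hQ hE hI hC
  obtain ⟨U, hXU, hU⟩ := hQ.exists_smoothOn
  obtain ⟨K, τ, hb⟩ := hQ.exists_bounds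
  obtain ⟨A, hA0, hA⟩ := hb.exists_meritGrad_bound pen.nu_pos.le C.muTilde 0 0
  have hA' : ∀ μ ∈ Set.Icc 0 C.muTilde, ∀ x ∈ X, ∀ l ∈ Lam, ‖Q.exactGrad μ pen.nu x l‖ ≤ A :=
    fun μ hμ x hx l hl => hA μ hμ x hx l hl _ _ (by simp) (by simp)
  obtain ⟨p1, p2, -⟩ := hP.consequences hw
  have hρ := pen.one_lt_rho
  have hρ0 : 0 < pen.rho := zero_lt_one.trans hρ
  have hw1 : 0 < 1 - w := by linarith [hw.2]
  have hαm := ls.alphaMax_pos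
  have ipot : ∀ k, Integrable (R.potential Q pen w k) Pr := fun k =>
    Integrable.of_bound (hE.measurable_potential hQ w k).aestronglyMeasurable T (by
      filter_upwards [hgp] with ω h using hT.potential_le h k)
  have imu : ∀ k, Integrable (R.muBefore pen k) Pr := fun k =>
    Integrable.of_bound ((hE.measurable_muBefore k).mono (hE.past_le k)
      le_rfl).aestronglyMeasurable C.muTilde (by
      filter_upwards [hgp] with ω h
      rw [Real.norm_of_nonneg (h.muBefore_mem k).1]
      exact (h.muBefore_mem k).2)
  have idec : ∀ k, Integrable ((R.goodSuccess Q pen ls k).indicator (R.decrease Q pen k)) Pr :=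
    fun k => (Integrable.of_bound (hE.measurable_decrease hQ k).aestronglyMeasurable T (by
      filter_upwards [hgp] with ω h
      rw [Real.norm_of_nonneg (h.decrease_pos k).le]
      exact hT.decrease_le h k)).indicator (hE.measurableSet_goodSuccess hQ k)
  refine ⟨K ^ 2 / 2 + (2 + pen.rho) * ls.alphaMax * (K ^ 2 * (2 * A)), by positivity, fun k =>
    ⟨ipot k, imu k, idec k, ?_⟩⟩
  have hAc : MeasurableSet (R.eventA Q pen ls k)ᶜ :=
    (hE.mid_le k _ (hE.measurableSet_eventA hQ k)).compl
  have hgm := hE.measurable_gradTerm hQ k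
  have hgms : AEStronglyMeasurable (R.gradTerm Q pen k) Pr :=
    (hgm.mono (hE.past_le k) le_rfl).aestronglyMeasurable
  have hg0 : 0 ≤ᵐ[Pr] R.gradTerm Q pen k := by
    filter_upwards [hgp] with ω h using hT.gradTerm_nonneg h k
  have hgT : ∀ᵐ ω ∂Pr, R.gradTerm Q pen k ω ≤ T := by
    filter_upwards [hgp] with ω h using hT.gradTerm_le h k
  have hgb : ∀ᵐ ω ∂Pr, ‖R.gradTerm Q pen k ω‖ ≤ T := by
    filter_upwards [hg0, hgT] with ω h1 h2
    rwa [Real.norm_of_nonneg h1]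
  have igrad : Integrable (R.gradTerm Q pen k) Pr := Integrable.of_bound hgms T hgb
  have ieps : Integrable (R.eps k) Pr :=
    Integrable.of_bound ((hE.adapted_eps k).mono (hE.past_le k)
      le_rfl).aestronglyMeasurable T (by
      filter_upwards [hgp] with ω h
      rw [Real.norm_of_nonneg (h.eps_pos k).le]
      exact hT.eps_le h k)
  have igA : Integrable (fun ω => R.gradTerm Q pen k ω *
      (R.eventA Q pen ls k)ᶜ.indicator (fun _ => (1 : ℝ)) ω) Pr :=
    ((integrable_const (1 : ℝ)).indicator hAc).bdd_mul hgms hgb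
  obtain ⟨iE, hEle⟩ := hE.integral_totalErr_le hQ hT hgp k
  have hgA := integral_mul_indicator_le (hE.past_le k) hAc hgm hg0 hgT (hE.accuracy_grad k)
  have hmain := integral_le_of_ae_le_combination ((ipot (k + 1)).sub (ipot k)) igrad ieps igA iE
    (idec k) ((imu (k + 1)).sub (imu k)) (by
      filter_upwards [hgp] with ω h using h.potential_descent hU hXU hQ.convex_X hQ.convex_Lam
        hC.hess_le hw hΩ hb hA' k)
  rw [integral_sub' (ipot (k + 1)) (ipot k), integral_sub' (imu (k + 1)) (imu k)] at hmain
  have hgrad0 : 0 ≤ ∫ ω, R.gradTerm Q pen k ω ∂Pr := integral_nonneg_of_ae hg0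
  have heps0 : 0 ≤ ∫ ω, R.eps k ω ∂Pr := integral_nonneg_of_ae (by
    filter_upwards [hgp] with ω h using (h.eps_pos k).le)
  have hi1 : 1 / pen.rho ≤ 1 := by rw [div_le_one hρ0]; exact hρ.le
  have hc0 : 0 ≤ (1 - w) * pen.rho + (1 - w) / 2 * (1 - 1 / pen.rho) :=
    add_nonneg (by positivity) (mul_nonneg (by positivity) (by linarith))
  have hpG := ls.pGrad_mem
  -- the terms of inaccurate gradients are absorbed
  have m1 := mul_le_mul_of_nonneg_left hgA hc0
  have n1 : ((1 - w) * pen.rho + (1 - w) / 2 * (1 - 1 / pen.rho)) *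
      (ls.pGrad * ∫ ω, R.gradTerm Q pen k ω ∂Pr) ≤
      (1 - w) / 2 * (1 - 1 / pen.rho) * ∫ ω, R.gradTerm Q pen k ω ∂Pr := by
    rw [← mul_assoc]
    refine mul_le_mul_of_nonneg_right ?_ hgrad0
    have t : pen.rho * ls.pGrad + 1 / 2 * (1 - 1 / pen.rho) * ls.pGrad ≤
        1 / 2 * (1 - 1 / pen.rho) := by
      have : 0 ≤ (1 - ls.pGrad) * (1 - 1 / pen.rho) :=
        mul_nonneg (by linarith [hpG.2]) (by linarith)
      linarith
    have := mul_le_mul_of_nonneg_left t hw1.le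
    linarith
  -- so are those of inaccurate merit values
  have m2 := mul_le_mul_of_nonneg_left hEle hw.1.le
  have n2 : w * (2 * √ls.pF * ∫ ω, R.eps k ω ∂Pr) ≤
      (1 - w) / 2 * (1 - 1 / pen.rho) * ∫ ω, R.eps k ω ∂Pr := by
    rw [← mul_assoc]
    refine mul_le_mul_of_nonneg_right ?_ heps0
    have : 0 ≤ (1 - w) * (1 - 1 / pen.rho) := mul_nonneg hw1.le (by linarith)
    linarith
  linarith

/-- The decrease predicted in good successful steps tends to zero, being summable. -/
theorem ae_tendsto_decrease [IsProbabilityMeasure Pr] (hE : R.IsExecution Q pen ls Pr)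
    (hQ : Q.Regular X Lam M0 M1 M2) (hI : R.IterateAssumptions Q pen X Lam Pr)
    (hC : C.Admissible Q X Lam pen R Pr) {w : ℝ} (hw : w ∈ Set.Ioo (0 : ℝ) 1)
    (hΩ : OmegaCondition pen ls C w) (hP : ProbCondition pen ls w) :
    ∀ᵐ ω ∂Pr, Tendsto
      (fun k => (R.goodSuccess Q pen ls k).indicator (R.decrease Q pen k) ω) atTop (𝓝 0) := by
  have hgp := ae_goodPath hQ hE hI hC
  obtain ⟨T, hT⟩ := exists_pathBounds (pen := pen) (ls := ls) (C := C) (R := R) hQ hw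
  obtain ⟨c, hc, hstep⟩ := hE.integral_potential_le hQ hI hC hw hΩ hP hT
  have hw0 := hw.1
  have hβ := ls.beta_mem.1
  have hwβ : 0 < w * ls.beta / 8 := by positivity
  have hpotle : ∀ k, |∫ ω, R.potential Q pen w k ω ∂Pr| ≤ T := fun k => by
    have := norm_integral_le_of_norm_le_const (μ := Pr) (f := R.potential Q pen w k) (C := T) (by
      filter_upwards [hgp] with ω h using hT.potential_le h k)
    simpa using this
  have hmule : ∀ k, |∫ ω, R.muBefore pen k ω ∂Pr| ≤ C.muTilde := fun k => by
    have := norm_integral_le_of_norm_le_const (μ := Pr) (f := R.muBefore pen k) (C := C.muTilde)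
      (by
        filter_upwards [hgp] with ω h
        rw [Real.norm_of_nonneg (h.muBefore_mem k).1]
        exact (h.muBefore_mem k).2)
    simpa using this
  refine ae_tendsto_zero_of_sum_integral_le (C := (2 * T + c * (2 * C.muTilde)) /
    (w * ls.beta / 8)) (fun k => (hstep k).2.2.1) (fun k => ?_) (fun n => ?_)
  · filter_upwards [hgp] with ω h
    exact Set.indicator_apply_nonneg fun _ => (h.decrease_pos k).le
  · rw [le_div_iff₀ hwβ, mul_comm, Finset.mul_sum]
    have h1 := Finset.sum_le_sum fun k (_ : k ∈ Finset.range n) => (hstep k).2.2.2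
    rw [Finset.sum_range_sub (fun k => ∫ ω, R.potential Q pen w k ω ∂Pr), Finset.sum_add_distrib,
      Finset.sum_neg_distrib, ← Finset.mul_sum _ _ c,
      Finset.sum_range_sub (fun k => ∫ ω, R.muBefore pen k ω ∂Pr)] at h1
    have h2 := abs_le.1 (hpotle n)
    have h3 := abs_le.1 (hpotle 0)
    have h4 := abs_le.1 (hmule n)
    have h5 := abs_le.1 (hmule 0)
    have h6 : c * (∫ ω, R.muBefore pen n ω ∂Pr - ∫ ω, R.muBefore pen 0 ω ∂Pr) ≤
        c * (2 * C.muTilde) := mul_le_mul_of_nonneg_left (by linarith) hc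
    linarith

/-- Both estimates are accurate with conditional probability at least `(1 - p_grad)(1 - p_f)`. -/
lemma le_integral_mul_good [IsProbabilityMeasure Pr] (hE : R.IsExecution Q pen ls Pr)
    (hQ : Q.Regular X Lam M0 M1 M2) (k : ℕ) {W : Ω → ℝ} (hW : Measurable[R.past k] W)
    (hW0 : ∀ ω, 0 ≤ W ω) {T : ℝ} (hWT : ∀ ω, W ω ≤ T) :
    (1 - ls.pGrad) * (1 - ls.pF) * ∫ ω, W ω ∂Pr ≤
      ∫ ω, W ω * (R.eventA Q pen ls k ∩ R.eventB Q pen ls k).indicator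
        (fun _ => (1 : ℝ)) ω ∂Pr := by
  have hA := hE.measurableSet_eventA hQ k
  have hAm := hE.mid_le k _ hA
  have hB := hE.past_le (k + 1) _ (hE.measurableSet_eventB hQ k)
  have hWm : Measurable W := hW.mono (hE.past_le k) le_rfl
  have hWn : ∀ ω, ‖W ω‖ ≤ T := fun ω => by
    rw [Real.norm_of_nonneg (hW0 ω)]
    exact hWT ω
  have iW : Integrable W Pr :=
    Integrable.of_bound hWm.aestronglyMeasurable T (Eventually.of_forall hWn)
  have hVm : Measurable[R.mid k] fun ω =>
      W ω * (R.eventA Q pen ls k).indicator (fun _ => (1 : ℝ)) ω :=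
    Measurable.mul (hW.mono (past_le_mid k) le_rfl)
      (Measurable.indicator (mβ := inferInstance) measurable_const hA)
  have h1 := integral_mul_indicator_le (hE.past_le k) hAm.compl hW (Eventually.of_forall hW0)
    (Eventually.of_forall hWT) (hE.accuracy_grad k)
  have h2 := integral_mul_indicator_le (hE.mid_le k) hB.compl hVm
    (Eventually.of_forall fun ω => mul_nonneg (hW0 ω)
      (Set.indicator_nonneg (fun _ _ => zero_le_one) ω))
    (C := T) (Eventually.of_forall fun ω => (mul_le_of_le_one_right (hW0 ω)
      (Set.indicator_le_self' (f := fun _ => (1 : ℝ)) (fun _ _ => zero_le_one) ω)).trans (hWT ω))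
    (hE.accuracy_merit k)
  have hi : ∀ {s : Set Ω}, MeasurableSet s →
      Integrable (fun ω => W ω * s.indicator (fun _ => (1 : ℝ)) ω) Pr := fun hs =>
    ((integrable_const (1 : ℝ)).indicator hs).bdd_mul hWm.aestronglyMeasurable
      (Eventually.of_forall hWn)
  have e1 : ∫ ω, W ω * (R.eventA Q pen ls k)ᶜ.indicator (fun _ => (1 : ℝ)) ω ∂Pr =
      ∫ ω, W ω ∂Pr - ∫ ω, W ω * (R.eventA Q pen ls k).indicator (fun _ => (1 : ℝ)) ω ∂Pr := by
    rw [← integral_sub iW (hi hAm)]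
    refine integral_congr_ae (Eventually.of_forall fun ω => ?_)
    by_cases h : ω ∈ R.eventA Q pen ls k <;> simp [h]
  have e2 : ∫ ω, W ω * (R.eventA Q pen ls k).indicator (fun _ => (1 : ℝ)) ω *
        (R.eventB Q pen ls k)ᶜ.indicator (fun _ => (1 : ℝ)) ω ∂Pr =
      ∫ ω, W ω * (R.eventA Q pen ls k).indicator (fun _ => (1 : ℝ)) ω ∂Pr -
        ∫ ω, W ω * (R.eventA Q pen ls k ∩ R.eventB Q pen ls k).indicator
          (fun _ => (1 : ℝ)) ω ∂Pr := by
    rw [← integral_sub (hi hAm) (hi (hAm.inter hB))]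
    refine integral_congr_ae (Eventually.of_forall fun ω => ?_)
    by_cases h : ω ∈ R.eventA Q pen ls k <;> by_cases h' : ω ∈ R.eventB Q pen ls k <;>
      simp [h, h']
  rw [e1] at h1
  rw [e2] at h2
  have h3 := mul_le_mul_of_nonneg_left (by linarith : (1 - ls.pGrad) * ∫ ω, W ω ∂Pr ≤
    ∫ ω, W ω * (R.eventA Q pen ls k).indicator (fun _ => (1 : ℝ)) ω ∂Pr)
    (by linarith [ls.pF_mem.2] : 0 ≤ 1 - ls.pF)
  linarith

/-- Infinitely many good steps are successful with a stepsize bounded away from zero. -/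
theorem ae_frequently_goodSuccess [IsProbabilityMeasure Pr] (hE : R.IsExecution Q pen ls Pr)
    (hQ : Q.Regular X Lam M0 M1 M2) (hI : R.IterateAssumptions Q pen X Lam Pr)
    (hC : C.Admissible Q X Lam pen R Pr)
    (hq : 1 / 2 < (1 - ls.pGrad) * (1 - ls.pF)) :
    ∃ a > 0, ∀ᵐ ω ∂Pr, ∃ᶠ k in atTop, ω ∈ R.goodSuccess Q pen ls k ∧ a ≤ R.alpha k ω := by
  classical
  obtain ⟨U, hXU, hU⟩ := hQ.exists_smoothOn
  obtain ⟨K, τ, hb⟩ := hQ.exists_bounds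
  obtain ⟨A, hA0, hA⟩ := hb.exists_meritGrad_bound pen.nu_pos.le C.muTilde M1 M2
  obtain ⟨αt, hαt, hsucc⟩ := exists_success_threshold (Ω := Ω) (ls := ls) (C := C) hU hXU
    hQ.compact_X hQ.compact_Lam hA0 hA
  have hr1 : 1 / (2 * ((1 - ls.pGrad) * (1 - ls.pF))) < 1 := by
    rw [div_lt_one (by linarith)]
    linarith
  obtain ⟨a, ha, hfreq⟩ := frequently_good_success pen.one_lt_rho ls.alphaMax_pos hαt
    (by positivity : 0 < 1 / (2 * ((1 - ls.pGrad) * (1 - ls.pF)))) hr1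
  have hprod := ae_tendsto_prod_zero (ℱ := R.past)
    (good := fun k => R.eventA Q pen ls k ∩ R.eventB Q pen ls k) past_mono hE.past_le
    (fun k => (mid_le_past_succ k _ (hE.measurableSet_eventA hQ k)).inter
      (hE.measurableSet_eventB hQ k)) hq
    (fun k W hW hW0 T hWT => hE.le_integral_mul_good hQ k hW hW0 hWT)
  refine ⟨a, ha, ?_⟩
  filter_upwards [ae_goodPath hQ hE hI hC, hprod] with ω h hlim
  refine (hfreq (fun k => R.alpha k ω)
    (fun k => ω ∈ R.eventA Q pen ls k ∩ R.eventB Q pen ls k)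
    (fun k => R.Armijo Q pen ls k ω) h.alpha_zero (fun k hk => ((h.lineSearch k).success hk).2.2)
    (fun k hk => ((h.lineSearch k).failure hk).2.2.1)
    (fun k hk hα => hsucc R ω h k hk.1 hk.2 hα) ?_).mono fun k hk => ⟨⟨hk.1, hk.2.1⟩, hk.2.2⟩
  convert hlim

/-- Along an execution the KKT residual comes arbitrarily close to zero infinitely often. -/
theorem ae_frequently_kktResidual_lt [IsProbabilityMeasure Pr] (hE : R.IsExecution Q pen ls Pr)
    (hQ : Q.Regular X Lam M0 M1 M2) (hI : R.IterateAssumptions Q pen X Lam Pr)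
    (hC : C.Admissible Q X Lam pen R Pr) {w : ℝ} (hw : w ∈ Set.Ioo (0 : ℝ) 1)
    (hΩ : OmegaCondition pen ls C w) (hP : ProbCondition pen ls w) :
    ∀ᵐ ω ∂Pr, ∀ δ > 0, ∃ᶠ k in atTop, Q.kktResidual (R.x k ω) (R.lam k ω) < δ := by
  obtain ⟨K, τ, hb⟩ := hQ.exists_bounds
  obtain ⟨K', hS⟩ := hb.exists_stepBound pen.gammaRH_pos pen.kappaB M1 M2
  have hr : 0 ≤ ls.kappaGrad * ls.alphaMax * |C.ups1| := by
    have := ls.kappaGrad_pos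
    have := ls.alphaMax_pos
    positivity
  obtain ⟨A, hA0, hA⟩ := hb.exists_kkt_bound hS pen.nu_pos hr
  obtain ⟨a, ha, hfreq⟩ := hE.ae_frequently_goodSuccess hQ hI hC (hP.consequences hw).2.2
  filter_upwards [ae_goodPath hQ hE hI hC, hfreq, hE.ae_tendsto_decrease hQ hI hC hw hΩ hP]
    with ω h hf hlim δ hδ
  have hγ := pen.gammaRH_pos
  -- a predicted decrease below this value forces `‖sₖ‖ < δ / (A + 1)`
  have hη : 0 < a * (pen.gammaRH / 2) * (δ / (A + 1)) ^ 2 := by positivity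
  refine (hf.and_eventually (hlim.eventually_lt_const hη)).mono fun k hk => ?_
  obtain ⟨⟨hgood, hak⟩, hlt⟩ := hk
  rw [Set.indicator_of_mem hgood] at hlt
  have hs : ‖R.scaleVec Q k ω‖ < δ / (A + 1) := by
    have h1 := (h.le_decrease k).trans_lt hlt
    have h2 : a * (pen.gammaRH / 2) * ‖R.scaleVec Q k ω‖ ^ 2 ≤
        R.alpha k ω * (pen.gammaRH / 2) * ‖R.scaleVec Q k ω‖ ^ 2 := by gcongr
    exact lt_of_pow_lt_pow_left₀ 2 (by positivity)
      (lt_of_mul_lt_mul_left (h2.trans_lt h1) (by positivity))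
  -- the gradient error does not depend on the penalty parameter, which is taken as zero
  have herr : ‖R.meritGradBar Q pen k ω 0 - Q.exactGrad 0 pen.nu (R.x k ω) (R.lam k ω)‖ ≤
      ls.kappaGrad * ls.alphaMax * |C.ups1| * ‖R.scaleVec Q k ω‖ := by
    refine (h.norm_grad_error_le hgood.1.1 0).trans ?_
    refine mul_le_mul_of_nonneg_right ?_ (norm_nonneg _)
    exact mul_le_mul (mul_le_mul_of_nonneg_left (h.alpha_bounds k).2 ls.kappaGrad_pos.le)
      (le_abs_self _) h.ups1_nonneg (mul_nonneg ls.kappaGrad_pos.le ls.alphaMax_pos.le)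
  have hkkt : Q.kktResidual (R.x k ω) (R.lam k ω) ≤ A * ‖R.scaleVec Q k ω‖ :=
    hA (h.step k) 0 herr
  have hlt' := (lt_div_iff₀ (by positivity : (0 : ℝ) < A + 1)).1 hs
  linarith [norm_nonneg (R.scaleVec Q k ω), mul_comm A ‖R.scaleVec Q k ω‖]

end IsExecution

end Trajectory

theorem mainTheorem1 {d m : ℕ} {Ξ : Type*} [MeasurableSpace Ξ] (Q : Problem d m Ξ)
    (X : Set (Vec d)) (Lam : Set (Vec m)) (M0 M1 M2 : ℝ) (hQ : Q.Regular X Lam M0 M1 M2)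
    (pen : PenaltyParams) :
    (∃ C : Consts, ∀ (Ω : Type*) [MeasurableSpace Ω] (Pr : Measure Ω) [IsProbabilityMeasure Pr]
      (ls : LineSearchParams) (R : Trajectory d m Ξ Ω),
      R.IsExecution Q pen ls Pr → R.IterateAssumptions Q pen X Lam Pr →
      C.Admissible Q X Lam pen R Pr) ∧
    (∀ (Ω : Type*) [MeasurableSpace Ω] (Pr : Measure Ω) [IsProbabilityMeasure Pr]
      (ls : LineSearchParams) (R : Trajectory d m Ξ Ω),
      R.IsExecution Q pen ls Pr → R.IterateAssumptions Q pen X Lam Pr →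
      ∀ C : Consts, C.Admissible Q X Lam pen R Pr →
      ∀ w ∈ Set.Ioo (0 : ℝ) 1, OmegaCondition pen ls C w → ProbCondition pen ls w →
      ∀ᵐ ω ∂Pr,
        liminf (fun k => ENNReal.ofReal (Q.kktResidual (R.x k ω) (R.lam k ω))) atTop = 0) := by
  refine ⟨hQ.exists_consts pen, fun Ω _ Pr _ ls R hE hI C hC w hw hΩ hP => ?_⟩
  filter_upwards [hE.ae_frequently_kktResidual_lt hQ hI hC hw hΩ hP] with ω h
  refine le_antisymm (ENNReal.le_of_forall_pos_le_add fun δ hδ _ => ?_) bot_le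
  rw [zero_add]
  refine liminf_le_of_frequently_le' ((h δ (by exact_mod_cast hδ)).mono fun k hk => ?_)
  exact ENNReal.ofReal_le_of_le_toReal hk.le
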